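/- Let $K\ge 1$, $R>0$ and $M<\infty$. There exist constants $0<c,c',C,\bar C<\infty$, depending only on $K$, $R$ and $M$, such that the following holds. Let $n\ge 2$ and let $p\in(0,1]$ satisfy $$p\ \ge\ \frac{\bar C\log n}{n}.$$ Let $\delta_{i,j}$ and $\xi_{i,j}$ ($i,j\in\{1,\dots,n\}$, $i\ne j$) be jointly independent real random variables on a probability space, where each $\delta_{i,j}$ is Bernoulli, equal to $1$ with probability $p$ and to $0$ with probability $1-p$, and the $\xi_{i,j}$ are identically distributed with $\mathbb E\,\xi_{i,j}=0$, $\operatorname{Var}\xi_{i,j}=1$ and $\mathbb E\,\xi_{i,j}^4\le M$. Let $\bar A_n$ be the $n\times n$ matrix with zero diagonal and off-diagonal entries $\delta_{i,j}\xi_{i,j}$, and let $D_n$ be a non-random real diagonal $n\times n$ matrix with $\|D_n\|\le R\sqrt{np}$. Here $\|\cdot\|$ is the operator norm with respect to the Euclidean norm $\|\cdot\|_2$, and $s_{\min}(B)=\inf\{\|Bx\|_2:\ x\in\mathbb R^n,\ \|x\|_2=1\}$ is the smallest singular value. Then for every $\varepsilon>0$, $$\mathbb P\left(\left\{s_{\min}(\bar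 A_n+D_n)\le C\,\varepsilon\,\exp\left(-c\,\frac{\log(1/p)}{\log(np)}\right)\sqrt{\frac pn}\right\}\cap\left\{\|\bar A_n\|\le K\sqrt{np}\right\}\right)\ \le\ \varepsilon+\exp(-c'np).$$ -/

import Mathlib

open MeasureTheory ProbabilityTheory
open scoped Matrix.Norms.L2Operator

/-- The off-diagonal positions of an `n × n` matrix. -/
abbrev OffDiag (n : ℕ) : Type := {e : Fin n × Fin n // e.1 ≠ e.2}

/-- The `n × n` matrix with zero diagonal and off-diagonal entries `δ (i, j) * ξ (i, j)`. -/
def zeroDiagMatrix {n : ℕ} (δ ξ : OffDiag n → ℝ) : Matrix (Fin n) (Fin n) ℝ :=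
  Matrix.of fun i j => if h : i ≠ j then δ ⟨(i, j), h⟩ * ξ ⟨(i, j), h⟩ else 0

/-- The smallest singular value `inf {‖A x‖₂ : ‖x‖₂ = 1}` of a square real matrix of size `n ≥ 1`. -/
noncomputable def sMin {n : ℕ} (A : Matrix (Fin n) (Fin n) ℝ) : ℝ :=
  sInf ((fun x : EuclideanSpace ℝ (Fin n) => ‖Matrix.toEuclideanLin A x‖) '' Metric.sphere 0 1)

/-! Put T = np. The diagonal is absorbed into the matrix, so that A has independent off-diagonal
entries, a deterministic diagonal and, on the event considered, norm at most (K + R)√T. The argument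
is invertibility via distances, adapted to sparse matrices. If ‖Ax‖ ≤ τ for a unit x, pairing Ax
with a unit vector v orthogonal to all columns but the j-th gives |⟨col_j, v⟩| ≤ τ/|x_j|. Two facts
therefore suffice. First, an almost null x has a positive proportion of coordinates of size at least
of order ρ/√n (`exists_matLaw_few_large_le`). Second, a unit null vector v of the other columns,
which may be chosen independently of col_j, satisfies P(|⟨col_j, v⟩| ≤ t) ≲ t/(ρ√p) + exp(-cT), off
an event of exponentially small probability (`exists_matLaw_not_smallBall_le`). Markov's inequality
for the number of close columns then gives ε + exp(-c'T) at τ of order ερ²√(p/n).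

The loss ρ (`spreadLevel`) comes from sparsity. A set of at most a small multiple of 1/p columns has
few collisions, so many rows meet it in exactly one entry (`Expands`). Hence, if Ax is small and x
has little mass outside its k' largest coordinates, it has little mass outside its k largest ones,
for k' about √T·k, up to a constant factor (`Expands.tailNorm_sq_sub_le`). About log(1/p)/log T such
steps lead from one coordinate to 1/p coordinates, so a unit almost null x keeps mass at least ρ
outside every set of m ≈ c₀/p coordinates. This yields x = N(g + y) with N ≥ ρ, a head g on at most
m coordinates, and a unit body y, supported elsewhere, with entries O(√p) (`Expands.exists_split`).

The head is harmless. Its net has entropy about m log n, small compared with n because np ≥ C log n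
and ‖g‖ ≤ 1/ρ is polynomial in n; and the bounds on characteristic functions only see y, the
supports being disjoint. The body is treated as in the dense case. Flat bodies close to sn-sparse
vectors have a net of size exp(small·n), while each net point is almost null with probability
exp(-cn), so y is spread. For null vectors, all dilations θy up to exp(wT) moreover avoid the
integer lattice: rational points q/D form a net of size (CD/√n)^n, each being almost null with
probability (Cα√n/D)^(n-1), and α is small (`exists_matLaw_structured_le`). Esseen's inequality
turns distance to the lattice into the small ball estimate.

The entries enter only through `SparseLaw`, which follows from four moments by symmetrization. Rows
are indexed by an injection `r` into the positions, so that one set of estimates covers both the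
full matrix and the matrix with one row deleted. -/

/-! ### Euclidean norms of plain functions -/

/-- The Euclidean norm of a real function on a finite type. -/
noncomputable def l2 {ι : Type*} [Fintype ι] (x : ι → ℝ) : ℝ := √(∑ i, x i ^ 2)

section l2

variable {ι : Type*} [Fintype ι]

theorem l2_eq_norm (x : ι → ℝ) : l2 x = ‖(WithLp.toLp 2 x : EuclideanSpace ℝ ι)‖ := by
  simp [l2, EuclideanSpace.norm_eq]

theorem l2_nonneg (x : ι → ℝ) : 0 ≤ l2 x := Real.sqrt_nonneg _

theorem l2_sq (x : ι → ℝ) : l2 x ^ 2 = ∑ i, x i ^ 2 :=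
  Real.sq_sqrt (Finset.sum_nonneg fun _ _ => sq_nonneg _)

theorem l2_add_le (x y : ι → ℝ) : l2 (x + y) ≤ l2 x + l2 y := by
  simp only [l2_eq_norm, WithLp.toLp_add]
  exact norm_add_le _ _

theorem l2_neg (x : ι → ℝ) : l2 (-x) = l2 x := by simp [l2]

theorem l2_zero : l2 (0 : ι → ℝ) = 0 := by simp [l2]

theorem l2_sub_le (x y : ι → ℝ) : l2 (x - y) ≤ l2 x + l2 y := by
  rw [sub_eq_add_neg]
  exact (l2_add_le _ _).trans (by rw [l2_neg])

theorem l2_sub_comm (x y : ι → ℝ) : l2 (x - y) = l2 (y - x) := by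
  rw [← l2_neg, neg_sub]

theorem l2_smul (c : ℝ) (x : ι → ℝ) : l2 (c • x) = |c| * l2 x := by
  simp only [l2_eq_norm, WithLp.toLp_smul, norm_smul, Real.norm_eq_abs]

theorem l2_le_of_sq_le {x : ι → ℝ} {a : ℝ} (ha : 0 ≤ a) (h : ∑ i, x i ^ 2 ≤ a ^ 2) : l2 x ≤ a :=
  Real.sqrt_le_iff.mpr ⟨ha, h⟩

theorem l2_mono {x y : ι → ℝ} (h : ∀ i, |x i| ≤ |y i|) : l2 x ≤ l2 y :=
  Real.sqrt_le_sqrt (Finset.sum_le_sum fun i _ => sq_le_sq.mpr (h i))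

theorem abs_le_l2 (x : ι → ℝ) (i : ι) : |x i| ≤ l2 x :=
  Real.abs_le_sqrt (Finset.single_le_sum (f := fun i => x i ^ 2) (fun _ _ => sq_nonneg _)
    (Finset.mem_univ i))

theorem l2_le_of_abs_le {x : ι → ℝ} {a : ℝ} (ha : 0 ≤ a) (h : ∀ i, |x i| ≤ a) :
    l2 x ≤ √(Fintype.card ι) * a := by
  refine l2_le_of_sq_le (by positivity) ?_
  rw [mul_pow, Real.sq_sqrt (by positivity)]
  calc ∑ i, x i ^ 2 ≤ ∑ _i : ι, a ^ 2 :=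
        Finset.sum_le_sum fun i _ => sq_le_sq.mpr (by rw [abs_of_nonneg ha]; exact h i)
    _ = _ := by simp

theorem sum_abs_le_sqrt_card_mul_l2 (x : ι → ℝ) (S : Finset ι) :
    ∑ i ∈ S, |x i| ≤ √(S.card) * l2 x := by
  refine (Real.le_sqrt_of_sq_le (sq_sum_le_card_mul_sum_sq (s := S) (f := fun i => |x i|))).trans ?_
  rw [Real.sqrt_mul (by positivity)]
  refine mul_le_mul_of_nonneg_left (Real.sqrt_le_sqrt ?_) (Real.sqrt_nonneg _)
  simp only [sq_abs]
  exact Finset.sum_le_sum_of_subset_of_nonneg (Finset.subset_univ _) fun _ _ _ => sq_nonneg _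

theorem continuous_l2 : Continuous (l2 : (ι → ℝ) → ℝ) := by
  unfold l2; fun_prop

end l2

/-! ### Restrictions of vectors and best sparse approximation. -/

section off

variable {ι : Type*} [DecidableEq ι]

/-- The vector `x` with the coordinates in `S` replaced by zero. -/
def off (x : ι → ℝ) (S : Finset ι) : ι → ℝ := fun j => if j ∈ S then 0 else x j

/-- The vector `x` with the coordinates outside `S` replaced by zero. -/
def on (x : ι → ℝ) (S : Finset ι) : ι → ℝ := fun j => if j ∈ S then x j else 0

theorem on_add_off (x : ι → ℝ) (S : Finset ι) : on x S + off x S = x := by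
  ext j; by_cases h : j ∈ S <;> simp [on, off, h]

variable [Fintype ι]

theorem l2_off_sq (x : ι → ℝ) (S : Finset ι) : l2 (off x S) ^ 2 = ∑ j ∈ Sᶜ, x j ^ 2 := by
  rw [l2_sq, ← Finset.sum_subset (Finset.subset_univ (Sᶜ))]
  · exact Finset.sum_congr rfl fun j hj => by simp [off, Finset.mem_compl.mp hj]
  · intro j _ hj; simp [off, by simpa using hj]

theorem l2_on_le (x : ι → ℝ) (S : Finset ι) : l2 (on x S) ≤ l2 x :=
  l2_mono fun j => by by_cases h : j ∈ S <;> simp [on, h]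

/-- The error of the best approximation of `x` by a vector with at most `m` nonzero coordinates. -/
noncomputable def tailNorm (x : ι → ℝ) (m : ℕ) : ℝ :=
  ⨅ S : {S : Finset ι // S.card ≤ m}, l2 (off x S.1)

instance (m : ℕ) : Nonempty {S : Finset ι // S.card ≤ m} := ⟨⟨∅, by simp⟩⟩

theorem tailNorm_le (x : ι → ℝ) {m : ℕ} {S : Finset ι} (h : S.card ≤ m) :
    tailNorm x m ≤ l2 (off x S) :=
  ciInf_le (Set.finite_range fun S : {S : Finset ι // S.card ≤ m} => l2 (off x S.1)).bddBelow ⟨S, h⟩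

theorem exists_tailNorm_eq (x : ι → ℝ) (m : ℕ) :
    ∃ S : Finset ι, S.card ≤ m ∧ l2 (off x S) = tailNorm x m := by
  obtain ⟨S, hS⟩ := exists_eq_ciInf_of_finite
    (f := fun S : {S : Finset ι // S.card ≤ m} => l2 (off x S.1))
  exact ⟨S.1, S.2, hS⟩

theorem tailNorm_nonneg (x : ι → ℝ) (m : ℕ) : 0 ≤ tailNorm x m :=
  Real.iInf_nonneg fun _ => l2_nonneg _

theorem tailNorm_anti (x : ι → ℝ) {m m' : ℕ} (h : m ≤ m') : tailNorm x m' ≤ tailNorm x m := by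
  obtain ⟨S, hS, hS'⟩ := exists_tailNorm_eq x m
  rw [← hS']
  exact tailNorm_le x (hS.trans h)

theorem tailNorm_zero (x : ι → ℝ) : tailNorm x 0 = l2 x := by
  obtain ⟨S, hS, hS'⟩ := exists_tailNorm_eq x 0
  rw [← hS', Finset.card_eq_zero.mp (Nat.le_zero.mp hS)]
  congr 1

end off

/-! ### Distance to the integer lattice -/

section latticeDist

variable {ι : Type*} [Fintype ι]

/-- The Euclidean distance from `y` to the integer lattice. -/
noncomputable def latticeDist (y : ι → ℝ) : ℝ := l2 fun j => y j - round (y j)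

theorem latticeDist_le (y : ι → ℝ) (q : ι → ℤ) : latticeDist y ≤ l2 (y - fun j => (q j : ℝ)) :=
  l2_mono fun j => round_le (y j) (q j)

theorem latticeDist_le_add (y z : ι → ℝ) : latticeDist y ≤ latticeDist z + l2 (y - z) := by
  refine (latticeDist_le y fun j => round (z j)).trans ?_
  have : (y - fun j => ((round (z j) : ℤ) : ℝ)) = (fun j => z j - round (z j)) + (y - z) := by
    ext j; simp
  rw [this]
  exact l2_add_le _ _

/-- Zero is a nearest integer, so within this range the distance to the lattice is the size itself.
-/
theorem abs_le_abs_sub_round {w : ℝ} (h : |w| ≤ 1 / 2) : |w| ≤ |w - round w| := by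
  by_cases h0 : round w = 0
  · simp [h0]
  · have h1 : (1 : ℝ) ≤ |(round w : ℝ)| := by exact_mod_cast Int.one_le_abs h0
    have := abs_sub_abs_le_abs_sub (round w : ℝ) w
    rw [abs_sub_comm] at this
    linarith

/-- A nonzero rounding has size at least one and errs by at most 1/2. Coordinatewise rounding
therefore keeps zeros at zero and at most doubles entries, so supports and flatness survive
discretization. -/
theorem abs_round_le (w : ℝ) : |(round w : ℝ)| ≤ 2 * |w| := by
  by_cases h0 : round w = 0
  · simp [h0]
  · have h1 : (1 : ℝ) ≤ |(round w : ℝ)| := by exact_mod_cast Int.one_le_abs h0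
    have h2 := abs_sub_round w
    have := abs_sub_abs_le_abs_sub (round w : ℝ) w
    rw [abs_sub_comm] at this
    linarith

/-- Reduce `w` modulo one and use the parabola above the cosine on [-π, π]. Summed over coordinates,
this converts decay of a characteristic function into squared distance to the lattice. -/
theorem eight_mul_sq_le_one_sub_cos (w : ℝ) :
    8 * (w - round w) ^ 2 ≤ 1 - Real.cos (2 * Real.pi * w) := by
  have h1 : Real.cos (2 * Real.pi * w) = Real.cos (2 * Real.pi * (w - round w)) := by
    rw [show 2 * Real.pi * (w - round w) = 2 * Real.pi * w - round w * (2 * Real.pi) by ring,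
      Real.cos_sub_int_mul_two_pi]
  have hpi := Real.pi_pos
  have h2 : |2 * Real.pi * (w - round w)| ≤ Real.pi := by
    rw [abs_mul, abs_of_pos (by positivity)]
    nlinarith [abs_sub_round w]
  have h3 := Real.cos_le_one_sub_mul_cos_sq h2
  have h4 : 2 / Real.pi ^ 2 * (2 * Real.pi * (w - round w)) ^ 2 = 8 * (w - round w) ^ 2 := by
    field_simp; ring
  rw [h1]; linarith

end latticeDist

/-! ### Counting integer vectors -/

section counting

variable {ι : Type*} [Fintype ι] [DecidableEq ι]

/-- The integer vectors with `ℓ¹` norm at most `Q`. -/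
noncomputable def l1Ball (ι : Type*) [Fintype ι] [DecidableEq ι] (Q : ℕ) : Finset (ι → ℤ) :=
  (Fintype.piFinset fun _ => Finset.Icc (-(Q : ℤ)) Q).filter fun q => ∑ j, |q j| ≤ Q

theorem mem_l1Ball {Q : ℕ} {q : ι → ℤ} (h : ∑ j, |q j| ≤ Q) : q ∈ l1Ball ι Q := by
  refine Finset.mem_filter.mpr ⟨Fintype.mem_piFinset.mpr fun j => ?_, h⟩
  rw [Finset.mem_Icc, ← abs_le]
  exact (Finset.single_le_sum (f := fun j => |q j|) (fun _ _ => abs_nonneg _)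
    (Finset.mem_univ j)).trans h

theorem sum_Icc_exp_neg_abs_le {a : ℝ} (ha : 0 < a) (Q : ℕ) :
    ∑ k ∈ Finset.Icc (-(Q : ℤ)) Q, Real.exp (-a * |(k : ℝ)|) ≤
      1 + 2 * Real.exp (-a) / (1 - Real.exp (-a)) := by
  have hlt : Real.exp (-a) < 1 := by rw [← Real.exp_zero]; exact Real.exp_lt_exp.mpr (by linarith)
  have hpos := Real.exp_pos (-a)
  have hgeom : ∀ Q : ℕ, ∑ k ∈ Finset.Icc (-(Q : ℤ)) Q, Real.exp (-a * |(k : ℝ)|) =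
      1 + 2 * ∑ k ∈ Finset.range Q, Real.exp (-a) ^ (k + 1) := by
    intro Q
    induction Q with
    | zero => simp
    | succ Q ih =>
      have : Finset.Icc (-((Q + 1 : ℕ) : ℤ)) ((Q + 1 : ℕ) : ℤ) =
          insert (-((Q : ℤ) + 1)) (insert ((Q : ℤ) + 1) (Finset.Icc (-(Q : ℤ)) Q)) := by
        ext k; simp only [Finset.mem_Icc, Finset.mem_insert]; push_cast; omega
      rw [this, Finset.sum_insert (by simp; omega), Finset.sum_insert (by simp), ih,
        Finset.sum_range_succ]
      have h1 : Real.exp (-a * |((Q : ℝ) + 1)|) = Real.exp (-a) ^ (Q + 1) := by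
        rw [abs_of_nonneg (by positivity), ← Real.exp_nat_mul]; congr 1; push_cast; ring
      push_cast
      rw [show (-((Q : ℝ) + 1)) = -((Q : ℝ) + 1) by ring, abs_neg, h1]; ring
  rw [hgeom]
  have h2 : ∑ k ∈ Finset.range Q, Real.exp (-a) ^ (k + 1) ≤ Real.exp (-a) / (1 - Real.exp (-a)) := by
    simp_rw [pow_succ]
    rw [← Finset.sum_mul, div_eq_inv_mul]
    refine mul_le_mul_of_nonneg_right ?_ hpos.le
    rw [← tsum_geometric_of_lt_one hpos.le hlt]
    exact (summable_geometric_of_lt_one hpos.le hlt).sum_le_tsum _ fun _ _ => by positivity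
  have : 2 * Real.exp (-a) / (1 - Real.exp (-a)) = 2 * (Real.exp (-a) / (1 - Real.exp (-a))) := by
    ring
  linarith

/-- Every member has weight exp(a(Q - ‖q‖₁)) ≥ 1, and the total weight factors into geometric sums
over the coordinates. The parameter `a` remains free for optimization. -/
theorem card_l1Ball_le {a : ℝ} (ha : 0 < a) (Q : ℕ) :
    ((l1Ball ι Q).card : ℝ) ≤
      Real.exp (a * Q) * (1 + 2 * Real.exp (-a) / (1 - Real.exp (-a))) ^ Fintype.card ι := by
  have h1 : ((l1Ball ι Q).card : ℝ) ≤ ∑ q ∈ l1Ball ι Q,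
      Real.exp (a * Q) * ∏ j, Real.exp (-a * |(q j : ℝ)|) := by
    rw [Finset.card_eq_sum_ones]; push_cast
    refine Finset.sum_le_sum fun q hq => ?_
    rw [← Real.exp_sum, ← Real.exp_add, ← Finset.mul_sum]
    refine Real.one_le_exp ?_
    have : (∑ j, |(q j : ℝ)|) ≤ Q := by exact_mod_cast (Finset.mem_filter.mp hq).2
    nlinarith
  refine h1.trans ?_
  rw [← Finset.mul_sum]
  refine mul_le_mul_of_nonneg_left ?_ (Real.exp_pos _).le
  calc _ ≤ ∑ q ∈ Fintype.piFinset fun _ : ι => Finset.Icc (-(Q : ℤ)) Q,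
        ∏ j, Real.exp (-a * |(q j : ℝ)|) :=
        Finset.sum_le_sum_of_subset_of_nonneg (Finset.filter_subset _ _)
          fun _ _ _ => Finset.prod_nonneg fun _ _ => (Real.exp_pos _).le
    _ = ∏ _j : ι, ∑ k ∈ Finset.Icc (-(Q : ℤ)) Q, Real.exp (-a * |(k : ℝ)|) :=
        (Finset.prod_univ_sum (fun _ : ι => Finset.Icc (-(Q : ℤ)) Q)
          fun _ k => Real.exp (-a * |(k : ℝ)|)).symm
    _ ≤ _ := by
        rw [Finset.prod_const, Finset.card_univ]
        exact pow_le_pow_left₀ (Finset.sum_nonneg fun _ _ => (Real.exp_pos _).le)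
          (sum_Icc_exp_neg_abs_le ha Q) _

/-- The integer vectors with at most `m` nonzero coordinates, all bounded by `H`. -/
noncomputable def sparseBox (ι : Type*) [Fintype ι] [DecidableEq ι] (m H : ℕ) : Finset (ι → ℤ) :=
  (Finset.powersetCard m Finset.univ).biUnion fun J =>
    Fintype.piFinset fun j => if j ∈ J then Finset.Icc (-(H : ℤ)) H else {0}

theorem mem_sparseBox {m H : ℕ} (hm : m ≤ Fintype.card ι) {h : ι → ℤ} {J : Finset ι}
    (hJ : J.card ≤ m) (h0 : ∀ j ∉ J, h j = 0) (hH : ∀ j, |h j| ≤ H) : h ∈ sparseBox ι m H := by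
  obtain ⟨J', hJJ', hJ'⟩ := Finset.exists_superset_card_eq hJ hm
  refine Finset.mem_biUnion.mpr ⟨J', by simp [hJ'], Fintype.mem_piFinset.mpr fun j => ?_⟩
  by_cases hj : j ∈ J'
  · simpa [hj, ← abs_le] using hH j
  · simpa [hj] using h0 j fun h => hj (hJJ' h)

theorem card_sparseBox_le (m H : ℕ) :
    (sparseBox ι m H).card ≤ (Fintype.card ι * (2 * H + 1)) ^ m := by
  refine (Finset.card_biUnion_le_card_mul _ _ ((2 * H + 1) ^ m) fun J hJ => ?_).trans ?_
  · rw [Fintype.card_piFinset, ← (Finset.mem_powersetCard.mp hJ).2]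
    simp only [apply_ite Finset.card, Int.card_Icc, Finset.card_singleton]
    rw [Finset.prod_ite]
    simp
    refine le_of_eq ?_
    congr 1
    omega
  · rw [Finset.card_powersetCard, mul_pow, Finset.card_univ]
    exact Nat.mul_le_mul_right _ (Nat.choose_le_pow _ _)

end counting

/-! ### Laws of random matrices with independent entries -/

/-- The law of the entry in position `j` of a row whose entry in position `k` equals `a`. -/
noncomputable def entryLaw {n : ℕ} (ν : Measure ℝ) (k : Fin n) (a : ℝ) (j : Fin n) : Measure ℝ :=
  if j = k then Measure.dirac a else ν

instance {n : ℕ} (ν : Measure ℝ) [IsProbabilityMeasure ν] (k : Fin n) (a : ℝ) (j : Fin n) :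
    IsProbabilityMeasure (entryLaw ν k a j) := by
  unfold entryLaw; split_ifs <;> infer_instance

/-- The law of a row with entry `a` in position `k` and independent entries of law `ν` elsewhere. -/
noncomputable def rowLaw {n : ℕ} (ν : Measure ℝ) (k : Fin n) (a : ℝ) : Measure (Fin n → ℝ) :=
  Measure.pi (entryLaw ν k a)

instance {n : ℕ} (ν : Measure ℝ) [IsProbabilityMeasure ν] (k : Fin n) (a : ℝ) :
    IsProbabilityMeasure (rowLaw ν k a) := by
  unfold rowLaw; infer_instance

/-- The law of a matrix with independent rows, row `i` having entry `d i` in position `r i` and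
independent entries of law `ν` elsewhere. -/
noncomputable def matLaw {n : ℕ} {ι : Type*} [Fintype ι] (ν : Measure ℝ) (r : ι → Fin n)
    (d : ι → ℝ) : Measure (ι → Fin n → ℝ) :=
  Measure.pi fun i => rowLaw ν (r i) (d i)

instance {n : ℕ} {ι : Type*} [Fintype ι] (ν : Measure ℝ) [IsProbabilityMeasure ν] (r : ι → Fin n)
    (d : ι → ℝ) : IsProbabilityMeasure (matLaw ν r d) := by
  unfold matLaw; infer_instance

/-- The exponential Markov inequality for sums of independent random variables. -/
theorem measureReal_pi_sum_le_le {ι X : Type*} [Fintype ι] [MeasurableSpace X] (μ : ι → Measure X)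
    [∀ i, IsProbabilityMeasure (μ i)] (f : ι → X → ℝ) (b : ι → ℝ)
    (hintg : ∀ i, Integrable (fun x => Real.exp (-f i x)) (μ i))
    (hb : ∀ i, ∫ x, Real.exp (-f i x) ∂μ i ≤ b i) (a : ℝ) :
    (Measure.pi μ).real {M | ∑ i, f i (M i) ≤ a} ≤ Real.exp a * ∏ i, b i := by
  have h1 : Integrable (fun M : ι → X => ∏ i, Real.exp (-f i (M i))) (Measure.pi μ) :=
    Integrable.fintype_prod hintg
  have h2 := mul_meas_ge_le_integral_of_nonneg (μ := Measure.pi μ)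
    (f := fun M : ι → X => ∏ i, Real.exp (-f i (M i)))
    (Filter.Eventually.of_forall fun M => Finset.prod_nonneg fun _ _ => (Real.exp_pos _).le) h1
    (Real.exp (-a))
  rw [integral_fintype_prod_eq_prod (fun i x => Real.exp (-f i x))] at h2
  have h3 : {M : ι → X | Real.exp (-a) ≤ ∏ i, Real.exp (-f i (M i))} =
      {M | ∑ i, f i (M i) ≤ a} := by
    ext M
    simp only [Set.mem_ofPred_eq, ← Real.exp_sum, Real.exp_le_exp, Finset.sum_neg_distrib, neg_le_neg_iff]
  rw [h3] at h2
  have h4 : ∏ i, ∫ x, Real.exp (-f i x) ∂μ i ≤ ∏ i, b i :=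
    Finset.prod_le_prod (fun i _ => integral_nonneg fun _ => (Real.exp_pos _).le) fun i _ => hb i
  calc _ = Real.exp a * (Real.exp (-a) * (Measure.pi μ).real {M | ∑ i, f i (M i) ≤ a}) := by
        rw [← mul_assoc, ← Real.exp_add]; simp
    _ ≤ _ := mul_le_mul_of_nonneg_left (h2.trans h4) (Real.exp_pos _).le

/-- The properties of the law of a product `δ ξ` that are used: it vanishes outside an event of
probability at most `p`, is bounded below with probability at least `κ p`, and its characteristic
function is controlled by that of a compound Poisson law of intensity `p`. -/
structure SparseLaw (ν : Measure ℝ) (p κ B : ℝ) : Prop where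
  prob : IsProbabilityMeasure ν
  nonzero_le : ν.real {0}ᶜ ≤ p
  le_large : κ * p ≤ ν.real {x | 1 / 2 ≤ |x|}
  norm_charFun_le : ∃ lam : Measure ℝ, κ ≤ lam.real Set.univ ∧ lam Set.univ ≤ 1 ∧
    (∀ᵐ x ∂lam, x ∈ Set.Icc 1 B) ∧
    ∀ s, ‖charFun ν s‖ ≤ Real.exp (-p * ∫ x, (1 - Real.cos (s * x)) ∂lam)

/-- The law of the inner product of a random row with the vector `z`. -/
noncomputable def rowSum {n : ℕ} (ν : Measure ℝ) (k : Fin n) (a : ℝ) (z : Fin n → ℝ) : Measure ℝ :=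
  (rowLaw ν k a).map fun X => X ⬝ᵥ z

theorem measurable_dotProduct_const {n : ℕ} (z : Fin n → ℝ) :
    Measurable fun X : Fin n → ℝ => X ⬝ᵥ z := by
  unfold dotProduct; fun_prop

instance {n : ℕ} (ν : Measure ℝ) [IsProbabilityMeasure ν] (k : Fin n) (a : ℝ) (z : Fin n → ℝ) :
    IsProbabilityMeasure (rowSum ν k a z) :=
  Measure.isProbabilityMeasure_map (measurable_dotProduct_const z).aemeasurable

/-- Independence factors the characteristic function. The deterministic position `k` contributes a
factor of modulus at most one and is dropped, so the bound does not depend on `a`. -/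
theorem norm_charFun_rowSum_le {n : ℕ} (ν : Measure ℝ) [IsProbabilityMeasure ν] (k : Fin n) (a : ℝ)
    (z : Fin n → ℝ) (s : ℝ) :
    ‖charFun (rowSum ν k a z) s‖ ≤ ∏ j ∈ Finset.univ.erase k, ‖charFun ν (s * z j)‖ := by
  rw [charFun_apply_real, rowSum, integral_map (measurable_dotProduct_const z).aemeasurable
    (by fun_prop)]
  have h1 : ∀ X : Fin n → ℝ, Complex.exp (s * ((X ⬝ᵥ z : ℝ) : ℂ) * Complex.I) =
      ∏ j, Complex.exp (((s * z j : ℝ) : ℂ) * (X j : ℂ) * Complex.I) := by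
    intro X
    rw [← Complex.exp_sum]
    congr 1
    simp only [dotProduct]
    push_cast
    rw [Finset.mul_sum, Finset.sum_mul]
    exact Finset.sum_congr rfl fun j _ => by ring
  simp_rw [h1]
  rw [rowLaw, integral_fintype_prod_eq_prod
    (fun j (x : ℝ) => Complex.exp (((s * z j : ℝ) : ℂ) * (x : ℂ) * Complex.I)), norm_prod]
  simp_rw [← charFun_apply_real]
  rw [← Finset.mul_prod_erase _ _ (Finset.mem_univ k)]
  refine (mul_le_mul_of_nonneg_right (norm_charFun_le_one _)
    (Finset.prod_nonneg fun _ _ => norm_nonneg _)).trans ?_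
  rw [one_mul]
  exact le_of_eq (Finset.prod_congr rfl fun j hj => by simp [entryLaw, Finset.ne_of_mem_erase hj])

/-! ### Small ball probabilities and characteristic functions -/

/-- The triangular weight has a nonnegative cosine transform, as for the Fejér kernel; this
positivity is what makes Esseen's inequality an instance of Markov's. -/
theorem integral_one_sub_mul_cos (x : ℝ) (hx : x ≠ 0) :
    ∫ s in (0 : ℝ)..1, (1 - s) * Real.cos (s * x) = (1 - Real.cos x) / x ^ 2 := by
  have h : ∀ s ∈ Set.uIcc (0 : ℝ) 1, HasDerivAt
      (fun s => (1 - s) * Real.sin (s * x) / x - Real.cos (s * x) / x ^ 2)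
      ((1 - s) * Real.cos (s * x)) s := by
    intro s _
    have h1 : HasDerivAt (fun s : ℝ => s * x) x s := by simpa using (hasDerivAt_id s).mul_const x
    have h2 : HasDerivAt (fun s : ℝ => 1 - s) (-1) s := by simpa using (hasDerivAt_id s).const_sub 1
    have := (((h2.mul h1.sin).div_const x).sub (h1.cos.div_const (x ^ 2)))
    refine this.congr_deriv ?_
    field_simp
    ring
  rw [intervalIntegral.integral_eq_sub_of_hasDerivAt h
    (Continuous.intervalIntegrable (by fun_prop) _ _)]
  simp
  ring

theorem integral_one_sub_mul_cos_nonneg (x : ℝ) :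
    0 ≤ ∫ s in (0 : ℝ)..1, (1 - s) * Real.cos (s * x) := by
  by_cases hx : x = 0
  · refine intervalIntegral.integral_nonneg zero_le_one fun s hs => ?_
    simp [hx, hs.2]
  · rw [integral_one_sub_mul_cos x hx]
    have := Real.cos_le_one x
    have : 0 ≤ 1 - Real.cos x := by linarith
    positivity

theorem quarter_le_integral_one_sub_mul_cos {x : ℝ} (hx : |x| ≤ 1) :
    1 / 4 ≤ ∫ s in (0 : ℝ)..1, (1 - s) * Real.cos (s * x) := by
  have h1 : ∫ s in (0 : ℝ)..1, (1 - s) * (1 / 2 : ℝ) = 1 / 4 := by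
    rw [intervalIntegral.integral_mul_const, intervalIntegral.integral_sub (by simp) (by simp)]
    simp; norm_num
  rw [← h1]
  refine intervalIntegral.integral_mono_on zero_le_one (Continuous.intervalIntegrable (by fun_prop) _ _)
    (Continuous.intervalIntegrable (by fun_prop) _ _) fun s hs => ?_
  refine mul_le_mul_of_nonneg_left ?_ (by linarith [hs.2])
  have h2 := Real.one_sub_sq_div_two_le_cos (x := s * x)
  have h3 : (s * x) ^ 2 ≤ 1 := by
    rw [← sq_abs, abs_mul, abs_of_nonneg hs.1]
    have : s * |x| ≤ 1 := by nlinarith [hs.1, hs.2, abs_nonneg x]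
    have h0 : 0 ≤ s * |x| := mul_nonneg hs.1 (abs_nonneg x)
    nlinarith
  linarith

/-- Esseen's inequality. -/
theorem measureReal_abs_le_le_integral_charFun (μ : Measure ℝ) [IsProbabilityMeasure μ] {t : ℝ}
    (ht : 0 < t) :
    μ.real {x | |x| ≤ t} ≤ 4 * ∫ s in (0 : ℝ)..1, ‖charFun μ (s / t)‖ := by
  set g : ℝ → ℝ := fun x => ∫ s in (0 : ℝ)..1, (1 - s) * Real.cos (s * (x / t)) with hg
  have hprod : Integrable (fun q : ℝ × ℝ => (1 - q.2) * Real.cos (q.2 * (q.1 / t)))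
      (μ.prod (volume.restrict (Set.Ioc 0 1))) := by
    refine Integrable.mono' (g := fun _ => (1 : ℝ)) (integrable_const _)
      (Continuous.aestronglyMeasurable (by fun_prop)) ?_
    have : ∀ᵐ q : ℝ × ℝ ∂(μ.prod (volume.restrict (Set.Ioc 0 1))), q.2 ∈ Set.Ioc (0 : ℝ) 1 := by
      refine Measure.quasiMeasurePreserving_snd.ae ?_
      exact ae_restrict_mem measurableSet_Ioc
    filter_upwards [this] with q hq
    rw [Real.norm_eq_abs, abs_mul, abs_of_nonneg (by linarith [hq.2])]
    have h1 := Real.abs_cos_le_one (q.2 * (q.1 / t))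
    have h2 := abs_nonneg (Real.cos (q.2 * (q.1 / t)))
    nlinarith [hq.1, hq.2]
  have hgint : Integrable g μ := by
    have := hprod.integral_prod_left
    simpa [hg, intervalIntegral.integral_of_le zero_le_one] using this
  -- The kernel is nonnegative everywhere and at least 1/4 on the ball. Fubini afterwards expresses
  -- its integral through the characteristic function.
  have h1 : 1 / 4 * μ.real {x | |x| ≤ t} ≤ ∫ x, g x ∂μ := by
    refine le_trans ?_ (mul_meas_ge_le_integral_of_nonneg (μ := μ)
      (Filter.Eventually.of_forall fun x => integral_one_sub_mul_cos_nonneg (x / t)) hgint (1 / 4))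
    refine mul_le_mul_of_nonneg_left (measureReal_mono fun x hx => ?_) (by norm_num)
    refine quarter_le_integral_one_sub_mul_cos ?_
    rw [abs_div, abs_of_pos ht]
    exact (div_le_one ht).mpr hx
  have h2 : ∫ x, g x ∂μ = ∫ s in (0 : ℝ)..1, (1 - s) * (charFun μ (s / t)).re := by
    rw [intervalIntegral.integral_of_le zero_le_one]
    simp only [hg, intervalIntegral.integral_of_le zero_le_one]
    rw [integral_integral_swap hprod]
    refine integral_congr_ae (Filter.Eventually.of_forall fun s => ?_)
    simp only
    rw [integral_const_mul, charFun_apply_real]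
    congr 1
    have h3 : Integrable (fun x : ℝ => Complex.exp (((s / t : ℝ) : ℂ) * x * Complex.I)) μ := by
      refine Integrable.mono' (g := fun _ => (1 : ℝ)) (integrable_const _)
        (Continuous.aestronglyMeasurable (by fun_prop)) (Filter.Eventually.of_forall fun x => ?_)
      rw [← Complex.ofReal_mul, Complex.norm_exp_ofReal_mul_I]
    have h4 := integral_re h3
    simp only [RCLike.re_to_complex] at h4
    rw [← h4]
    refine integral_congr_ae (Filter.Eventually.of_forall fun x => ?_)
    simp only
    rw [← Complex.ofReal_mul, Complex.exp_ofReal_mul_I_re]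
    congr 1; ring
  have hcont : Continuous fun s : ℝ => charFun μ (s / t) :=
    (continuous_charFun (μ := μ)).comp (by fun_prop)
  have h3 : ∫ s in (0 : ℝ)..1, (1 - s) * (charFun μ (s / t)).re ≤
      ∫ s in (0 : ℝ)..1, ‖charFun μ (s / t)‖ := by
    refine intervalIntegral.integral_mono_on zero_le_one
      (Continuous.intervalIntegrable (by fun_prop) _ _)
      (Continuous.intervalIntegrable (by fun_prop) _ _) fun s hs => ?_
    have h5 := (Complex.abs_re_le_norm (charFun μ (s / t)))
    have h6 := le_abs_self (charFun μ (s / t)).re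
    nlinarith [hs.1, hs.2, norm_nonneg (charFun μ (s / t))]
  linarith

/-- A small ball estimate at all scales above `t` bounds the Laplace transform at scale `t`. -/
theorem integral_exp_neg_abs_div_le (μ : Measure ℝ) [IsProbabilityMeasure μ] {t b : ℝ} (ht : 0 < t)
    (hb : ∀ u : ℝ, 1 ≤ u → μ.real {x | |x| ≤ u * t} ≤ u * b) :
    ∫ x, Real.exp (-(|x| / t)) ∂μ ≤ 4 * b := by
  have hb0 : 0 ≤ b := by
    have := hb 1 le_rfl
    rw [one_mul, one_mul] at this
    exact measureReal_nonneg.trans this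
  -- Majorize the exponential by Σ 2^(-k) 1{|x| ≤ (k+1)t}: the single term k = ⌊|x|/t⌋ suffices
  -- because e⁻¹ ≤ 1/2. The constant 4 is then Σ (k+1) 2^(-k).
  have h1 : ∀ x : ℝ, ENNReal.ofReal (Real.exp (-(|x| / t))) ≤
      ∑' k : ℕ, Set.indicator {x : ℝ | |x| ≤ ((k : ℝ) + 1) * t}
        (fun _ => ENNReal.ofReal ((1 / 2) ^ k)) x := by
    intro x
    refine le_trans ?_ (ENNReal.le_tsum ⌊|x| / t⌋₊)
    have hx : |x| ≤ (((⌊|x| / t⌋₊ : ℕ) : ℝ) + 1) * t := by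
      rw [← div_le_iff₀ ht]
      exact (Nat.lt_floor_add_one _).le
    rw [Set.indicator_of_mem (by exact hx)]
    refine ENNReal.ofReal_le_ofReal ?_
    have h2 : Real.exp (-(|x| / t)) ≤ Real.exp (-1) ^ ⌊|x| / t⌋₊ := by
      rw [← Real.exp_nat_mul]
      refine Real.exp_le_exp.mpr ?_
      have := Nat.floor_le (a := |x| / t) (by positivity)
      linarith
    refine h2.trans (pow_le_pow_left₀ (Real.exp_pos _).le ?_ _)
    rw [Real.exp_neg, one_div]
    refine inv_anti₀ (by norm_num) ?_
    have := Real.add_one_le_exp (1 : ℝ)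
    linarith
  have h3 : ∫⁻ x, ENNReal.ofReal (Real.exp (-(|x| / t))) ∂μ ≤
      ∑' k : ℕ, ENNReal.ofReal ((1 / 2) ^ k * ((k + 1) * b)) := by
    refine (lintegral_mono h1).trans ?_
    rw [lintegral_tsum fun k => (Measurable.indicator measurable_const
      (measurableSet_le (by fun_prop) (by fun_prop))).aemeasurable]
    refine ENNReal.tsum_le_tsum fun k => ?_
    rw [lintegral_indicator_const (measurableSet_le (by fun_prop) (by fun_prop)),
      ENNReal.ofReal_mul (by positivity)]
    refine mul_le_mul_right ?_ _
    rw [← ofReal_measureReal]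
    exact ENNReal.ofReal_le_ofReal (hb ((k : ℝ) + 1) (by linarith [k.cast_nonneg (α := ℝ)]))
  have hs : HasSum (fun k : ℕ => (1 / 2 : ℝ) ^ k * ((k + 1) * b)) (4 * b) := by
    have h4 := hasSum_coe_mul_geometric_of_norm_lt_one (𝕜 := ℝ) (r := 1 / 2) (by norm_num)
    have h5 := hasSum_geometric_of_lt_one (r := (1 / 2 : ℝ)) (by norm_num) (by norm_num)
    have h6 := (h4.add h5).mul_right b
    have h7 : ((1 / 2 : ℝ) / (1 - 1 / 2) ^ 2 + (1 - 1 / 2)⁻¹) * b = 4 * b := by norm_num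
    rw [h7] at h6
    exact h6.congr_fun fun k => by ring
  rw [← ENNReal.ofReal_tsum_of_nonneg (fun k => by positivity) hs.summable, hs.tsum_eq] at h3
  rw [integral_eq_lintegral_of_nonneg_ae (Filter.Eventually.of_forall fun x => (Real.exp_pos _).le)
    (by fun_prop)]
  exact ENNReal.toReal_le_of_le_ofReal (by positivity) h3

/-- Coordinates where `y` vanishes contribute factors at most one, so the head of `z`, however
large, is ignored and only the body `y` counts. One measure `lam` serves all rows, vectors and
frequencies. -/
theorem SparseLaw.norm_charFun_rowSum_le {ν : Measure ℝ} {p κ B : ℝ} (hν : SparseLaw ν p κ B)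
    (hp : 0 < p) :
    ∃ lam : Measure ℝ, κ ≤ lam.real Set.univ ∧ lam Set.univ ≤ 1 ∧ (∀ᵐ x ∂lam, x ∈ Set.Icc 1 B) ∧
      ∀ (n : ℕ) (k : Fin n) (a : ℝ) (y z : Fin n → ℝ), (∀ j, y j = 0 ∨ z j = y j) → ∀ s : ℝ,
        ‖charFun (rowSum ν k a z) s‖ ≤
          Real.exp (-p * ∫ x, ∑ j ∈ Finset.univ.erase k, (1 - Real.cos (s * y j * x)) ∂lam) := by
  have := hν.prob
  obtain ⟨lam, h1, h2, h3, h4⟩ := hν.norm_charFun_le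
  refine ⟨lam, h1, h2, h3, fun n k a y z hyz s => ?_⟩
  have : IsFiniteMeasure lam := ⟨h2.trans_lt ENNReal.one_lt_top⟩
  refine (_root_.norm_charFun_rowSum_le ν k a z s).trans ?_
  rw [integral_finsetSum, Finset.mul_sum, Real.exp_sum]
  · refine Finset.prod_le_prod (fun _ _ => norm_nonneg _) fun j _ => (h4 _).trans ?_
    refine Real.exp_le_exp.mpr ?_
    rcases hyz j with h | h
    · have : 0 ≤ ∫ x, (1 - Real.cos (s * z j * x)) ∂lam :=
        integral_nonneg fun x => by simpa using Real.cos_le_one _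
      rw [h]
      simp
      positivity
    · rw [h]
  · intro j _
    refine Integrable.mono' (g := fun _ => (2 : ℝ)) (integrable_const _)
      (Continuous.aestronglyMeasurable (by fun_prop)) (Filter.Eventually.of_forall fun x => ?_)
    rw [Real.norm_eq_abs, abs_le]
    constructor <;> linarith [Real.cos_le_one (s * y j * x), Real.neg_one_le_cos (s * y j * x)]

/-- The real part of the characteristic function is the mean of cos(sx), which is at least 1 -
(st)²/2 on the ball and at least -1 off it. Hence decay at a single frequency already prevents full
concentration. -/
theorem two_mul_measureReal_abs_le_sub_le (μ : Measure ℝ) [IsProbabilityMeasure μ] (s t : ℝ) :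
    2 * μ.real {x | |x| ≤ t} - 1 - (s * t) ^ 2 / 2 ≤ ‖charFun μ s‖ := by
  have hintg : Integrable (fun x : ℝ => Complex.exp ((s : ℂ) * x * Complex.I)) μ := by
    refine Integrable.mono' (g := fun _ => (1 : ℝ)) (integrable_const _)
      (Continuous.aestronglyMeasurable (by fun_prop)) (Filter.Eventually.of_forall fun x => ?_)
    rw [← Complex.ofReal_mul, Complex.norm_exp_ofReal_mul_I]
  have h1 : (charFun μ s).re = ∫ x, Real.cos (s * x) ∂μ := by
    rw [charFun_apply_real]
    have h4 := integral_re hintg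
    simp only [RCLike.re_to_complex] at h4
    rw [← h4]
    refine integral_congr_ae (Filter.Eventually.of_forall fun x => ?_)
    simp only
    rw [← Complex.ofReal_mul, Complex.exp_ofReal_mul_I_re]
  have hm : MeasurableSet {x : ℝ | |x| ≤ t} := measurableSet_le (by fun_prop) (by fun_prop)
  have h2 : ∫ x, (Set.indicator {x : ℝ | |x| ≤ t} (fun _ => (2 : ℝ)) x - 1 - (s * t) ^ 2 / 2) ∂μ ≤
      ∫ x, Real.cos (s * x) ∂μ := by
    refine integral_mono ?_ ?_ fun x => ?_
    · exact ((((integrable_const _).indicator hm)).sub (integrable_const _)).sub (integrable_const _)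
    · refine Integrable.mono' (g := fun _ => (1 : ℝ)) (integrable_const _)
        (Continuous.aestronglyMeasurable (by fun_prop)) (Filter.Eventually.of_forall fun x => ?_)
      exact Real.abs_cos_le_one _
    · simp only
      by_cases hx : x ∈ {x : ℝ | |x| ≤ t}
      · rw [Set.indicator_of_mem hx]
        have h3 := Real.one_sub_sq_div_two_le_cos (x := s * x)
        have h4 : (s * x) ^ 2 ≤ (s * t) ^ 2 := by
          rw [mul_pow, mul_pow]
          refine mul_le_mul_of_nonneg_left ?_ (sq_nonneg _)
          exact sq_le_sq.mpr (le_trans hx (le_abs_self t))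
        linarith
      · rw [Set.indicator_of_notMem hx]
        have := Real.neg_one_le_cos (s * x)
        nlinarith [sq_nonneg (s * t)]
  have hi : Integrable (Set.indicator {x : ℝ | |x| ≤ t} fun _ => (2 : ℝ)) μ :=
    (integrable_const _).indicator hm
  simp_rw [sub_sub] at h2
  rw [integral_sub hi (integrable_const _), integral_indicator_const _ hm, integral_const] at h2
  simp only [smul_eq_mul, probReal_univ] at h2
  have h5 := (le_abs_self _).trans (Complex.abs_re_le_norm (charFun μ s))
  rw [h1] at h5
  linarith

/-- A row sum with flat coefficients is not concentrated near zero. -/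
theorem exists_integral_exp_neg_rowSum_le {κ B A : ℝ} (hκ : 0 < κ) (hB : 1 ≤ B) (hA : 0 < A) :
    ∃ η θ : ℝ, 0 < η ∧ 0 < θ ∧ ∀ (p : ℝ), 0 < p → ∀ ν : Measure ℝ, SparseLaw ν p κ B →
      ∀ (n : ℕ) (k : Fin n) (a : ℝ) (y z : Fin n → ℝ), (∀ j, y j = 0 ∨ z j = y j) →
        (∀ j, |y j| ≤ A * √p) → 1 / 8 ≤ ∑ j ∈ Finset.univ.erase k, y j ^ 2 →
        ∫ x, Real.exp (-(θ * x ^ 2 / p)) ∂rowSum ν k a z ≤ Real.exp (-η) := by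
  have hB0 : 0 < B := by linarith
  -- φ is the bound obtained below for one value of the characteristic function. With it, the ball
  -- of radius √(τ2 p) has mass at most 1 - e, and θ is chosen so that the integrand is at most e/2
  -- off that ball.
  set φ := Real.exp (-(κ / (40 * (A * B) ^ 2))) with hφ
  have hφ1 : φ < 1 := by
    rw [hφ, ← Real.exp_zero]
    exact Real.exp_lt_exp.mpr (by have : 0 < κ / (40 * (A * B) ^ 2) := by positivity
                                  linarith)
  set e := (1 - φ) / 4 with he
  have he0 : 0 < e := by rw [he]; linarith
  set τ2 := (1 - φ) * (A * B) ^ 2 with hτ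
  have hτ0 : 0 < τ2 := by
    have : 0 < 1 - φ := by linarith
    positivity
  set θ := (Real.log (2 / e)) / τ2 with hθ
  have he1 : e < 1 := by have := Real.exp_pos (-(κ / (40 * (A * B) ^ 2))); rw [he]; linarith
  have hθ0 : 0 < θ := div_pos (Real.log_pos (by rw [lt_div_iff₀ he0]; linarith)) hτ0
  refine ⟨e / 2, θ, by positivity, hθ0, fun p hp ν hν n k a y z hyz hyA hy => ?_⟩
  have := hν.prob
  obtain ⟨lam, h1, h2, h3, h4⟩ := hν.norm_charFun_rowSum_le hp
  have : IsFiniteMeasure lam := ⟨h2.trans_lt ENNReal.one_lt_top⟩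
  -- At this frequency every phase s y_j x, with x ≤ B, lies in [-1, 1], where 1 - cos is quadratic.
  set s := 1 / (A * B * √p) with hs
  have hsp : 0 < √p := Real.sqrt_pos.mpr hp
  have hspp : √p ^ 2 = p := Real.sq_sqrt hp.le
  have hchar : ‖charFun (rowSum ν k a z) s‖ ≤ φ := by
    refine (h4 n k a y z hyz s).trans (Real.exp_le_exp.mpr ?_)
    have h5 : ∫ _x, s ^ 2 / 40 ∂lam ≤
        ∫ x, ∑ j ∈ Finset.univ.erase k, (1 - Real.cos (s * y j * x)) ∂lam := by
      refine integral_mono_ae (integrable_const _) ?_ ?_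
      · refine integrable_finsetSum _ fun j _ => ?_
        refine Integrable.mono' (g := fun _ => (2 : ℝ)) (integrable_const _)
          (Continuous.aestronglyMeasurable (by fun_prop)) (Filter.Eventually.of_forall fun x => ?_)
        rw [Real.norm_eq_abs, abs_le]
        constructor <;> linarith [Real.cos_le_one (s * y j * x), Real.neg_one_le_cos (s * y j * x)]
      · filter_upwards [h3] with x hx
        have h6 : ∀ j ∈ Finset.univ.erase k, s ^ 2 / 5 * y j ^ 2 ≤ 1 - Real.cos (s * y j * x) := by
          intro j _
          have h7 : |s * y j * x| ≤ 1 := by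
            rw [abs_mul, abs_mul, abs_of_nonneg (by linarith [hx.1] : 0 ≤ x),
              abs_of_pos (by positivity : 0 < s)]
            calc s * |y j| * x ≤ s * (A * √p) * B := by
                  have := hx.2
                  have := hx.1
                  gcongr
                  exact hyA j
              _ = 1 := by rw [hs]; field_simp
          have h8 := Real.cos_le_one_sub_mul_cos_sq (h7.trans (by linarith [Real.pi_gt_three]))
          have h9 : (1 : ℝ) / 5 ≤ 2 / Real.pi ^ 2 := by
            rw [div_le_div_iff₀ (by norm_num) (by positivity)]
            nlinarith [Real.pi_lt_d2, Real.pi_pos]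
          have h10 : s ^ 2 * y j ^ 2 ≤ (s * y j * x) ^ 2 := by
            rw [mul_pow, mul_pow]
            have : 1 ≤ x ^ 2 := by nlinarith [hx.1]
            nlinarith [mul_nonneg (sq_nonneg s) (sq_nonneg (y j))]
          have h11 : 1 / 5 * (s ^ 2 * y j ^ 2) ≤ 2 / Real.pi ^ 2 * (s * y j * x) ^ 2 :=
            mul_le_mul h9 h10 (by positivity) (by positivity)
          linarith
        refine le_trans ?_ (Finset.sum_le_sum h6)
        rw [← Finset.mul_sum]
        nlinarith [sq_nonneg s]
    rw [integral_const, smul_eq_mul] at h5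
    have h6 : κ * (s ^ 2 / 40) ≤ lam.real Set.univ * (s ^ 2 / 40) := by gcongr
    have h7 : κ / (40 * (A * B) ^ 2) = p * (κ * (s ^ 2 / 40)) := by
      rw [hs, div_pow, one_pow, mul_pow _ (√p), hspp]; field_simp
    rw [h7]
    have := mul_le_mul_of_nonneg_left (h6.trans h5) hp.le
    linarith
  have hball : (rowSum ν k a z).real {x | |x| ≤ √(τ2 * p)} ≤ 1 - e := by
    have h5 := two_mul_measureReal_abs_le_sub_le (rowSum ν k a z) s (√(τ2 * p))
    have h6 : (s * √(τ2 * p)) ^ 2 = 1 - φ := by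
      rw [mul_pow, Real.sq_sqrt (by positivity), hs, div_pow, one_pow, mul_pow _ (√p), hspp, hτ]
      field_simp
    rw [h6] at h5
    rw [he]; linarith
  have hm : MeasurableSet {x : ℝ | |x| ≤ √(τ2 * p)} :=
    measurableSet_le (by fun_prop) (by fun_prop)
  have hle : ∫ x, Real.exp (-(θ * x ^ 2 / p)) ∂rowSum ν k a z ≤
      ∫ x, (Set.indicator {x : ℝ | |x| ≤ √(τ2 * p)} (fun _ => (1 : ℝ)) x + e / 2) ∂rowSum ν k a z := by
    refine integral_mono ?_ (((integrable_const _).indicator hm).add (integrable_const _)) fun x => ?_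
    · refine Integrable.mono' (g := fun _ => (1 : ℝ)) (integrable_const _)
        (Continuous.aestronglyMeasurable (by fun_prop)) (Filter.Eventually.of_forall fun x => ?_)
      rw [Real.norm_eq_abs, abs_of_pos (Real.exp_pos _)]
      exact Real.exp_le_one_iff.mpr (by have : 0 ≤ θ * x ^ 2 / p := by positivity
                                        linarith)
    · simp only
      by_cases hx : x ∈ {x : ℝ | |x| ≤ √(τ2 * p)}
      · rw [Set.indicator_of_mem hx]
        have : Real.exp (-(θ * x ^ 2 / p)) ≤ 1 :=
          Real.exp_le_one_iff.mpr (by have : 0 ≤ θ * x ^ 2 / p := by positivity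
                                      linarith)
        linarith
      · rw [Set.indicator_of_notMem hx, zero_add]
        have h5 : τ2 * p ≤ x ^ 2 := by
          have h6 : √(τ2 * p) < |x| := not_le.mp hx
          rw [← sq_abs x]
          exact (Real.sqrt_le_left (abs_nonneg x)).mp h6.le
        have h7 : Real.log (2 / e) ≤ θ * x ^ 2 / p := by
          rw [le_div_iff₀ hp]
          calc Real.log (2 / e) * p = θ * (τ2 * p) := by rw [hθ]; field_simp
            _ ≤ _ := by gcongr
        calc Real.exp (-(θ * x ^ 2 / p)) ≤ Real.exp (-Real.log (2 / e)) :=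
              Real.exp_le_exp.mpr (by linarith)
          _ = e / 2 := by rw [Real.exp_neg, Real.exp_log (by positivity), inv_div]
  refine hle.trans ?_
  rw [integral_add ((integrable_const _).indicator hm) (integrable_const _),
    integral_indicator_const _ hm]
  simp
  have := Real.add_one_le_exp (-(e / 2))
  linarith

/-- A small ball estimate for a row sum whose coefficient vector `y` keeps away from the lattice. -/
theorem SparseLaw.measureReal_rowSum_le {ν : Measure ℝ} {p κ B : ℝ} (hν : SparseLaw ν p κ B)
    (hp : 0 < p) (hp1 : p ≤ 1) (hκ : 0 < κ) (hB : 1 ≤ B) {n : ℕ} (k : Fin n) (a : ℝ)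
    {y z : Fin n → ℝ} (hyz : ∀ j, y j = 0 ∨ z j = y j) {e g Θ t : ℝ} (he : 0 < e) (hg : 0 < g)
    (hΘ : 0 < Θ) (hy : ∀ θ : ℝ, 0 ≤ θ → θ ≤ Θ → min (e * θ) g ≤ latticeDist (θ • y))
    (ht : B / Θ ≤ t) :
    (rowSum ν k a z).real {x | |x| ≤ t} ≤
      32 * √(Real.pi ^ 3 / (2 * κ * e ^ 2)) * (t / √p) + 32 * Real.exp (-8 * κ * p * g ^ 2) := by
  have := hν.prob
  have hB0 : 0 < B := by linarith
  have ht0 : 0 < t := lt_of_lt_of_le (by positivity) ht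
  have hpi := Real.pi_pos
  obtain ⟨lam, h1, h2, h3, h4⟩ := hν.norm_charFun_rowSum_le hp
  have : IsFiniteMeasure lam := ⟨h2.trans_lt ENNReal.one_lt_top⟩
  have hlam1 : lam.real Set.univ ≤ 1 := by
    rw [← ENNReal.toReal_one]
    exact ENNReal.toReal_mono ENNReal.one_ne_top h2
  set b := 2 * κ * e ^ 2 * p / (Real.pi ^ 2 * t ^ 2) with hb
  have hb0 : 0 < b := by positivity
  have hchar : ∀ s ∈ Set.Icc (0 : ℝ) 1, ‖charFun (rowSum ν k a z) (s / t)‖ ≤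
      8 * Real.exp (-b * s ^ 2) + 8 * Real.exp (-8 * κ * p * g ^ 2) := by
    intro s hs
    set Φ := min (e ^ 2 * (s / t / (2 * Real.pi)) ^ 2) (g ^ 2) with hΦ
    have hΦ0 : 0 ≤ Φ := le_min (by positivity) (by positivity)
    refine (h4 n k a y z hyz (s / t)).trans ?_
    -- The sum omits the deterministic coordinate `k`, whose term is at most 2; this is the origin
    -- of -2 and of the factor e² ≤ 8 below.
    have h5 : ∫ _x, (8 * Φ - 2) ∂lam ≤
        ∫ x, ∑ j ∈ Finset.univ.erase k, (1 - Real.cos (s / t * y j * x)) ∂lam := by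
      refine integral_mono_ae (integrable_const _) ?_ ?_
      · refine integrable_finsetSum _ fun j _ => ?_
        refine Integrable.mono' (g := fun _ => (2 : ℝ)) (integrable_const _)
          (Continuous.aestronglyMeasurable (by fun_prop)) (Filter.Eventually.of_forall fun x => ?_)
        rw [Real.norm_eq_abs, abs_le]
        constructor <;>
          linarith [Real.cos_le_one (s / t * y j * x), Real.neg_one_le_cos (s / t * y j * x)]
      · filter_upwards [h3] with x hx
        -- With this dilation the phases are 2πθ y_j. The bound x ≤ B and the condition on t keep θ
        -- within Θ, while x ≥ 1 bounds θ from below.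
        set θ := s / t * x / (2 * Real.pi) with hθ
        have hst : 0 ≤ s / t := div_nonneg hs.1 ht0.le
        have hθ0 : 0 ≤ θ := div_nonneg (mul_nonneg hst (by linarith [hx.1])) (by positivity)
        have hθΘ : θ ≤ Θ := by
          rw [hθ, div_le_iff₀ (by positivity)]
          have h6 : s / t ≤ Θ / B := by
            rw [div_le_div_iff₀ ht0 hB0]
            rw [div_le_iff₀ hΘ] at ht
            nlinarith [hs.1, hs.2]
          calc s / t * x ≤ Θ / B * B := by
                have := hx.1; have := hx.2
                gcongr
            _ = Θ := by field_simp
            _ ≤ Θ * (2 * Real.pi) := by nlinarith [Real.pi_gt_three]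
        have h6 := hy θ hθ0 hθΘ
        have h7 : Φ ≤ latticeDist (θ • y) ^ 2 := by
          have h8 : 0 ≤ min (e * θ) g := le_min (by positivity) hg.le
          refine le_trans ?_ (pow_le_pow_left₀ h8 h6 2)
          rcases le_total (e * θ) g with h | h
          · rw [min_eq_left h]
            refine (min_le_left _ _).trans ?_
            rw [mul_pow]
            gcongr
            rw [hθ]
            gcongr
            have := hx.1
            nlinarith
          · rw [min_eq_right h]; exact min_le_right _ _
        have h8 : 8 * latticeDist (θ • y) ^ 2 ≤ ∑ j, (1 - Real.cos (s / t * y j * x)) := by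
          rw [latticeDist, l2_sq, Finset.mul_sum]
          refine Finset.sum_le_sum fun j _ => ?_
          have := eight_mul_sq_le_one_sub_cos ((θ • y) j)
          have h9 : 2 * Real.pi * (θ • y) j = s / t * y j * x := by
            simp only [Pi.smul_apply, smul_eq_mul, hθ]; field_simp
          rwa [h9] at this
        rw [← Finset.add_sum_erase _ _ (Finset.mem_univ k)] at h8
        have h9 := Real.neg_one_le_cos (s / t * y k * x)
        linarith
    rw [integral_const, smul_eq_mul] at h5
    have h6 : κ * (8 * Φ) - 2 ≤ lam.real Set.univ * (8 * Φ - 2) := by nlinarith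
    have h7 : Real.exp 2 ≤ 8 := by
      have : Real.exp 2 = Real.exp 1 * Real.exp 1 := by rw [← Real.exp_add]; norm_num
      rw [this]
      nlinarith [Real.exp_one_lt_d9, Real.exp_pos 1]
    have h8 : Real.exp (-(p * (κ * (8 * Φ)))) ≤
        Real.exp (-b * s ^ 2) + Real.exp (-8 * κ * p * g ^ 2) := by
      rcases min_choice (e ^ 2 * (s / t / (2 * Real.pi)) ^ 2) (g ^ 2) with h | h
      · have : -(p * (κ * (8 * Φ))) = -b * s ^ 2 := by
          rw [hΦ, h, hb]; field_simp; ring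
        rw [this]
        linarith [Real.exp_pos (-8 * κ * p * g ^ 2)]
      · have : -(p * (κ * (8 * Φ))) = -8 * κ * p * g ^ 2 := by rw [hΦ, h]; ring
        rw [this]
        linarith [Real.exp_pos (-b * s ^ 2)]
    calc _ ≤ Real.exp (2 + -(p * (κ * (8 * Φ)))) := Real.exp_le_exp.mpr (by
            have := mul_le_mul_of_nonneg_left (h6.trans h5) hp.le
            nlinarith)
      _ = Real.exp 2 * Real.exp (-(p * (κ * (8 * Φ)))) := Real.exp_add _ _
      _ ≤ 8 * (Real.exp (-b * s ^ 2) + Real.exp (-8 * κ * p * g ^ 2)) := by gcongr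
      _ = _ := by ring
  refine (measureReal_abs_le_le_integral_charFun _ ht0).trans ?_
  have hcont : Continuous fun s : ℝ => charFun (rowSum ν k a z) (s / t) :=
    (continuous_charFun (μ := rowSum ν k a z)).comp (by fun_prop)
  have h5 : ∫ s in (0 : ℝ)..1, ‖charFun (rowSum ν k a z) (s / t)‖ ≤
      ∫ s in (0 : ℝ)..1, (8 * Real.exp (-b * s ^ 2) + 8 * Real.exp (-8 * κ * p * g ^ 2)) :=
    intervalIntegral.integral_mono_on zero_le_one (Continuous.intervalIntegrable (by fun_prop) _ _)
      (Continuous.intervalIntegrable (by fun_prop) _ _) hchar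
  rw [intervalIntegral.integral_add (Continuous.intervalIntegrable (by fun_prop) _ _) (by simp),
    intervalIntegral.integral_const_mul] at h5
  have h6 : ∫ s in (0 : ℝ)..1, Real.exp (-b * s ^ 2) ≤ √(Real.pi / b) := by
    rw [← integral_gaussian, intervalIntegral.integral_of_le zero_le_one]
    exact setIntegral_le_integral (integrable_exp_neg_mul_sq hb0)
      (Filter.Eventually.of_forall fun s => (Real.exp_pos _).le)
  have h7 : √(Real.pi / b) = √(Real.pi ^ 3 / (2 * κ * e ^ 2)) * (t / √p) := by
    have : Real.pi / b = Real.pi ^ 3 / (2 * κ * e ^ 2) * (t ^ 2 / p) := by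
      rw [hb]; field_simp
    rw [this, Real.sqrt_mul (by positivity), Real.sqrt_div (sq_nonneg t), Real.sqrt_sq ht0.le]
  rw [h7] at h6
  rw [intervalIntegral.integral_const, sub_zero, one_smul] at h5
  linarith

/-! ### Nets for nearly sparse flat vectors -/

/-- The product of a matrix, given by its rows, with a vector. -/
def app {ι : Type*} {n : ℕ} (M : ι → Fin n → ℝ) (x : Fin n → ℝ) : ι → ℝ := fun i => M i ⬝ᵥ x

section app

variable {ι : Type*} {n : ℕ}

theorem app_add (M : ι → Fin n → ℝ) (x y : Fin n → ℝ) : app M (x + y) = app M x + app M y := by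
  ext i; simp [app]

theorem app_sub (M : ι → Fin n → ℝ) (x y : Fin n → ℝ) : app M (x - y) = app M x - app M y := by
  ext i; simp [app]

theorem app_smul (M : ι → Fin n → ℝ) (c : ℝ) (x : Fin n → ℝ) : app M (c • x) = c • app M x := by
  ext i; simp [app]

variable [Fintype ι]

/-- The operator norm of `M` is at most `a`. -/
def OpBound (M : ι → Fin n → ℝ) (a : ℝ) : Prop := ∀ x, l2 (app M x) ≤ a * l2 x

end app

theorem integral_rowLaw_eq_rowSum {n : ℕ} (ν : Measure ℝ) (k : Fin n) (a : ℝ) (z : Fin n → ℝ)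
    {f : ℝ → ℝ} (hf : Continuous f) :
    ∫ X, f (X ⬝ᵥ z) ∂rowLaw ν k a = ∫ x, f x ∂rowSum ν k a z := by
  rw [rowSum, integral_map (measurable_dotProduct_const z).aemeasurable hf.aestronglyMeasurable]

theorem integrable_exp_neg_of_nonneg {X : Type*} [MeasurableSpace X] (μ : Measure X)
    [IsProbabilityMeasure μ] {f : X → ℝ} (hf : Measurable f) (h0 : ∀ x, 0 ≤ f x) :
    Integrable (fun x => Real.exp (-f x)) μ := by
  refine Integrable.mono' (g := fun _ => (1 : ℝ)) (integrable_const _)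
    (Measurable.aestronglyMeasurable (by fun_prop)) (Filter.Eventually.of_forall fun x => ?_)
  rw [Real.norm_eq_abs, abs_of_pos (Real.exp_pos _)]
  exact Real.exp_le_one_iff.mpr (by linarith [h0 x])

/-- Tensorization: against a fixed flat body each row escapes zero with constant probability, and
exponential Markov multiplies this over at least half of the rows. The constants do not depend on
the head contained in `z`. -/
theorem exists_matLaw_flat_le {κ B A : ℝ} (hκ : 0 < κ) (hB : 1 ≤ B) (hA : 0 < A) :
    ∃ b c : ℝ, 0 < b ∧ 0 < c ∧ ∀ (p : ℝ), 0 < p → ∀ ν : Measure ℝ, SparseLaw ν p κ B →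
      ∀ (n : ℕ), 66 ≤ n → ∀ (ι : Type) [Fintype ι] (r : ι → Fin n) (d : ι → ℝ),
        Function.Injective r → n ≤ Fintype.card ι + 1 →
        ∀ (y z : Fin n → ℝ), (∀ j, y j = 0 ∨ z j = y j) → (∀ j, |y j| ≤ A * √p) →
          1 / 4 ≤ ∑ j, y j ^ 2 → ∑ j, y j ^ 2 ≤ 4 →
          (matLaw ν r d).real {M | l2 (app M z) ≤ b * √(n * p)} ≤ Real.exp (-c * n) := by
  classical
  obtain ⟨η, θ, hη, hθ, h⟩ := exists_integral_exp_neg_rowSum_le hκ hB hA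
  refine ⟨√(η / (4 * θ)), η / 4, by positivity, by positivity, ?_⟩
  intro p hp ν hν n hn ι _ r d hr hcard y z hyz hyA hy1 hy4
  have := hν.prob
  -- In these rows the deterministic position carries at most 1/8 of the squared norm, leaving at
  -- least 1/8 on random positions. Since Σ y_j² ≤ 4, at most 32 rows are excluded; with one row
  -- possibly missing, n ≥ 66 still leaves n/2 good rows.
  set good : Finset ι := Finset.univ.filter fun i => y (r i) ^ 2 ≤ 1 / 8 with hgood
  have hbad : (goodᶜ).card ≤ 32 := by
    have h1 : ∑ i ∈ goodᶜ, (1 / 8 : ℝ) ≤ 4 := by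
      calc ∑ i ∈ goodᶜ, (1 / 8 : ℝ) ≤ ∑ i ∈ goodᶜ, y (r i) ^ 2 :=
            Finset.sum_le_sum fun i hi => by
              simp only [hgood, Finset.mem_compl, Finset.mem_filter, Finset.mem_univ, true_and,
                not_le] at hi
              exact hi.le
        _ = ∑ j ∈ (goodᶜ).image r, y j ^ 2 := (Finset.sum_image (f := fun j => y j ^ 2) fun _ _ _ _ h => hr h).symm
        _ ≤ ∑ j, y j ^ 2 := Finset.sum_le_sum_of_subset_of_nonneg (Finset.subset_univ _)
            fun _ _ _ => sq_nonneg _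
        _ ≤ 4 := hy4
    rw [Finset.sum_const, nsmul_eq_mul] at h1
    have : ((goodᶜ).card : ℝ) ≤ 32 := by linarith
    exact_mod_cast this
  have hgc : (n : ℝ) / 2 ≤ good.card := by
    have h1 := Finset.card_add_card_compl good
    have h2 : n ≤ 2 * good.card := by omega
    have : (n : ℝ) ≤ 2 * good.card := by exact_mod_cast h2
    linarith
  set f : ι → (Fin n → ℝ) → ℝ := fun i X => if i ∈ good then θ * (X ⬝ᵥ z) ^ 2 / p else 0 with hf
  have hf0 : ∀ i X, 0 ≤ f i X := by
    intro i X; simp only [hf]; split_ifs <;> positivity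
  have hmeas : ∀ i, Measurable (f i) := by
    intro i
    have := measurable_dotProduct_const z
    simp only [hf]; split_ifs <;> fun_prop
  have hfb : ∀ i, ∫ X, Real.exp (-f i X) ∂rowLaw ν (r i) (d i) ≤
      if i ∈ good then Real.exp (-η) else 1 := by
    intro i
    by_cases hi : i ∈ good
    · simp only [hf, hi, if_true]
      rw [integral_rowLaw_eq_rowSum ν (r i) (d i) z (f := fun x => Real.exp (-(θ * x ^ 2 / p)))
        (by fun_prop)]
      refine h p hp ν hν n (r i) (d i) y z hyz hyA ?_
      have h2 : y (r i) ^ 2 ≤ 1 / 8 := (Finset.mem_filter.mp hi).2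
      rw [← Finset.add_sum_erase _ _ (Finset.mem_univ (r i))] at hy1
      linarith
    · simp [hf, hi]
  have hmain := measureReal_pi_sum_le_le (fun i => rowLaw ν (r i) (d i)) f _
    (fun i => integrable_exp_neg_of_nonneg _ (hmeas i) (hf0 i)) hfb (η / 4 * n)
  refine (measureReal_mono ?_).trans (hmain.trans ?_)
  · intro M hM
    have hM : l2 (app M z) ≤ √(η / (4 * θ)) * √(n * p) := hM
    have h3 : ∑ i, (app M z i) ^ 2 ≤ η / (4 * θ) * (n * p) := by
      rw [← l2_sq]
      calc l2 (app M z) ^ 2 ≤ (√(η / (4 * θ)) * √(n * p)) ^ 2 :=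
            pow_le_pow_left₀ (l2_nonneg _) hM 2
        _ = _ := by rw [mul_pow, Real.sq_sqrt (by positivity), Real.sq_sqrt (by positivity)]
    show ∑ i, f i (M i) ≤ η / 4 * n
    calc ∑ i, f i (M i) ≤ ∑ i, θ / p * (app M z i) ^ 2 := Finset.sum_le_sum fun i _ => by
          simp only [hf, app]
          split_ifs
          · exact le_of_eq (by ring)
          · positivity
      _ = θ / p * ∑ i, (app M z i) ^ 2 := by rw [Finset.mul_sum]
      _ ≤ θ / p * (η / (4 * θ) * (n * p)) := by gcongr
      _ = _ := by field_simp
  · rw [Finset.prod_ite, Finset.prod_const, Finset.prod_const_one, mul_one, ← Real.exp_nat_mul,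
      ← Real.exp_add]
    refine Real.exp_le_exp.mpr ?_
    simp only [Finset.filter_mem_eq_inter, Finset.univ_inter]
    nlinarith

/-- A vector split into a sparse part `h` and a normalized remainder `y` with disjoint support. -/
structure IsSplit {n : ℕ} (m : ℕ) (J : Finset (Fin n)) (h y : Fin n → ℝ) : Prop where
  card_le : J.card ≤ m
  head : ∀ j ∉ J, h j = 0
  body : ∀ j ∈ J, y j = 0
  l2_eq : l2 y = 1

theorem l2_sub_smul_round_le {n : ℕ} {x : Fin n → ℝ} {a : ℝ} (ha : 0 < a) :
    l2 (a • (fun j => (round (x j / a) : ℝ)) - x) ≤ √n * a := by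
  have := l2_le_of_abs_le (x := a • (fun j => (round (x j / a) : ℝ)) - x) (a := a) ha.le (by
    intro j
    have h1 := abs_sub_round (x j / a)
    have h2 : (a • (fun j => (round (x j / a) : ℝ)) - x) j = -(a * (x j / a - round (x j / a))) := by
      simp only [Pi.sub_apply, Pi.smul_apply, smul_eq_mul]; field_simp; ring
    rw [h2, abs_neg, abs_mul, abs_of_pos ha]
    nlinarith)
  simpa using this

/-- Union bound over a net. Bodies essentially carried by sn coordinates are approximated by lattice
points in a small ℓ¹ ball, of cardinality exp(small·n); the hypothesis on `m` and `H` bounds the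
entropy of the heads. Each net point is covered by `exists_matLaw_flat_le`. -/
theorem exists_matLaw_nearlySparse_le {κ B A K : ℝ} (hκ : 0 < κ) (hB : 1 ≤ B) (hA : 0 < A)
    (hK : 1 ≤ K) :
    ∃ ε s b c : ℝ, 0 < ε ∧ 0 < s ∧ 0 < b ∧ 0 < c ∧ s ≤ 1 ∧
      ∀ (p : ℝ), 0 < p → ∀ ν : Measure ℝ, SparseLaw ν p κ B →
      ∀ (n : ℕ), 66 ≤ n → ∀ (ι : Type) [Fintype ι] (r : ι → Fin n) (d : ι → ℝ),
        Function.Injective r → n ≤ Fintype.card ι + 1 →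
        ∀ m H : ℕ, m ≤ n → ((n * (2 * H + 1) : ℝ)) ^ m ≤ Real.exp (c * n) →
        (matLaw ν r d).real {M | OpBound M (K * √(n * p)) ∧ ∃ J h y, IsSplit m J h y ∧
          2 * (l2 h * √n / ε) ≤ H ∧ (∀ j, |y j| ≤ A * √p) ∧
          (∃ S : Finset (Fin n), S.card ≤ s * n ∧ l2 (off y S) ≤ ε) ∧
          l2 (app M (h + y)) ≤ b * √(n * p)} ≤ Real.exp (-c * n) := by
  classical
  obtain ⟨b, c, hb, hc, hflat⟩ := exists_matLaw_flat_le hκ hB (A := 2 * A) (by linarith)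
  have hK0 : 0 < K := by linarith
  -- The rounding errors are ε for the head and 2ε for the body. Thus 3Kε ≤ b/2 preserves the
  -- smallness of the image, and ε ≤ 1/6 keeps the rounded body of norm at least 1/2.
  set ε := min (1 / 6) (b / (6 * K)) with hε
  have hε0 : 0 < ε := by positivity
  have hε1 : ε ≤ 1 / 6 := min_le_left _ _
  have hε2 : ε * (6 * K) ≤ b := by rw [← le_div_iff₀ (by positivity)]; exact min_le_right _ _
  -- With exp(-a) = w, the weight of each coordinate in the ℓ¹ count is at most exp(c/4); the choice
  -- of `s` below makes the other factor exp(aQ) at most exp(cn/4).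
  set w := min (1 / 2) (c / 16) with hw
  have hw0 : 0 < w := by positivity
  have hw1 : w ≤ 1 / 2 := min_le_left _ _
  have hw2 : w ≤ c / 16 := min_le_right _ _
  set a := -Real.log w with ha
  have ha0 : 0 < a := by
    have := Real.log_neg hw0 (by linarith)
    rw [ha]; linarith
  have hea : Real.exp (-a) = w := by rw [ha, neg_neg, Real.exp_log hw0]
  set s := min 1 ((c * ε / (8 * a)) ^ 2) with hs
  have hs0 : 0 < s := by positivity
  have hs1 : √s ≤ c * ε / (8 * a) :=
    Real.sqrt_le_iff.mpr ⟨by positivity, min_le_right _ _⟩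
  refine ⟨ε, s, b / 2, c / 8, hε0, hs0, by positivity, by positivity, min_le_left _ _, ?_⟩
  intro p hp ν hν n hn ι _ r d hr hcard m H hmn hbudget
  have := hν.prob
  have hn0 : (0 : ℝ) < n := by exact_mod_cast (by omega : 0 < n)
  have hsn : 0 < √(n : ℝ) := Real.sqrt_pos.mpr hn0
  set Q := ⌊2 * (√s * n / ε)⌋₊ with hQ
  -- The mesh for which rounding n coordinates costs at most ε in Euclidean norm.
  set g := ε / √n with hg
  have hg0 : 0 < g := by positivity
  set Y : (Fin n → ℤ) → Fin n → ℝ := fun q => g • fun j => (q j : ℝ) with hY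
  -- The conditions on the net point sit inside the event: for a point violating them the event is
  -- empty, so the union may run over the full product of boxes.
  set E : (Fin n → ℤ) × (Fin n → ℤ) → Set (ι → Fin n → ℝ) := fun w =>
    {M | (∀ j, Y w.2 j = 0 ∨ (Y w.1 + Y w.2) j = Y w.2 j) ∧ (∀ j, |Y w.2 j| ≤ 2 * A * √p) ∧
      1 / 4 ≤ ∑ j, Y w.2 j ^ 2 ∧ ∑ j, Y w.2 j ^ 2 ≤ 4 ∧
      l2 (app M (Y w.1 + Y w.2)) ≤ b * √(n * p)} with hE
  have hEle : ∀ w, (matLaw ν r d).real (E w) ≤ Real.exp (-c * n) := by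
    intro w
    by_cases hcond : (∀ j, Y w.2 j = 0 ∨ (Y w.1 + Y w.2) j = Y w.2 j) ∧
        (∀ j, |Y w.2 j| ≤ 2 * A * √p) ∧ 1 / 4 ≤ ∑ j, Y w.2 j ^ 2 ∧ ∑ j, Y w.2 j ^ 2 ≤ 4
    · refine (measureReal_mono fun M hM => ?_).trans (hflat p hp ν hν n hn ι r d hr hcard (Y w.2)
        (Y w.1 + Y w.2) hcond.1 hcond.2.1 hcond.2.2.1 hcond.2.2.2)
      exact hM.2.2.2.2
    · have : E w = ∅ := by
        ext M
        simp only [Set.mem_empty_iff_false, iff_false]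
        exact fun hM => hcond ⟨hM.1, hM.2.1, hM.2.2.1, hM.2.2.2.1⟩
      rw [this, measureReal_empty]
      exact (Real.exp_pos _).le
  have hsub : {M : ι → Fin n → ℝ | OpBound M (K * √(n * p)) ∧ ∃ J h y, IsSplit m J h y ∧
          2 * (l2 h * √n / ε) ≤ H ∧ (∀ j, |y j| ≤ A * √p) ∧
          (∃ S : Finset (Fin n), S.card ≤ s * n ∧ l2 (off y S) ≤ ε) ∧
          l2 (app M (h + y)) ≤ b / 2 * √(n * p)} ⊆
      ⋃ w ∈ sparseBox (Fin n) m H ×ˢ l1Ball (Fin n) Q, E w := by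
    rintro M ⟨hop, J, h, y, hsplit, hH, hyA, ⟨S, hS, hSε⟩, happ⟩
    set h' : Fin n → ℤ := fun j => round (h j / g) with hh'
    set q : Fin n → ℤ := fun j => round (on y S j / g) with hq
    have hgi : ∀ x : ℝ, |x| / g = |x| * √n / ε := fun x => by rw [hg]; field_simp
    have hh'mem : h' ∈ sparseBox (Fin n) m H := by
      refine mem_sparseBox (by simpa using hmn) hsplit.card_le
        (fun j hj => by simp [hh', hsplit.head j hj]) fun j => ?_
      have h1 : |(h' j : ℝ)| ≤ H := by
        refine (abs_round_le _).trans (le_trans ?_ hH)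
        rw [abs_div, abs_of_pos hg0, hgi]
        gcongr
        exact abs_le_l2 h j
      exact_mod_cast h1
    have hqmem : q ∈ l1Ball (Fin n) Q := by
      refine mem_l1Ball ?_
      have h1 : ∑ j, |(q j : ℝ)| ≤ 2 * (√s * n / ε) := by
        calc ∑ j, |(q j : ℝ)| ≤ ∑ j, 2 * (|on y S j| / g) := Finset.sum_le_sum fun j _ => by
              refine (abs_round_le _).trans ?_
              rw [abs_div, abs_of_pos hg0]
          _ = 2 / g * ∑ j ∈ S, |y j| := by
              rw [Finset.mul_sum, ← Finset.sum_subset (Finset.subset_univ S)]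
              · exact Finset.sum_congr rfl fun j hj => by simp [on, hj]; ring
              · intro j _ hj; simp [on, hj]
          _ ≤ 2 / g * (√(s * n) * 1) := by
              gcongr
              refine (sum_abs_le_sqrt_card_mul_l2 y S).trans ?_
              rw [hsplit.l2_eq]
              gcongr
          _ = _ := by
              rw [Real.sqrt_mul hs0.le, hg]
              have : √(n : ℝ) * √n = n := Real.mul_self_sqrt hn0.le
              field_simp
              rw [sq, this]
      have h2 : ((∑ j, |q j| : ℤ) : ℝ) ≤ 2 * (√s * n / ε) := by push_cast; exact h1
      have h3 : 0 ≤ ∑ j, |q j| := Finset.sum_nonneg fun _ _ => abs_nonneg _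
      obtain ⟨N, hN⟩ := Int.eq_ofNat_of_zero_le h3
      rw [hN] at h2 ⊢
      exact_mod_cast Nat.le_floor (by exact_mod_cast h2)
    have hroundh : l2 (Y h' - h) ≤ ε := by
      refine (l2_sub_smul_round_le (x := h) hg0).trans (le_of_eq ?_)
      rw [hg]; field_simp
    have hroundy : l2 (Y q - y) ≤ 2 * ε := by
      have h1 : Y q - y = (Y q - on y S) - off y S := by
        rw [sub_sub, on_add_off]
      rw [h1]
      refine (l2_sub_le _ _).trans ?_
      have h2 : l2 (Y q - on y S) ≤ ε := by
        refine (l2_sub_smul_round_le (x := on y S) hg0).trans (le_of_eq ?_)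
        rw [hg]; field_simp
      linarith
    have hYle : ∀ j, |Y q j| ≤ 2 * |y j| := by
      intro j
      simp only [hY, hq, Pi.smul_apply, smul_eq_mul, abs_mul, abs_of_pos hg0]
      have h1 := abs_round_le (on y S j / g)
      rw [abs_div, abs_of_pos hg0] at h1
      have h2 : |on y S j| ≤ |y j| := by by_cases hj : j ∈ S <;> simp [on, hj]
      calc g * |(round (on y S j / g) : ℝ)| ≤ g * (2 * (|on y S j| / g)) := by gcongr
        _ = 2 * |on y S j| := by field_simp
        _ ≤ _ := by gcongr
    refine Set.mem_iUnion₂.mpr ⟨(h', q), Finset.mem_product.mpr ⟨hh'mem, hqmem⟩, ?_, ?_, ?_, ?_, ?_⟩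
    · intro j
      by_cases hj : j ∈ J
      · left
        have := hYle j
        rw [hsplit.body j hj] at this
        simpa using this
      · right
        simp [hY, hh', hsplit.head j hj]
    · intro j
      refine (hYle j).trans ?_
      have := hyA j
      linarith
    · have h1 : 1 / 2 ≤ l2 (Y q) := by
        have h2 : y = Y q - (Y q - y) := by abel
        have h3 := l2_sub_le (Y q) (Y q - y)
        rw [← h2, hsplit.l2_eq] at h3
        linarith
      rw [← l2_sq]
      have := pow_le_pow_left₀ (by norm_num) h1 2
      linarith
    · have h1 : l2 (Y q) ≤ 2 * l2 y := by
        have h2 := l2_smul 2 y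
        rw [abs_of_pos (by norm_num)] at h2
        rw [← h2]
        refine l2_mono fun j => ?_
        simp only [Pi.smul_apply, smul_eq_mul, abs_mul, abs_of_pos (by norm_num : (0 : ℝ) < 2)]
        exact hYle j
      rw [hsplit.l2_eq] at h1
      rw [← l2_sq]
      have := pow_le_pow_left₀ (l2_nonneg _) h1 2
      linarith
    · have h1 : Y h' + Y q = (h + y) + ((Y h' - h) + (Y q - y)) := by abel
      have h2 : l2 ((Y h' - h) + (Y q - y)) ≤ 3 * ε := (l2_add_le _ _).trans (by linarith)
      have h3 := hop ((Y h' - h) + (Y q - y))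
      show l2 (app M (Y h' + Y q)) ≤ _
      rw [h1, app_add]
      refine (l2_add_le _ _).trans ?_
      have h4 : 0 ≤ √(n * p) := Real.sqrt_nonneg _
      calc _ ≤ b / 2 * √(n * p) + K * √(n * p) * (3 * ε) := by
            gcongr
            exact h3.trans (by gcongr)
        _ = (b / 2 + ε * (6 * K) / 2) * √(n * p) := by ring
        _ ≤ b * √(n * p) := by gcongr; linarith
  have hcardB : ((l1Ball (Fin n) Q).card : ℝ) ≤ Real.exp (c / 2 * n) := by
    refine (card_l1Ball_le ha0 Q).trans ?_
    rw [hea, Fintype.card_fin]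
    have h1 : 1 + 2 * w / (1 - w) ≤ Real.exp (c / 4) := by
      have h2 : 2 * w / (1 - w) ≤ 4 * w := by
        rw [div_le_iff₀ (by linarith)]; nlinarith
      have := Real.add_one_le_exp (c / 4)
      linarith
    have h3 : a * Q ≤ c / 4 * n := by
      have h4 : (Q : ℝ) ≤ 2 * (√s * n / ε) := Nat.floor_le (by positivity)
      calc a * Q ≤ a * (2 * (c * ε / (8 * a) * n / ε)) := by
            refine mul_le_mul_of_nonneg_left (h4.trans ?_) ha0.le
            gcongr
        _ = _ := by field_simp; norm_num
    have h1' : 0 ≤ 1 + 2 * w / (1 - w) := by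
      have : 0 < 1 - w := by linarith
      positivity
    calc _ ≤ Real.exp (c / 4 * n) * Real.exp (c / 4) ^ n :=
          mul_le_mul (Real.exp_le_exp.mpr h3) (pow_le_pow_left₀ h1' h1 n)
            (pow_nonneg h1' _) (Real.exp_pos _).le
      _ = _ := by rw [← Real.exp_nat_mul, ← Real.exp_add]; congr 1; ring
  have hcardA : ((sparseBox (Fin n) m H).card : ℝ) ≤ Real.exp (c / 8 * n) := by
    refine le_trans ?_ hbudget
    have := card_sparseBox_le (ι := Fin n) m H
    rw [Fintype.card_fin] at this
    exact_mod_cast this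
  refine (measureReal_mono hsub (measure_ne_top _ _)).trans ((measureReal_biUnion_finset_le _ _).trans ?_)
  refine (Finset.sum_le_sum fun w _ => hEle w).trans ?_
  rw [Finset.sum_const, nsmul_eq_mul, Finset.card_product]
  push_cast
  calc _ ≤ Real.exp (c / 8 * n) * Real.exp (c / 2 * n) * Real.exp (-c * n) := by gcongr
    _ = Real.exp (-(3 / 8 * c) * n) := by
        rw [← Real.exp_add, ← Real.exp_add]; congr 1; ring
    _ ≤ _ := Real.exp_le_exp.mpr (by nlinarith)

/-! ### Vectors with a rich arithmetic structure -/

/-- No restriction of `y` to the complement of a set of at most `s n` coordinates is small. -/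
def IsSpread {n : ℕ} (s ε : ℝ) (y : Fin n → ℝ) : Prop :=
  ∀ S : Finset (Fin n), S.card ≤ s * n → ε ≤ l2 (off y S)

/-- The set of coordinates of a unit vector exceeding `1 / √(s n)` has at most `s n` elements. -/
theorem card_filter_lt_abs_le {n : ℕ} {s : ℝ} (hs : 0 < s) (hn : 0 < n) {y : Fin n → ℝ}
    (hy : l2 y = 1) :
    ((Finset.univ.filter fun j => 1 / √(s * n) < |y j|).card : ℝ) ≤ s * n := by
  have hn0 : (0 : ℝ) < n := by exact_mod_cast hn
  have h1 : ∑ j ∈ Finset.univ.filter (fun j => 1 / √(s * n) < |y j|), 1 / (s * n) ≤ 1 := by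
    calc _ ≤ ∑ j ∈ Finset.univ.filter (fun j => 1 / √(s * n) < |y j|), y j ^ 2 :=
          Finset.sum_le_sum fun j hj => by
            have h2 := pow_le_pow_left₀ (by positivity) (Finset.mem_filter.mp hj).2.le 2
            rwa [div_pow, one_pow, Real.sq_sqrt (by positivity), sq_abs] at h2
      _ ≤ ∑ j, y j ^ 2 := Finset.sum_le_sum_of_subset_of_nonneg (Finset.subset_univ _)
          fun _ _ _ => sq_nonneg _
      _ = 1 := by rw [← l2_sq, hy, one_pow]
  rw [Finset.sum_const, nsmul_eq_mul, mul_one_div, div_le_one (by positivity)] at h1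
  exact h1

/-- Coordinates of size at most 1/√(sn) stay in [-1/2, 1/2] after dilation, hence are nearest to
zero, and the few larger ones may be dropped by spreadness. -/
theorem IsSpread.mul_le_latticeDist {n : ℕ} {s ε : ℝ} {y : Fin n → ℝ} (h : IsSpread s ε y)
    (hs : 0 < s) (hn : 0 < n) (hy : l2 y = 1) {θ : ℝ} (h0 : 0 ≤ θ) (hθ : θ ≤ √(s * n) / 2) :
    ε * θ ≤ latticeDist (θ • y) := by
  have hn0 : (0 : ℝ) < n := by exact_mod_cast hn
  set S := Finset.univ.filter fun j => 1 / √(s * n) < |y j| with hS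
  have h1 := h S (card_filter_lt_abs_le hs hn hy)
  calc ε * θ ≤ |θ| * l2 (off y S) := by rw [abs_of_nonneg h0, mul_comm]; gcongr
    _ = l2 (θ • off y S) := (l2_smul _ _).symm
    _ ≤ latticeDist (θ • y) := l2_mono fun j => by
        by_cases hj : j ∈ S
        · simp [off, hj]
        · simp only [off, hj, Pi.smul_apply, smul_eq_mul, if_false]
          refine abs_le_abs_sub_round ?_
          have h2 : |y j| ≤ 1 / √(s * n) := by
            by_contra h3
            exact hj (by simpa [hS] using h3)
          rw [abs_mul, abs_of_nonneg h0]
          calc θ * |y j| ≤ √(s * n) / 2 * (1 / √(s * n)) := by gcongr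
            _ = 1 / 2 := by
              have : 0 < √(s * n) := by positivity
              field_simp

/-- It suffices to control integer dilations: rounding θ up moves the dilated unit vector by at most
one, the distance to the lattice is 1-Lipschitz, and one is at most half of α√n. -/
theorem IsSpread.min_le_latticeDist {n : ℕ} {s ε α : ℝ} {y : Fin n → ℝ} (h : IsSpread s ε y)
    (hs : 0 < s) (hn : 0 < n) (hy : l2 y = 1) (hα : 2 ≤ α * √n) {D : ℕ}
    (hD : ∀ N : ℕ, √(s * n) / 2 ≤ N → N < D → α * √n < latticeDist ((N : ℝ) • y)) {θ : ℝ}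
    (h0 : 0 ≤ θ) (hθ : θ + 1 ≤ D) : min (ε * θ) (α * √n / 2) ≤ latticeDist (θ • y) := by
  rcases le_total θ (√(s * n) / 2) with h1 | h1
  · exact (min_le_left _ _).trans (h.mul_le_latticeDist hs hn hy h0 h1)
  · refine (min_le_right _ _).trans ?_
    have h2 := Nat.le_ceil θ
    have h3 := Nat.ceil_lt_add_one h0
    have h4 := hD ⌈θ⌉₊ (h1.trans h2) (by exact_mod_cast h3.trans_le hθ)
    have h5 := latticeDist_le_add (((⌈θ⌉₊ : ℕ) : ℝ) • y) (θ • y)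
    rw [← sub_smul, l2_smul, hy, abs_of_nonneg (by linarith)] at h5
    linarith

/-- By Cauchy–Schwarz a small Euclidean norm forces Σ |M_i · z|/t ≤ n, and each exponential moment
is at most 4b. Working with |x|/t rather than its square allows the small ball bound to be used at
all larger scales. -/
theorem SparseLaw.matLaw_lattice_le {ν : Measure ℝ} {p κ B : ℝ} (hν : SparseLaw ν p κ B)
    (hp : 0 < p) (hp1 : p ≤ 1) (hκ : 0 < κ) (hB : 1 ≤ B) {n : ℕ} {ι : Type} [Fintype ι]
    (r : ι → Fin n) (d : ι → ℝ) (hr : Function.Injective r)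
    {y z : Fin n → ℝ} (hyz : ∀ j, y j = 0 ∨ z j = y j) {e g Θ t b : ℝ} (he : 0 < e) (hg : 0 < g)
    (hΘ : 0 < Θ) (hy : ∀ θ : ℝ, 0 ≤ θ → θ ≤ Θ → min (e * θ) g ≤ latticeDist (θ • y))
    (ht : B / Θ ≤ t)
    (hb : 32 * √(Real.pi ^ 3 / (2 * κ * e ^ 2)) * (t / √p) + 32 * Real.exp (-8 * κ * p * g ^ 2) ≤ b) :
    (matLaw ν r d).real {M | l2 (app M z) ≤ √n * t} ≤ Real.exp n * (4 * b) ^ Fintype.card ι := by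
  have := hν.prob
  have ht0 : 0 < t := lt_of_lt_of_le (by positivity) ht
  have hcard : Fintype.card ι ≤ n := by simpa using Fintype.card_le_of_injective r hr
  have hmain := measureReal_pi_sum_le_le (fun i => rowLaw ν (r i) (d i))
    (fun _ X => |X ⬝ᵥ z| / t) (fun _ => 4 * b)
    (fun i => integrable_exp_neg_of_nonneg _
      (by have := measurable_dotProduct_const z; fun_prop) (fun X => by positivity)) (fun i => by
      rw [integral_rowLaw_eq_rowSum ν (r i) (d i) z (f := fun x => Real.exp (-(|x| / t)))
        (by fun_prop)]
      refine integral_exp_neg_abs_div_le _ ht0 fun u hu => ?_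
      refine (hν.measureReal_rowSum_le hp hp1 hκ hB (r i) (d i) hyz he hg hΘ hy
        (ht.trans (by nlinarith))).trans ?_
      have h1 : 0 < Real.exp (-8 * κ * p * g ^ 2) := Real.exp_pos _
      calc _ ≤ u * (32 * √(Real.pi ^ 3 / (2 * κ * e ^ 2)) * (t / √p)) +
            u * (32 * Real.exp (-8 * κ * p * g ^ 2)) := by
            refine add_le_add (le_of_eq (by ring)) ?_
            nlinarith
        _ ≤ _ := by rw [← mul_add]; gcongr) n
  rw [Finset.prod_const, Finset.card_univ] at hmain
  refine (measureReal_mono fun M hM => ?_).trans hmain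
  have hM : l2 (app M z) ≤ √n * t := hM
  show ∑ i, |M i ⬝ᵥ z| / t ≤ n
  rw [← Finset.sum_div, div_le_iff₀ ht0]
  refine (sum_abs_le_sqrt_card_mul_l2 (app M z) Finset.univ).trans ?_
  rw [Finset.card_univ]
  calc _ ≤ √n * (√n * t) := mul_le_mul (by gcongr) hM (l2_nonneg _) (by positivity)
    _ = n * t := by rw [← mul_assoc, Real.mul_self_sqrt (by positivity)]

/-- `card_l1Ball_le` at a = √n/D, which is bounded thanks to the lower bound on `D`. The growth
(D/√n)^n is what the small ball factor (√n/D)^(n-1) has to compensate. -/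
theorem card_l1Ball_lattice_le {n D : ℕ} {γ : ℝ} (hγ : 0 < γ) (hn : 0 < n) (hD : γ * √n ≤ D) :
    ((l1Ball (Fin n) ⌊2 * (D * √n)⌋₊).card : ℝ) ≤
      (Real.exp 2 * (2 * (1 + 1 / γ)) * (D / √n)) ^ n := by
  have hn0 : (0 : ℝ) < n := by exact_mod_cast hn
  have hsn : 0 < √(n : ℝ) := Real.sqrt_pos.mpr hn0
  have hD0 : (0 : ℝ) < D := lt_of_lt_of_le (by positivity) hD
  set a := √n / D with ha
  have ha0 : 0 < a := by positivity
  have ha1 : a ≤ 1 / γ := by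
    rw [ha, div_le_div_iff₀ hD0 hγ]; linarith
  refine (card_l1Ball_le ha0 _).trans ?_
  rw [Fintype.card_fin, mul_assoc, mul_pow, ← Real.exp_nat_mul]
  have h1 : Real.exp (-a) ≤ 1 / (1 + a) := by
    rw [Real.exp_neg, ← one_div]
    exact one_div_le_one_div_of_le (by positivity) (by linarith [Real.add_one_le_exp a])
  have h2 : a / (1 + a) ≤ 1 - Real.exp (-a) := by
    have : a / (1 + a) = 1 - 1 / (1 + a) := by field_simp; ring
    linarith
  have h3 : 0 < 1 - Real.exp (-a) := lt_of_lt_of_le (by positivity) h2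
  have h4 : 1 + 2 * Real.exp (-a) / (1 - Real.exp (-a)) ≤ 2 * (1 + 1 / γ) * (D / √n) := by
    have h5 : 1 + 2 * Real.exp (-a) / (1 - Real.exp (-a)) =
        (1 + Real.exp (-a)) / (1 - Real.exp (-a)) := by field_simp; ring
    rw [h5]
    calc _ ≤ 2 / (a / (1 + a)) := by
          refine div_le_div₀ (by norm_num) ?_ (by positivity) h2
          have : Real.exp (-a) ≤ 1 := by rw [Real.exp_le_one_iff]; linarith
          linarith
      _ = 2 * (1 + a) * (D / √n) := by rw [ha]; field_simp
      _ ≤ _ := by gcongr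
  refine mul_le_mul (Real.exp_le_exp.mpr ?_) (pow_le_pow_left₀ (by positivity) h4 n)
    (by positivity) (Real.exp_pos _).le
  calc a * ⌊2 * (D * √n)⌋₊ ≤ a * (2 * (D * √n)) := by
        gcongr
        exact Nat.floor_le (by positivity)
    _ = n * 2 := by
        rw [ha]
        field_simp
        rw [Real.sq_sqrt hn0.le]

set_option maxHeartbeats 1000000 in
/-- A null vector of the random matrix has no rich arithmetic structure. -/
theorem exists_matLaw_structured_le {κ B K s ε : ℝ} (hκ : 0 < κ) (hκ1 : κ ≤ 1) (hB : 1 ≤ B)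
    (hK : 1 ≤ K) (hs : 0 < s) (hε : 0 < ε) :
    ∃ α w C₀ : ℝ, 0 < α ∧ 0 < w ∧ w ≤ 1 ∧ w ≤ κ * α ^ 2 / 4 ∧ ∀ (p : ℝ), 0 < p → p ≤ 1 →
      ∀ ν : Measure ℝ, SparseLaw ν p κ B → ∀ (n : ℕ), C₀ ≤ n * p → ∀ (ι : Type) [Fintype ι]
        (r : ι → Fin n) (d : ι → ℝ), Function.Injective r → n ≤ Fintype.card ι + 1 →
        ∀ (m : ℕ) (H : ℝ), 0 ≤ H → m ≤ n →
        (n * (4 * (Real.exp (w * (n * p)) * H / α) + 1)) ^ m ≤ Real.exp n →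
        (matLaw ν r d).real {M | OpBound M (K * √(n * p)) ∧ ∃ J h y, IsSplit m J h y ∧
          l2 h ≤ H ∧ IsSpread s ε y ∧ app M (h + y) = 0 ∧
          ¬ ∀ θ : ℝ, 0 ≤ θ → θ + 1 ≤ Real.exp (w * (n * p)) →
            min (ε / 2 * θ) (α * √n / 4) ≤ latticeDist (θ • y)} ≤ Real.exp (-n) := by
  classical
  have hK0 : 0 < K := by linarith
  set γ := √s / 2 with hγ
  have hγ0 : 0 < γ := by positivity
  set CL := 32 * √(Real.pi ^ 3 / (2 * κ * (ε / 2) ^ 2)) with hCL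
  have hCL0 : 0 < CL := by have := Real.pi_pos; positivity
  set C1 := Real.exp 2 * (2 * (1 + 1 / γ)) with hC1
  have hC10 : 0 < C1 := by positivity
  set C2 := 16 * CL * K with hC2
  have hC20 : 0 < C2 := by positivity
  -- The entry γε/2 keeps the rounding error below half of the linear lower bound, γ/C2 makes the
  -- small ball base at most one, and the last entry brings the product of net and small ball
  -- constants down to e⁻¹².
  set α := min (min 1 (γ * ε / 2)) (min (γ / C2) (Real.exp (-12) / (C1 * C2))) with hα
  have hα0 : 0 < α := by positivity
  have hα1 : α ≤ 1 := (min_le_left _ _).trans (min_le_left _ _)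
  have hα2 : α ≤ γ * ε / 2 := (min_le_left _ _).trans (min_le_right _ _)
  have hα3 : C2 * α ≤ γ := by
    rw [mul_comm, ← le_div_iff₀ hC20]; exact (min_le_right _ _).trans (min_le_left _ _)
  have hα4 : C1 * (C2 * α) ≤ Real.exp (-12) := by
    have : α * (C1 * C2) ≤ Real.exp (-12) := by
      rw [← le_div_iff₀ (by positivity)]; exact (min_le_right _ _).trans (min_le_right _ _)
    linarith
  -- Then the additive Esseen error equals a constant times exp(-2wT), which for dilations D ≤
  -- exp(wT) is at most that constant over D and is absorbed in the main term.
  set w := κ * α ^ 2 / 4 with hw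
  have hw0 : 0 < w := by positivity
  have hw1 : w ≤ 1 := by rw [hw]; nlinarith
  set C₀ := max (max ((2 / α) ^ 2) ((4 / γ) ^ 2)) (max (max ((4 * B / (K * α)) ^ 2)
    ((16 / (CL * K * α)) ^ 2)) (2 * C1 * Real.exp 12 + 1)) with hC₀
  refine ⟨α, w, C₀, hα0, hw0, hw1, le_rfl, ?_⟩
  intro p hp hp1 ν hν n hT ι _ r d hr hcard m H hH hmn hbudget
  have := hν.prob
  set T := n * p with hTdef
  have hT1 : C₀ ≤ T := hT
  have hTpos : 0 < T := lt_of_lt_of_le (lt_of_lt_of_le (by positivity)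
    ((le_max_right _ _).trans (le_max_right _ _))) hT1
  have hn0 : (0 : ℝ) < n := by
    by_contra h0
    have : (n : ℝ) * p ≤ 0 := mul_nonpos_of_nonpos_of_nonneg (not_lt.mp h0) hp.le
    linarith
  have hn : 0 < n := by exact_mod_cast hn0
  have hTn : T ≤ n := by rw [hTdef]; nlinarith
  have hsn : 0 < √(n : ℝ) := Real.sqrt_pos.mpr hn0
  have hsT : 0 < √T := Real.sqrt_pos.mpr hTpos
  have hsqrt : ∀ a : ℝ, 0 ≤ a → a ^ 2 ≤ C₀ → a ≤ √T ∧ a ≤ √n := fun a ha h =>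
    ⟨Real.le_sqrt_of_sq_le (h.trans hT1), Real.le_sqrt_of_sq_le (h.trans (hT1.trans hTn))⟩
  have hc1 : 2 ≤ α * √n := by
    have := (hsqrt (2 / α) (by positivity) ((le_max_left _ _).trans (le_max_left _ _))).2
    rw [div_le_iff₀ hα0] at this; linarith
  have hc2 : 4 ≤ γ * √n := by
    have := (hsqrt (4 / γ) (by positivity) ((le_max_right _ _).trans (le_max_left _ _))).2
    rw [div_le_iff₀ hγ0] at this; linarith
  have hc3 : 4 * B ≤ K * α * √T := by
    have := (hsqrt (4 * B / (K * α)) (by positivity)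
      ((le_max_left _ _).trans ((le_max_left _ _).trans (le_max_right _ _)))).1
    rw [div_le_iff₀ (by positivity)] at this; linarith
  have hc4 : 16 ≤ CL * K * α * √n := by
    have := (hsqrt (16 / (CL * K * α)) (by positivity)
      ((le_max_right _ _).trans ((le_max_left _ _).trans (le_max_right _ _)))).2
    rw [div_le_iff₀ (by positivity)] at this; linarith
  have hc5 : 2 * C1 * Real.exp 12 ≤ Real.exp n := by
    have h1 : 2 * C1 * Real.exp 12 + 1 ≤ C₀ := (le_max_right _ _).trans (le_max_right _ _)
    have h2 := Real.add_one_le_exp (n : ℝ)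
    linarith
  have hγs : √(s * n) / 2 = γ * √n := by rw [Real.sqrt_mul hs.le, hγ]; ring
  set X := Real.exp (w * T) with hX
  have hX0 : 0 < X := Real.exp_pos _
  have hXn : X ≤ Real.exp n := Real.exp_le_exp.mpr (by nlinarith)
  set Hn := ⌊2 * (X * H / α)⌋₊ with hHn
  set Ds : Finset ℕ := (Finset.range (⌊X⌋₊ + 1)).filter fun D : ℕ => γ * √n ≤ D with hDs
  set Z : ℕ → (Fin n → ℤ) → Fin n → ℝ := fun D h => (α / D) • fun j => (h j : ℝ) with hZ
  set Y : ℕ → (Fin n → ℤ) → Fin n → ℝ := fun D q => (1 / (D : ℝ)) • fun j => (q j : ℝ) with hY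
  set Cond : ℕ → (Fin n → ℤ) × (Fin n → ℤ) → Prop := fun D u =>
    (∀ j, Y D u.2 j = 0 ∨ (Z D u.1 + Y D u.2) j = Y D u.2 j) ∧
    ∀ θ : ℝ, 0 ≤ θ → θ ≤ D / 8 → min (ε / 2 * θ) (α * √n / 4) ≤ latticeDist (θ • Y D u.2) with hCond
  set E : ℕ → (Fin n → ℤ) × (Fin n → ℤ) → Set (ι → Fin n → ℝ) := fun D u =>
    {M | Cond D u ∧ l2 (app M (Z D u.1 + Y D u.2)) ≤ √n * (2 * K * α * √T / D)} with hE
  have hsub : {M : ι → Fin n → ℝ | OpBound M (K * √T) ∧ ∃ J h y, IsSplit m J h y ∧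
          l2 h ≤ H ∧ IsSpread s ε y ∧ app M (h + y) = 0 ∧
          ¬ ∀ θ : ℝ, 0 ≤ θ → θ + 1 ≤ X → min (ε / 2 * θ) (α * √n / 4) ≤ latticeDist (θ • y)} ⊆
      ⋃ D ∈ Ds, ⋃ u ∈ sparseBox (Fin n) m Hn ×ˢ l1Ball (Fin n) ⌊2 * (D * √n)⌋₊, E D u := by
    rintro M ⟨hop, J, h, y, hsplit, hhH, hspread, hker, hneg⟩
    -- Failure of the lower bound at a real θ is traced back to an integer dilation close to the
    -- lattice; dilations below γ√n are excluded by spreadness.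
    have hex : ∃ D : ℕ, γ * √n ≤ D ∧ (D : ℝ) ≤ X ∧ latticeDist ((D : ℝ) • y) ≤ α * √n := by
      by_contra hcon
      push Not at hcon
      refine hneg fun θ h0 hθ => ?_
      have h1 := hspread.min_le_latticeDist hs hn hsplit.l2_eq hc1 (D := ⌊X⌋₊ + 1)
        (fun N hN1 hN2 => hcon N (by rwa [hγs] at hN1)
          ((Nat.le_floor_iff hX0.le).mp (Nat.lt_succ_iff.mp hN2))) h0
        (by have := Nat.lt_floor_add_one X; push_cast; linarith)
      refine le_trans (min_le_min ?_ ?_) h1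
      · exact mul_le_mul_of_nonneg_right (by linarith) h0
      · have : 0 ≤ α * √n := by positivity
        linarith
    classical
    -- For the least such D, the point q/D is within α√n/D of y. By minimality y avoids the lattice
    -- at smaller dilations, and q/D inherits this for θ ≤ D/8, with halved constants; this is what
    -- the small ball estimate for q/D needs.
    set D := Nat.find hex with hD
    obtain ⟨hD1, hD2, hD3⟩ := Nat.find_spec hex
    have hDmin : ∀ N : ℕ, √(s * n) / 2 ≤ N → N < D → α * √n < latticeDist ((N : ℝ) • y) := by
      intro N hN1 hN2
      by_contra hcon
      refine Nat.find_min hex hN2 ⟨by rwa [hγs] at hN1, ?_, not_lt.mp hcon⟩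
      exact le_trans (Nat.cast_le.mpr (Nat.le_of_lt hN2)) hD2
    have hDpos : (0 : ℝ) < D := lt_of_lt_of_le (by positivity) hD1
    have hD4 : (4 : ℝ) ≤ D := hc2.trans hD1
    set h' : Fin n → ℤ := fun j => round (h j / (α / D)) with hh'
    set q : Fin n → ℤ := fun j => round ((D : ℝ) * y j) with hq
    have hYq : l2 (Y D q - y) ≤ α * √n / D := by
      have h1 : Y D q - y = (-(1 / (D : ℝ))) • (fun j => ((D : ℝ) • y) j - round (((D : ℝ) • y) j)) := by
        ext j
        simp only [hY, hq, Pi.sub_apply, Pi.smul_apply, smul_eq_mul]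
        field_simp
        ring
      rw [h1, l2_smul, abs_neg, abs_of_pos (by positivity), one_div_mul_eq_div]
      exact div_le_div_of_nonneg_right hD3 hDpos.le
    have hZh : l2 (Z D h' - h) ≤ α * √n / D := by
      refine (l2_sub_smul_round_le (x := h) (a := α / D) (by positivity)).trans (le_of_eq ?_)
      ring
    have hh'mem : h' ∈ sparseBox (Fin n) m Hn := by
      refine mem_sparseBox (by simpa using hmn) hsplit.card_le
        (fun j hj => by simp [hh', hsplit.head j hj]) fun j => ?_
      have h1 : |(h' j : ℝ)| ≤ 2 * (X * H / α) := by
        refine (abs_round_le _).trans ?_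
        rw [abs_div, abs_of_pos (by positivity : 0 < α / (D : ℝ))]
        calc 2 * (|h j| / (α / D)) = 2 * (D * |h j| / α) := by field_simp
          _ ≤ _ := by
            gcongr
            exact (abs_le_l2 h j).trans hhH
      have h3 : 0 ≤ |h' j| := abs_nonneg _
      obtain ⟨N, hN⟩ := Int.eq_ofNat_of_zero_le h3
      have h2 : ((|h' j| : ℤ) : ℝ) ≤ 2 * (X * H / α) := by push_cast; exact h1
      rw [hN] at h2 ⊢
      exact_mod_cast Nat.le_floor (by exact_mod_cast h2)
    have hqmem : q ∈ l1Ball (Fin n) ⌊2 * (D * √n)⌋₊ := by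
      refine mem_l1Ball ?_
      have h1 : ∑ j, |(q j : ℝ)| ≤ 2 * (D * √n) := by
        calc ∑ j, |(q j : ℝ)| ≤ ∑ j, 2 * D * |y j| := Finset.sum_le_sum fun j _ => by
              refine (abs_round_le _).trans ?_
              rw [abs_mul, abs_of_pos hDpos, mul_assoc]
          _ = 2 * D * ∑ j, |y j| := by rw [Finset.mul_sum]
          _ ≤ 2 * D * (√n * 1) := by
              gcongr
              have := sum_abs_le_sqrt_card_mul_l2 y Finset.univ
              rw [hsplit.l2_eq] at this
              simpa using this
          _ = _ := by ring
      have h2 : ((∑ j, |q j| : ℤ) : ℝ) ≤ 2 * (D * √n) := by push_cast; exact h1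
      have h3 : 0 ≤ ∑ j, |q j| := Finset.sum_nonneg fun _ _ => abs_nonneg _
      obtain ⟨N, hN⟩ := Int.eq_ofNat_of_zero_le h3
      rw [hN] at h2 ⊢
      exact_mod_cast Nat.le_floor (by exact_mod_cast h2)
    have hDmem : D ∈ Ds := by
      refine Finset.mem_filter.mpr ⟨Finset.mem_range.mpr (Nat.lt_succ_iff.mpr (Nat.le_floor hD2)), hD1⟩
    refine Set.mem_iUnion₂.mpr ⟨D, hDmem, Set.mem_iUnion₂.mpr
      ⟨(h', q), Finset.mem_product.mpr ⟨hh'mem, hqmem⟩, ⟨?_, ?_⟩, ?_⟩⟩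
    · intro j
      by_cases hj : j ∈ J
      · left; simp [hY, hq, hsplit.body j hj]
      · right; simp [hZ, hh', hsplit.head j hj]
    · intro θ h0 hθ
      have h1 := hspread.min_le_latticeDist hs hn hsplit.l2_eq hc1 hDmin h0 (by linarith)
      have h2 := latticeDist_le_add (θ • y) (θ • Y D q)
      rw [← smul_sub, l2_smul, abs_of_nonneg h0, l2_sub_comm] at h2
      have h3 : θ * l2 (Y D q - y) ≤ θ * (α * √n / D) := by gcongr
      have h4 : θ * (α * √n / D) ≤ α * √n / 8 := by
        calc θ * (α * √n / D) ≤ D / 8 * (α * √n / D) := by gcongr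
          _ = _ := by field_simp
      have h5 : θ * (α * √n / D) ≤ ε / 2 * θ := by
        rw [mul_comm]
        refine mul_le_mul_of_nonneg_right ?_ h0
        rw [div_le_iff₀ hDpos]
        calc α * √n ≤ γ * ε / 2 * √n := by gcongr
          _ = ε / 2 * (γ * √n) := by ring
          _ ≤ _ := by gcongr
      rcases min_le_iff.mp h1 with h6 | h6
      · refine (min_le_left _ _).trans ?_
        show _ ≤ latticeDist (θ • Y D q)
        linarith
      · refine (min_le_right _ _).trans ?_
        show _ ≤ latticeDist (θ • Y D q)
        have : 0 ≤ α * √n := by positivity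
        linarith
    · have h1 : Z D h' + Y D q = (h + y) + ((Z D h' - h) + (Y D q - y)) := by abel
      show l2 (app M (Z D h' + Y D q)) ≤ _
      rw [h1, app_add, hker, zero_add]
      refine (hop _).trans ?_
      calc _ ≤ K * √T * (α * √n / D + α * √n / D) := by
            gcongr
            exact (l2_add_le _ _).trans (add_le_add hZh hYq)
        _ = _ := by ring
  have hEle : ∀ D ∈ Ds, ∀ u, (matLaw ν r d).real (E D u) ≤
      Real.exp n * (C2 * α * (√n / D)) ^ (n - 1) := by
    intro D hD u
    have hD1 : γ * √n ≤ D := (Finset.mem_filter.mp hD).2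
    have hD2 : (D : ℝ) ≤ X := (Nat.le_floor_iff hX0.le).mp
      (Nat.lt_succ_iff.mp (Finset.mem_range.mp (Finset.mem_filter.mp hD).1))
    have hDpos : (0 : ℝ) < D := lt_of_lt_of_le (by positivity) hD1
    by_cases hcond : Cond D u
    · have hsp : 0 < √p := Real.sqrt_pos.mpr hp
      have hTs : √T = √n * √p := by rw [hTdef, Real.sqrt_mul hn0.le]
      have hb : 32 * √(Real.pi ^ 3 / (2 * κ * (ε / 2) ^ 2)) * (2 * K * α * √T / D / √p) +
          32 * Real.exp (-8 * κ * p * (α * √n / 4) ^ 2) ≤ 4 * CL * K * α * (√n / D) := by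
        have h1 : 2 * K * α * √T / D / √p = 2 * K * α * (√n / D) := by
          rw [hTs]; field_simp
        have h2 : -8 * κ * p * (α * √n / 4) ^ 2 = -(w * T) + -(w * T) := by
          rw [div_pow, mul_pow, Real.sq_sqrt hn0.le, hw, hTdef]; ring
        rw [h1, ← hCL, h2, Real.exp_add, Real.exp_neg, ← hX]
        have h3 : X⁻¹ * X⁻¹ ≤ 1 / D := by
          have h4 : 1 ≤ X := Real.one_le_exp (by positivity)
          calc X⁻¹ * X⁻¹ ≤ 1 * X⁻¹ := by gcongr; exact inv_le_one_of_one_le₀ h4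
            _ ≤ 1 / D := by rw [one_mul, one_div]; exact inv_anti₀ hDpos hD2
        have h5 : 32 * (1 / (D : ℝ)) ≤ 2 * CL * K * α * (√n / D) := by
          rw [mul_one_div, mul_div_assoc', div_le_div_iff_of_pos_right hDpos]
          linarith
        calc _ ≤ CL * (2 * K * α * (√n / D)) + 32 * (1 / (D : ℝ)) := by gcongr
          _ ≤ _ := by linarith
      have h6 := hν.matLaw_lattice_le hp hp1 hκ hB r d hr (y := Y D u.2) (z := Z D u.1 + Y D u.2)
        hcond.1 (e := ε / 2) (g := α * √n / 4) (Θ := D / 8) (t := 2 * K * α * √T / D)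
        (by positivity) (by positivity) (by positivity) hcond.2 (by
          rw [div_div_eq_mul_div, div_le_div_iff_of_pos_right hDpos]; linarith) hb
      refine (measureReal_mono fun M hM => hM.2).trans (h6.trans ?_)
      have h7 : 4 * (4 * CL * K * α * (√n / D)) = C2 * α * (√n / D) := by rw [hC2]; ring
      rw [h7]
      gcongr Real.exp n * ?_
      refine pow_le_pow_of_le_one (by positivity) ?_ (by omega)
      rw [mul_div_assoc', div_le_one hDpos]
      calc C2 * α * √n ≤ γ * √n := by gcongr
        _ ≤ D := hD1
    · have : E D u = ∅ := by
        ext M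
        simp only [Set.mem_empty_iff_false, iff_false]
        exact fun hM => hcond hM.1
      rw [this, measureReal_empty]
      positivity
  have hhead : ((sparseBox (Fin n) m Hn).card : ℝ) ≤ Real.exp n := by
    refine le_trans ?_ hbudget
    have h1 := card_sparseBox_le (ι := Fin n) m Hn
    rw [Fintype.card_fin] at h1
    have h2 : ((sparseBox (Fin n) m Hn).card : ℝ) ≤ (n * (2 * Hn + 1)) ^ m := by exact_mod_cast h1
    refine h2.trans ?_
    have h3 : (Hn : ℝ) ≤ 2 * (X * H / α) := Nat.floor_le (by positivity)
    exact pow_le_pow_left₀ (by positivity) (mul_le_mul_of_nonneg_left (by linarith) hn0.le) m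
  have hDle : ∀ D ∈ Ds, (matLaw ν r d).real (⋃ u ∈ sparseBox (Fin n) m Hn ×ˢ
      l1Ball (Fin n) ⌊2 * (D * √n)⌋₊, E D u) ≤ Real.exp (-(8 * n)) * (C1 * Real.exp 12) := by
    intro D hD
    have hD1 : γ * √n ≤ D := (Finset.mem_filter.mp hD).2
    have hD2 : (D : ℝ) ≤ X := (Nat.le_floor_iff hX0.le).mp
      (Nat.lt_succ_iff.mp (Finset.mem_range.mp (Finset.mem_filter.mp hD).1))
    have hDpos : (0 : ℝ) < D := lt_of_lt_of_le (by positivity) hD1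
    refine (measureReal_biUnion_finset_le _ _).trans ?_
    refine (Finset.sum_le_sum fun u _ => hEle D hD u).trans ?_
    rw [Finset.sum_const, nsmul_eq_mul, Finset.card_product]
    push_cast
    have h1 := card_l1Ball_lattice_le hγ0 hn hD1
    rw [← hC1] at h1
    obtain ⟨N, hN⟩ : ∃ N, n = N + 1 := ⟨n - 1, by omega⟩
    have hN1 : n - 1 = N := by omega
    -- The net contributes n factors D/√n and the rows n - 1 factors √n/D, as one row may be
    -- missing. A single factor D/√n ≤ exp(n) survives.
    have h2 : (C1 * (D / √n)) ^ n * (C2 * α * (√n / D)) ^ (n - 1) =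
        (C1 * (C2 * α)) ^ N * (C1 * (D / √n)) := by
      rw [hN1]
      have : (C1 * (D / √(n : ℝ))) ^ n = (C1 * (D / √n)) ^ N * (C1 * (D / √n)) := by
        conv_lhs => rw [show (n : ℕ) = N + 1 from hN]
        rw [pow_succ, ← hN]
      rw [this, mul_right_comm, ← mul_pow]
      congr 2
      field_simp
    have h3 : (C1 * (C2 * α)) ^ N ≤ Real.exp 12 * Real.exp (-(12 * n)) := by
      refine (pow_le_pow_left₀ (by positivity) hα4 N).trans (le_of_eq ?_)
      rw [← Real.exp_nat_mul, ← Real.exp_add]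
      congr 1
      rw [hN]; push_cast; ring
    have h4 : D / √n ≤ Real.exp n := by
      refine (div_le_self hDpos.le ?_).trans (hD2.trans hXn)
      nlinarith
    calc _ ≤ Real.exp n * (C1 * (D / √n)) ^ n * (Real.exp n * (C2 * α * (√n / D)) ^ (n - 1)) :=
          mul_le_mul_of_nonneg_right (mul_le_mul hhead h1 (by positivity) (by positivity))
            (by positivity)
      _ = Real.exp n * Real.exp n * ((C1 * (D / √n)) ^ n * (C2 * α * (√n / D)) ^ (n - 1)) := by ring
      _ = Real.exp n * Real.exp n * ((C1 * (C2 * α)) ^ N * (C1 * (D / √n))) := by rw [h2]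
      _ ≤ Real.exp n * Real.exp n * (Real.exp 12 * Real.exp (-(12 * n)) * (C1 * Real.exp n)) := by
          gcongr
      _ = Real.exp n * Real.exp n * Real.exp n * Real.exp (-(12 * n)) * (C1 * Real.exp 12) := by ring
      _ ≤ _ := by
          gcongr
          rw [← Real.exp_add, ← Real.exp_add, ← Real.exp_add]
          exact Real.exp_le_exp.mpr (by linarith)
  refine (measureReal_mono hsub (measure_ne_top _ _)).trans
    ((measureReal_biUnion_finset_le _ _).trans ?_)
  refine (Finset.sum_le_sum hDle).trans ?_
  rw [Finset.sum_const, nsmul_eq_mul]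
  have hDscard : (Ds.card : ℝ) ≤ 2 * Real.exp n := by
    have h1 : Ds.card ≤ ⌊X⌋₊ + 1 := (Finset.card_filter_le _ _).trans (by simp)
    have h2 : (Ds.card : ℝ) ≤ ⌊X⌋₊ + 1 := by exact_mod_cast h1
    have h3 := Nat.floor_le hX0.le
    have h4 : 1 ≤ Real.exp n := Real.one_le_exp hn0.le
    linarith
  calc _ ≤ 2 * Real.exp n * (Real.exp (-(8 * n)) * (C1 * Real.exp 12)) := by gcongr
    _ = Real.exp n * Real.exp (-(8 * n)) * (2 * C1 * Real.exp 12) := by ring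
    _ ≤ Real.exp n * Real.exp (-(8 * n)) * Real.exp n := by gcongr
    _ ≤ _ := by
        rw [← Real.exp_add, ← Real.exp_add]
        exact Real.exp_le_exp.mpr (by linarith)

/-! ### Expansion of the pattern of nonzero entries -/

theorem exp_neg_le_one_sub_half {x : ℝ} (h0 : 0 ≤ x) (h1 : x ≤ 1) : Real.exp (-x) ≤ 1 - x / 2 := by
  rw [Real.exp_neg, inv_le_comm₀ (Real.exp_pos _) (by linarith)]
  refine le_trans ?_ (Real.add_one_le_exp x)
  rw [inv_eq_one_div, div_le_iff₀ (by linarith)]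
  nlinarith

/-! ### Chernoff bounds for counting events in independent rows. -/

section chernoff

variable {ι X : Type*} [Fintype ι] [MeasurableSpace X] (μ : ι → Measure X)
  [∀ i, IsProbabilityMeasure (μ i)]

open scoped Classical in
-- Exponential Markov with the elementary bound exp(-1_A) ≤ 1 - 1_A/2.
theorem measureReal_pi_card_filter_le_le (I : Finset ι) (A : ι → Set X)
    (hA : ∀ i, MeasurableSet (A i)) {q : ℝ} (hq : ∀ i ∈ I, q ≤ (μ i).real (A i)) (a : ℝ) :
    (Measure.pi μ).real {M | ((I.filter fun i => M i ∈ A i).card : ℝ) ≤ a} ≤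
      Real.exp (a - q / 2 * I.card) := by
  set f : ι → X → ℝ := fun i => if i ∈ I then (A i).indicator fun _ => 1 else fun _ => 0 with hf
  have hmeas : ∀ i, Measurable (f i) := by
    intro i; simp only [hf]; split_ifs
    · exact measurable_const.indicator (hA i)
    · exact measurable_const
  have hf0 : ∀ i x, 0 ≤ f i x := by
    intro i x; simp only [hf]; split_ifs
    · exact Set.indicator_nonneg (fun _ _ => zero_le_one) x
    · exact le_rfl
  have hb : ∀ i, ∫ x, Real.exp (-f i x) ∂μ i ≤ if i ∈ I then Real.exp (-(q / 2)) else 1 := by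
    intro i
    by_cases hi : i ∈ I
    · simp only [hf, hi, if_true]
      have hind : Integrable ((A i).indicator fun _ => (1 / 2 : ℝ)) (μ i) :=
        (integrable_const _).indicator (hA i)
      have h1 : ∫ x, Real.exp (-(A i).indicator (fun _ => 1) x) ∂μ i ≤
          ∫ x, (1 - (A i).indicator (fun _ => (1 / 2 : ℝ)) x) ∂μ i := by
        refine integral_mono ?_ ((integrable_const _).sub hind) fun x => ?_
        · exact integrable_exp_neg_of_nonneg _ (measurable_const.indicator (hA i))
            fun x => Set.indicator_nonneg (fun _ _ => zero_le_one) x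
        · by_cases hx : x ∈ A i
          · simp only [Set.indicator_of_mem hx]
            have := exp_neg_le_one_sub_half zero_le_one le_rfl
            linarith
          · simp [Set.indicator_of_notMem hx]
      rw [integral_sub (integrable_const _) hind, integral_indicator_const _ (hA i)] at h1
      simp only [integral_const, probReal_univ, smul_eq_mul] at h1
      have h2 := Real.add_one_le_exp (-(q / 2))
      have h3 := hq i hi
      linarith
    · simp [hf, hi]
  have hmain := measureReal_pi_sum_le_le μ f _
    (fun i => integrable_exp_neg_of_nonneg _ (hmeas i) (hf0 i)) hb a
  rw [Finset.prod_ite, Finset.prod_const, Finset.prod_const_one, mul_one, ← Real.exp_nat_mul,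
    ← Real.exp_add] at hmain
  simp only [Finset.filter_mem_eq_inter, Finset.univ_inter] at hmain
  refine le_trans (le_of_eq ?_) (hmain.trans (le_of_eq ?_))
  · congr 1
    ext M
    have : ∑ i, f i (M i) = ((I.filter fun i => M i ∈ A i).card : ℝ) := by
      rw [Finset.card_filter, ← Finset.sum_subset (Finset.subset_univ I)]
      · push_cast
        exact Finset.sum_congr rfl fun i hi => by simp [hf, hi, Set.indicator_apply]
      · intro i _ hi; simp [hf, hi]
    simp only [Set.mem_ofPred_eq, this]
  · congr 1; ring

open scoped Classical in
-- The parameter `l` stays free: for very rare events a large `l` multiplies the exponent by a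
-- logarithm, which is needed to beat the entropy of choosing the larger set of columns.
theorem measureReal_pi_le_card_filter_le (A : ι → Set X) (hA : ∀ i, MeasurableSet (A i)) {q : ℝ}
    (hq : ∀ i, (μ i).real (A i) ≤ q) {l : ℝ} (hl : 0 ≤ l) (a : ℝ) :
    (Measure.pi μ).real {M | a ≤ ((Finset.univ.filter fun i => M i ∈ A i).card : ℝ)} ≤
      Real.exp (Fintype.card ι * (Real.exp l * q) - l * a) := by
  set f : ι → X → ℝ := fun i => (A i).indicator fun _ => -l with hf
  have hintg : ∀ i, Integrable (fun x => Real.exp (-f i x)) (μ i) := by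
    intro i
    refine Integrable.mono' (g := fun _ => Real.exp l) (integrable_const _)
      (Measurable.aestronglyMeasurable ?_) (Filter.Eventually.of_forall fun x => ?_)
    · have : Measurable (f i) := measurable_const.indicator (hA i)
      fun_prop
    · rw [Real.norm_eq_abs, abs_of_pos (Real.exp_pos _)]
      refine Real.exp_le_exp.mpr ?_
      by_cases hx : x ∈ A i <;> simp [hf, hx, hl]
  have hb : ∀ i, ∫ x, Real.exp (-f i x) ∂μ i ≤ Real.exp (Real.exp l * q) := by
    intro i
    have hind : Integrable ((A i).indicator fun _ => Real.exp l) (μ i) :=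
      (integrable_const _).indicator (hA i)
    have h1 : ∫ x, Real.exp (-f i x) ∂μ i ≤
        ∫ x, (1 + (A i).indicator (fun _ => Real.exp l) x) ∂μ i := by
      refine integral_mono (hintg i) ((integrable_const _).add hind) fun x => ?_
      by_cases hx : x ∈ A i
      · simp [hf, hx]
      · simp [hf, hx]
    rw [integral_add (integrable_const _) hind, integral_indicator_const _ (hA i)] at h1
    simp only [integral_const, probReal_univ, smul_eq_mul] at h1
    have h2 := Real.add_one_le_exp (Real.exp l * q)
    have h3 := mul_le_mul_of_nonneg_right (hq i) (Real.exp_pos l).le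
    linarith
  have hmain := measureReal_pi_sum_le_le μ f _ hintg hb (-(l * a))
  rw [Finset.prod_const, Finset.card_univ, ← Real.exp_nat_mul, ← Real.exp_add] at hmain
  refine le_trans (measureReal_mono fun M hM => ?_) (hmain.trans (le_of_eq ?_))
  · have hM : a ≤ ((Finset.univ.filter fun i => M i ∈ A i).card : ℝ) := hM
    have : ∑ i, f i (M i) = -(l * ((Finset.univ.filter fun i => M i ∈ A i).card : ℝ)) := by
      rw [Finset.card_filter]
      push_cast
      rw [Finset.mul_sum, ← Finset.sum_neg_distrib]
      exact Finset.sum_congr rfl fun i _ => by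
        by_cases h : M i ∈ A i <;> simp [hf, h]
    show ∑ i, f i (M i) ≤ -(l * a)
    rw [this]
    exact neg_le_neg (mul_le_mul_of_nonneg_left hM hl)
  · congr 1; ring

end chernoff

/-! ### Large entries and collisions in one row. -/

section entries

variable {ν : Measure ℝ} {p κ B : ℝ} {n : ℕ}

theorem measurableSet_exists_large (J : Finset (Fin n)) :
    MeasurableSet {X : Fin n → ℝ | ∃ j ∈ J, 1 / 2 ≤ |X j|} := by
  have : {X : Fin n → ℝ | ∃ j ∈ J, 1 / 2 ≤ |X j|} = ⋃ j ∈ J, {X | 1 / 2 ≤ |X j|} := by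
    ext X; simp
  rw [this]
  exact J.measurableSet_biUnion fun j _ => measurableSet_le (by fun_prop) (by fun_prop)

/-- Independence gives failure probability (1 - κp)^|J| ≤ exp(-κp|J|), which is at most 1 - κp|J|/2
in the range considered. -/
theorem SparseLaw.le_rowLaw_exists_large (hν : SparseLaw ν p κ B) (hp : 0 < p) (hκ : 0 < κ)
    {J : Finset (Fin n)} {k : Fin n} (hk : k ∉ J) (a : ℝ) (hJ : κ * p * J.card ≤ 1) :
    κ * p * J.card / 2 ≤ (rowLaw ν k a).real {X | ∃ j ∈ J, 1 / 2 ≤ |X j|} := by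
  have := hν.prob
  have h1 : {X : Fin n → ℝ | ∃ j ∈ J, 1 / 2 ≤ |X j|}ᶜ =
      Set.univ.pi fun j => if j ∈ J then {x : ℝ | 1 / 2 ≤ |x|}ᶜ else Set.univ := by
    ext X
    simp only [Set.mem_compl_iff, Set.mem_ofPred_eq, not_exists, not_and, Set.mem_univ_pi]
    refine forall_congr' fun j => ?_
    by_cases hj : j ∈ J <;> simp [hj]
  have hm : MeasurableSet {x : ℝ | 1 / 2 ≤ |x|} := measurableSet_le (by fun_prop) (by fun_prop)
  have h2 : (rowLaw ν k a).real {X : Fin n → ℝ | ∃ j ∈ J, 1 / 2 ≤ |X j|}ᶜ ≤ (1 - κ * p) ^ J.card := by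
    rw [h1, rowLaw, measureReal_def, Measure.pi_pi, ENNReal.toReal_prod,
      ← Finset.prod_subset (Finset.subset_univ J)]
    · refine (Finset.prod_le_prod (g := fun _ => 1 - κ * p) (fun _ _ => ENNReal.toReal_nonneg)
        fun j hj => ?_).trans (le_of_eq (Finset.prod_const _))
      have hjk : j ≠ k := fun h => hk (h ▸ hj)
      simp only [hj, if_true, entryLaw, hjk, if_false]
      rw [← measureReal_def, probReal_compl_eq_one_sub hm]
      linarith [hν.le_large]
    · intro j _ hj
      simp [hj]
  rw [probReal_compl_eq_one_sub (measurableSet_exists_large J)] at h2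
  have h3 : (1 - κ * p) ^ J.card ≤ Real.exp (-(κ * p * J.card)) := by
    have h4 : 0 ≤ 1 - κ * p := by
      have := hν.le_large.trans (measureReal_le_one (μ := ν))
      linarith
    calc (1 - κ * p) ^ J.card ≤ Real.exp (-(κ * p)) ^ J.card :=
          pow_le_pow_left₀ h4 (Real.one_sub_le_exp_neg _) _
      _ = _ := by rw [← Real.exp_nat_mul]; congr 1; ring
  have h5 := exp_neg_le_one_sub_half (x := κ * p * J.card) (by positivity) hJ
  linarith

/-- Rows with nonzero entries at two positions, one in `J` and the other in `J'`. -/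
def collisionSet (J J' : Finset (Fin n)) (k : Fin n) : Set (Fin n → ℝ) :=
  {X | ∃ j ∈ J, ∃ l ∈ J', l ≠ j ∧ j ≠ k ∧ l ≠ k ∧ X j ≠ 0 ∧ X l ≠ 0}

theorem collisionSet_eq (J J' : Finset (Fin n)) (k : Fin n) :
    collisionSet J J' k = ⋃ u ∈ (J ×ˢ J').filter fun u => u.2 ≠ u.1 ∧ u.1 ≠ k ∧ u.2 ≠ k,
      {X | X u.1 ≠ 0 ∧ X u.2 ≠ 0} := by
  ext X
  simp only [collisionSet, Set.mem_ofPred_eq, Set.mem_iUnion, Finset.mem_filter, Finset.mem_product,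
    exists_prop, Prod.exists]
  constructor
  · rintro ⟨j, hj, l, hl, h1, h2, h3, h4⟩
    exact ⟨j, l, ⟨⟨hj, hl⟩, h1, h2, h3⟩, h4⟩
  · rintro ⟨j, l, ⟨⟨hj, hl⟩, h1, h2, h3⟩, h4⟩
    exact ⟨j, hj, l, hl, h1, h2, h3, h4⟩

theorem measurableSet_collisionSet (J J' : Finset (Fin n)) (k : Fin n) :
    MeasurableSet (collisionSet J J' k) := by
  rw [collisionSet_eq]
  refine Finset.measurableSet_biUnion _ fun u _ => MeasurableSet.inter ?_ ?_
  · exact (measurableSet_eq_fun (measurable_pi_apply u.1) measurable_const).compl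
  · exact (measurableSet_eq_fun (measurable_pi_apply u.2) measurable_const).compl

theorem SparseLaw.rowLaw_collisionSet_le (hν : SparseLaw ν p κ B) (J J' : Finset (Fin n))
    (k : Fin n) (a : ℝ) :
    (rowLaw ν k a).real (collisionSet J J' k) ≤ J.card * J'.card * p ^ 2 := by
  have := hν.prob
  rw [collisionSet_eq]
  refine (measureReal_biUnion_finset_le _ _).trans ?_
  have h1 : ∀ u ∈ (J ×ˢ J').filter (fun u => u.2 ≠ u.1 ∧ u.1 ≠ k ∧ u.2 ≠ k),
      (rowLaw ν k a).real {X | X u.1 ≠ 0 ∧ X u.2 ≠ 0} ≤ p ^ 2 := by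
    intro u hu
    obtain ⟨hne, hk1, hk2⟩ := (Finset.mem_filter.mp hu).2
    have h2 : {X : Fin n → ℝ | X u.1 ≠ 0 ∧ X u.2 ≠ 0} =
        Set.univ.pi fun j => if j ∈ ({u.1, u.2} : Finset (Fin n)) then {0}ᶜ else Set.univ := by
      ext X
      simp only [Set.mem_ofPred_eq, Set.mem_univ_pi]
      constructor
      · rintro ⟨h3, h4⟩ j
        by_cases hj : j ∈ ({u.1, u.2} : Finset (Fin n))
        · simp only [hj, if_true]
          rcases Finset.mem_insert.mp hj with h | h
          · rw [h]; exact h3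
          · rw [Finset.mem_singleton.mp h]; exact h4
        · simp [hj]
      · intro h
        have h3 := h u.1
        have h4 := h u.2
        simp at h3 h4
        exact ⟨h3, h4⟩
    rw [h2, rowLaw, measureReal_def, Measure.pi_pi, ENNReal.toReal_prod,
      ← Finset.prod_subset (Finset.subset_univ ({u.1, u.2} : Finset (Fin n)))]
    · have h5 : p ^ 2 = p ^ ({u.1, u.2} : Finset (Fin n)).card := by
        rw [Finset.card_pair hne.symm]
      rw [h5]
      refine (Finset.prod_le_prod (g := fun _ => p) (fun _ _ => ENNReal.toReal_nonneg)
        fun j hj => ?_).trans (le_of_eq (Finset.prod_const _))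
      have hjk : j ≠ k := by
        rcases Finset.mem_insert.mp hj with h | h
        · rw [h]; exact hk1
        · rw [Finset.mem_singleton.mp h]; exact hk2
      simp only [hj, if_true, entryLaw, hjk, if_false]
      exact hν.nonzero_le
    · intro j _ hj
      simp only [hj, if_false]
      simp
  refine (Finset.sum_le_sum h1).trans ?_
  rw [Finset.sum_const, nsmul_eq_mul]
  gcongr
  have := (Finset.card_filter_le (J ×ˢ J') fun u => u.2 ≠ u.1 ∧ u.1 ≠ k ∧ u.2 ≠ k)
  rw [Finset.card_product] at this
  exact_mod_cast this

end entries

/-! ### Rows meeting a set of columns exactly once. -/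

section expansion

variable {n : ℕ} {ι : Type} [Fintype ι]

open scoped Classical in
/-- The rows whose only nonzero entry among the positions in `J'` is a large entry at `j`. -/
noncomputable def hitRows (r : ι → Fin n) (M : ι → Fin n → ℝ) (J' : Finset (Fin n)) (j : Fin n) :
    Finset ι :=
  Finset.univ.filter fun i => r i ∉ J' ∧ 1 / 2 ≤ |M i j| ∧ ∀ l ∈ J', l ≠ j → M i l = 0

/-- Every set of columns of `M` that is not too small compared with the set `J'` containing it has
many rows that hit it but not the rest of `J'`. -/
def Expands (r : ι → Fin n) (M : ι → Fin n → ℝ) (L m : ℕ) (a : ℝ) : Prop :=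
  ∀ J J' : Finset (Fin n), J ⊆ J' → J.Nonempty → J'.card ≤ L * J.card → J'.card ≤ m →
    a * J.card ≤ ∑ j ∈ J, ((hitRows r M J' j).card : ℝ)

open scoped Classical in
-- A row with a large entry in `J` either meets `J'` only there, or has a second nonzero entry in
-- `J'`, or has its deterministic position in `J'`. Injectivity of `r` bounds the last kind by |J'|.
theorem card_le_sum_card_hitRows (r : ι → Fin n) (hr : Function.Injective r) (M : ι → Fin n → ℝ)
    {J J' : Finset (Fin n)} :
    ((Finset.univ.filter fun i => r i ∉ J).filter
      fun i => M i ∈ {X : Fin n → ℝ | ∃ j ∈ J, 1 / 2 ≤ |X j|}).card ≤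
      ∑ j ∈ J, (hitRows r M J' j).card +
        (Finset.univ.filter fun i => M i ∈ collisionSet J J' (r i)).card + J'.card := by
  have h1 : (Finset.univ.filter fun i => r i ∈ J').card ≤ J'.card :=
    Finset.card_le_card_of_injOn r (fun i hi => (Finset.mem_filter.mp hi).2) hr.injOn
  have h2 := Finset.card_biUnion_le (s := J) (t := fun j => hitRows r M J' j)
  refine le_trans ?_ (add_le_add (add_le_add h2 le_rfl) h1)
  refine le_trans (Finset.card_le_card ?_) ((Finset.card_union_le _ _).trans
    (add_le_add (Finset.card_union_le _ _) le_rfl))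
  intro i hi
  obtain ⟨hi1, j, hj, hij⟩ := Finset.mem_filter.mp hi
  replace hi1 : r i ∉ J := (Finset.mem_filter.mp hi1).2
  by_cases h3 : r i ∈ J'
  · exact Finset.mem_union_right _ (by simpa using h3)
  · by_cases h4 : M i ∈ collisionSet J J' (r i)
    · exact Finset.mem_union_left _ (Finset.mem_union_right _ (by simpa using h4))
    · refine Finset.mem_union_left _ (Finset.mem_union_left _ (Finset.mem_biUnion.mpr ⟨j, hj, ?_⟩))
      refine Finset.mem_filter.mpr ⟨Finset.mem_univ _, h3, hij, fun l hl hlj => ?_⟩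
      by_contra h5
      refine h4 ⟨j, hj, l, hl, hlj, fun h => hi1 (h ▸ hj), fun h => h3 (h ▸ hl), fun h => ?_, h5⟩
      rw [h] at hij
      norm_num at hij

end expansion

theorem choose_le_exp {n m : ℕ} (hm : 0 < m) :
    (n.choose m : ℝ) ≤ Real.exp (m * (1 + Real.log (n / m))) := by
  rcases Nat.eq_zero_or_pos n with h0 | hn
  · subst h0
    rw [Nat.choose_eq_zero_of_lt hm]
    simpa using (Real.exp_pos _).le
  have hm0 : (0 : ℝ) < m := by exact_mod_cast hm
  have hn0 : (0 : ℝ) < n := by exact_mod_cast hn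
  have h1 := Nat.choose_le_pow_div (α := ℝ) m n
  have h2 := Real.pow_div_factorial_le_exp (m : ℝ) hm0.le m
  have hf : (0 : ℝ) < (m.factorial : ℝ) := by exact_mod_cast m.factorial_pos
  calc (n.choose m : ℝ) ≤ (n : ℝ) ^ m / m.factorial := h1
    _ = (n / m : ℝ) ^ m * ((m : ℝ) ^ m / m.factorial) := by rw [div_pow]; field_simp
    _ ≤ (n / m : ℝ) ^ m * Real.exp m := by gcongr
    _ = _ := by
      rw [mul_add, Real.exp_add, mul_one, mul_comm, Real.exp_nat_mul, Real.exp_log (by positivity)]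

/-- Group the sets by cardinality: each of the n + 1 sizes contributes at most `b`. -/
theorem sum_finset_le_of_choose_mul_le {n : ℕ} (S : Finset (Finset (Fin n)))
    (g : Finset (Fin n) → ℝ) {b : ℝ} (hb0 : 0 ≤ b)
    (hb : ∀ J ∈ S, (n.choose J.card : ℝ) * g J ≤ b) : ∑ J ∈ S, g J ≤ (n + 1) * b := by
  have hc : ∀ J : Finset (Fin n), (0 : ℝ) < n.choose J.card := fun J => by
    exact_mod_cast Nat.choose_pos (by simpa using Finset.card_le_univ J)
  calc ∑ J ∈ S, g J ≤ ∑ J ∈ S, b / n.choose J.card := Finset.sum_le_sum fun J hJ => by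
        rw [le_div_iff₀ (hc J), mul_comm]; exact hb J hJ
    _ ≤ ∑ J ∈ (Finset.univ : Finset (Fin n)).powerset, b / n.choose J.card :=
        Finset.sum_le_sum_of_subset_of_nonneg (fun J _ => by simp)
          fun J _ _ => div_nonneg hb0 (hc J).le
    _ = ∑ m ∈ Finset.range (n + 1), n.choose m • (b / n.choose m) := by
        rw [Finset.sum_powerset_apply_card (fun m => b / (n.choose m : ℝ))]
        simp
    _ = ∑ m ∈ Finset.range (n + 1), b := Finset.sum_congr rfl fun m hm => by
        have : (0 : ℝ) < n.choose m := by
          exact_mod_cast Nat.choose_pos (Nat.lt_succ_iff.mp (Finset.mem_range.mp hm))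
        rw [nsmul_eq_mul]; field_simp
    _ = (n + 1) * b := by simp

theorem log_le_mul_sqrt {a T : ℝ} (ha : 0 < a) (hT : (7 / a) ^ 4 ≤ T) (h1 : 1 ≤ T) :
    3 + Real.log T ≤ a * √T := by
  set u := √(√T) with hu
  have hT0 : 0 < T := by linarith
  have hu2 : u ^ 2 = √T := Real.sq_sqrt (Real.sqrt_nonneg _)
  have hu4 : u ^ 4 = T := by
    rw [show u ^ 4 = (u ^ 2) ^ 2 by ring, hu2, Real.sq_sqrt hT0.le]
  have hu0 : 0 ≤ u := Real.sqrt_nonneg _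
  have hu1 : 1 ≤ u := by
    rw [hu, Real.one_le_sqrt, Real.one_le_sqrt]; exact h1
  have h7 : 7 / a ≤ u := by
    refine le_of_pow_le_pow_left₀ (n := 4) (by norm_num) hu0 (by rw [hu4]; exact hT)
  have h2 : Real.log T ≤ 4 * u := by
    rw [← hu4, Real.log_pow]
    have := Real.log_le_sub_one_of_pos (by linarith : 0 < u)
    push_cast
    linarith
  rw [← hu2]
  rw [div_le_iff₀ ha] at h7
  nlinarith

set_option maxHeartbeats 1000000 in
open scoped Classical in
-- At least κT|J|/16 rows have a large entry in `J`. Collisions and rows whose deterministic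
-- position lies in `J'` each remove at most κT|J|/64, leaving κT|J|/32. For the first count log n ≪
-- T pays for the choice of `J`; collisions are so rare that their large deviation exponent also
-- pays for the choice of `J'`.
theorem exists_matLaw_not_expands_le {κ B : ℝ} (hκ : 0 < κ) (hκ1 : κ ≤ 1) :
    ∃ c₀ C₀ : ℝ, 0 < c₀ ∧ c₀ ≤ 1 / 8 ∧ ∀ (p : ℝ), 0 < p → p ≤ 1 →
      ∀ ν : Measure ℝ, SparseLaw ν p κ B → ∀ (n : ℕ), C₀ ≤ n * p → C₀ * Real.log n ≤ n * p →
      ∀ (ι : Type) [Fintype ι] (r : ι → Fin n) (d : ι → ℝ), Function.Injective r →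
        n ≤ Fintype.card ι + 1 →
        (matLaw ν r d).real
          {M | ¬ Expands r M ⌊√(n * p)⌋₊ (2 * ⌊c₀ / p⌋₊) (κ / 32 * (n * p))} ≤
          Real.exp (-(κ / 1024) * (n * p)) := by
  -- Chosen so that mp ≤ (κ/256)², hence exp(-X/2) ≤ κ/256 in the estimate of collisions.
  set c₀ := κ ^ 2 / 2 ^ 17 with hc₀
  have hc₀0 : 0 < c₀ := by positivity
  have hc₀1 : c₀ ≤ 1 / 8 := by
    have : κ ^ 2 ≤ 1 := by nlinarith
    rw [hc₀]; linarith
  refine ⟨c₀, max (max 8 (3072 / κ)) (max ((64 / κ) ^ 2) ((7 / (κ / 512)) ^ 4)), hc₀0, hc₀1, ?_⟩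
  intro p hp hp1 ν hν n hT hTlog ι _ r d hr hcard
  have := hν.prob
  set T := n * p with hTdef
  have hT8 : 8 ≤ T := ((le_max_left _ _).trans (le_max_left _ _)).trans hT
  have hT64 : (64 / κ) ^ 2 ≤ T := ((le_max_left _ _).trans (le_max_right _ _)).trans hT
  have hT7 : (7 / (κ / 512)) ^ 4 ≤ T := ((le_max_right _ _).trans (le_max_right _ _)).trans hT
  have hT0 : 0 < T := by linarith
  have hsT : √T ^ 2 = T := Real.sq_sqrt hT0.le
  have hsT0 : 0 < √T := Real.sqrt_pos.mpr hT0
  have hn0 : (0 : ℝ) < n := by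
    by_contra h0
    have : (n : ℝ) * p ≤ 0 := mul_nonpos_of_nonpos_of_nonneg (not_lt.mp h0) hp.le
    linarith
  have hTn : T ≤ n := by rw [hTdef]; nlinarith
  have hlogn : Real.log n ≤ κ * T / 3072 := by
    have h1 : 0 ≤ Real.log n := Real.log_nonneg (by linarith)
    have h2 : 3072 / κ * Real.log n ≤ T :=
      (mul_le_mul_of_nonneg_right ((le_max_right _ _).trans (le_max_left _ _)) h1).trans hTlog
    rw [div_mul_eq_mul_div, div_le_iff₀ hκ] at h2
    linarith
  have hlogT := log_le_mul_sqrt (a := κ / 512) (by positivity) hT7 (by linarith)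
  have hsT64 : 64 / κ ≤ √T := Real.le_sqrt_of_sq_le hT64
  set L := ⌊√T⌋₊ with hL
  have hLle : (L : ℝ) ≤ √T := Nat.floor_le hsT0.le
  set m := 2 * ⌊c₀ / p⌋₊ with hm
  have hmp : (m : ℝ) * p ≤ (κ / 256) ^ 2 := by
    have h1 : (⌊c₀ / p⌋₊ : ℝ) ≤ c₀ / p := Nat.floor_le (by positivity)
    have h2 : (m : ℝ) ≤ 2 * (c₀ / p) := by rw [hm]; push_cast; linarith
    calc (m : ℝ) * p ≤ 2 * (c₀ / p) * p := by gcongr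
      _ = (κ / 256) ^ 2 := by rw [hc₀]; field_simp; norm_num
  have hmp1 : (m : ℝ) * p ≤ 1 / 4 := by
    refine hmp.trans ?_
    nlinarith
  set rows : Finset (Fin n) → Finset ι := fun J => Finset.univ.filter fun i => r i ∉ J with hrowsdef
  set U : Finset (Fin n) → Set (Fin n → ℝ) := fun J => {X | ∃ j ∈ J, 1 / 2 ≤ |X j|} with hU
  set F1 : Finset (Fin n) → Set (ι → Fin n → ℝ) := fun J =>
    {M | (((rows J).filter fun i => M i ∈ U J).card : ℝ) ≤
      κ * T * J.card / 16} with hF1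
  set F2 : Finset (Fin n) → Finset (Fin n) → Set (ι → Fin n → ℝ) := fun J J' =>
    {M | κ * T * J.card / 64 ≤
      ((Finset.univ.filter fun i => M i ∈ collisionSet J J' (r i)).card : ℝ)} with hF2
  set S1 : Finset (Finset (Fin n)) := Finset.univ.filter fun J => J.Nonempty ∧ J.card ≤ m with hS1
  set S2 : Finset (Fin n) → Finset (Finset (Fin n)) := fun J' =>
    J'.powerset.filter fun J => J'.card ≤ L * J.card with hS2
  have hsub : {M : ι → Fin n → ℝ | ¬ Expands r M L m (κ / 32 * T)} ⊆
      (⋃ J ∈ S1, F1 J) ∪ ⋃ J' ∈ S1, ⋃ J ∈ S2 J', F2 J J' := by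
    intro M hM
    have hM : ¬ Expands r M L m (κ / 32 * T) := hM
    simp only [Expands, not_forall, not_le] at hM
    obtain ⟨J, J', hJJ', hne, hL', hm', hlt⟩ := hM
    by_cases h1 : M ∈ F1 J
    · left
      exact Set.mem_iUnion₂.mpr ⟨J, Finset.mem_filter.mpr ⟨Finset.mem_univ _, hne,
        (Finset.card_le_card hJJ').trans hm'⟩, h1⟩
    · right
      refine Set.mem_iUnion₂.mpr ⟨J', Finset.mem_filter.mpr ⟨Finset.mem_univ _,
        hne.mono hJJ', hm'⟩, Set.mem_iUnion₂.mpr ⟨J, Finset.mem_filter.mpr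
        ⟨Finset.mem_powerset.mpr hJJ', hL'⟩, ?_⟩⟩
      have h2 : κ * T * J.card / 16 <
          (((rows J).filter fun i => M i ∈ U J).card : ℝ) := not_le.mp h1
      have h3 : (((rows J).filter fun i => M i ∈ U J).card : ℝ) ≤
          ∑ j ∈ J, ((hitRows r M J' j).card : ℝ) +
            ((Finset.univ.filter fun i => M i ∈ collisionSet J J' (r i)).card : ℝ) + J'.card := by
        exact_mod_cast card_le_sum_card_hitRows r hr M (J := J) (J' := J')
      have h4 : (J'.card : ℝ) ≤ κ * T * J.card / 64 := by
        have h5 : (J'.card : ℝ) ≤ L * J.card := by exact_mod_cast hL'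
        have h6 : √T ≤ κ * T / 64 := by
          rw [div_le_iff₀ hκ] at hsT64
          nlinarith
        calc (J'.card : ℝ) ≤ √T * J.card := h5.trans (by gcongr)
          _ ≤ κ * T / 64 * J.card := by gcongr
          _ = _ := by ring
      show κ * T * J.card / 64 ≤ _
      have h7 : κ / 32 * T * J.card = κ * T * J.card / 32 := by ring
      rw [h7] at hlt
      linarith
  have hP1 : ∀ J ∈ S1, (n.choose J.card : ℝ) * (matLaw ν r d).real (F1 J) ≤
      Real.exp (-(κ / 512) * T) := by
    intro J hJ
    obtain ⟨hne, hJm⟩ := (Finset.mem_filter.mp hJ).2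
    have hJ1 : (1 : ℝ) ≤ J.card := by exact_mod_cast hne.card_pos
    have hJmp : (J.card : ℝ) * p ≤ 1 / 4 := by
      refine le_trans ?_ hmp1
      gcongr
    have hrows : (n : ℝ) / 2 ≤ ((rows J).card : ℝ) := by
      have h1 : (Finset.univ.filter fun i => r i ∈ J).card ≤ J.card :=
        Finset.card_le_card_of_injOn r (fun i hi => (Finset.mem_filter.mp hi).2) hr.injOn
      have h2 : (Finset.univ.filter fun i => r i ∈ J).card + (rows J).card = Fintype.card ι := by
        rw [← Finset.card_univ]
        convert Finset.card_filter_add_card_filter_not (s := (Finset.univ : Finset ι))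
          (fun i => r i ∈ J)
      have h3 : n ≤ (rows J).card + J.card + 1 := by omega
      have h4 : (n : ℝ) ≤ ((rows J).card : ℝ) + J.card + 1 := by
        exact_mod_cast h3
      have h5 : (J.card : ℝ) ≤ n / 4 := by
        have : (J.card : ℝ) * p * 8 ≤ 1 / 4 * (n * p) := by nlinarith
        have h6 : (J.card : ℝ) * 8 * p ≤ n / 4 * p := by linarith
        have := le_of_mul_le_mul_right h6 hp
        linarith
      linarith
    have h1 := measureReal_pi_card_filter_le_le (fun i => rowLaw ν (r i) (d i))
      (rows J) (fun _ => U J) (fun _ => measurableSet_exists_large J)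
      (q := κ * p * J.card / 2) (fun i hi => hν.le_rowLaw_exists_large hp hκ
        (Finset.mem_filter.mp hi).2 (d i) (by nlinarith)) (κ * T * J.card / 16)
    have h2 : (n.choose J.card : ℝ) ≤ Real.exp (J.card * Real.log n) := by
      rw [Real.exp_nat_mul, Real.exp_log hn0]
      exact_mod_cast Nat.choose_le_pow _ _
    calc (n.choose J.card : ℝ) * (matLaw ν r d).real (F1 J) ≤
          Real.exp (J.card * Real.log n) * Real.exp (κ * T * J.card / 16 -
          κ * p * J.card / 2 / 2 * ((rows J).card : ℝ)) :=
          mul_le_mul h2 (le_trans (le_of_eq (by simp only [hF1, matLaw]; congr!)) h1)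
            measureReal_nonneg (Real.exp_pos _).le
      _ ≤ Real.exp (-(κ / 512) * T) := by
          rw [← Real.exp_add]
          refine Real.exp_le_exp.mpr ?_
          have h3 : κ * p * J.card / 2 / 2 * (n / 2 : ℝ) ≤
              κ * p * J.card / 2 / 2 * ((rows J).card : ℝ) := by
            gcongr
          have h4 : κ * p * J.card / 2 / 2 * (n / 2 : ℝ) = κ * T * J.card / 8 := by rw [hTdef]; ring
          have h5 : (J.card : ℝ) * Real.log n ≤ J.card * (κ * T / 3072) := by gcongr
          have h6 : κ * T * 1 ≤ κ * T * J.card := by gcongr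
          have h7 : 0 < κ * T := by positivity
          linarith
  have hP2 : ∀ J' ∈ S1, (n.choose J'.card : ℝ) * (matLaw ν r d).real (⋃ J ∈ S2 J', F2 J J') ≤
      Real.exp (-(κ / 512) * T) := by
    intro J' hJ'
    obtain ⟨hne, hJm⟩ := (Finset.mem_filter.mp hJ').2
    have hJ1 : (1 : ℝ) ≤ J'.card := by exact_mod_cast hne.card_pos
    -- X measures how far |J'| is below 1/p. It is both the gain in the collision tail and, through
    -- log(n/|J'|) = log T + X, the entropy of `J'`.
    set X := -Real.log (J'.card * p) with hX
    have hexpX : Real.exp (-X) = J'.card * p := by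
      rw [hX, neg_neg, Real.exp_log (by positivity)]
    have hJmp : (J'.card : ℝ) * p ≤ (κ / 256) ^ 2 := by
      refine le_trans ?_ hmp
      gcongr
    have hhalf : Real.exp (-(X / 2)) ≤ κ / 256 := by
      refine le_of_pow_le_pow_left₀ two_ne_zero (by positivity) ?_
      rw [← Real.exp_nat_mul, show ((2 : ℕ) : ℝ) * -(X / 2) = -X by push_cast; ring, hexpX]
      exact hJmp
    have hX1 : 1 ≤ X := by
      have h1 : Real.exp (-X) ≤ Real.exp (-1) := by
        rw [hexpX]
        refine hJmp.trans ?_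
        have h2 : (1 / 3 : ℝ) ≤ Real.exp (-1) := by
          rw [Real.exp_neg, one_div]
          exact inv_anti₀ (Real.exp_pos _) (by linarith [Real.exp_one_lt_d9])
        nlinarith
      linarith [Real.exp_le_exp.mp h1]
    -- With l = X/2 the tilted mean is T|J|exp(-X/2) ≤ κT|J|/256, while the threshold gains
    -- κT|J|X/128. The surplus is shared between κT/512 and a multiple of √T|J'|X, using |J'| ≤
    -- √T|J|.
    have hF2le : ∀ J ∈ S2 J', (matLaw ν r d).real (F2 J J') ≤
        Real.exp (-(κ / 512) * T - κ / 512 * √T * J'.card * X) := by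
      intro J hJ
      have hJL := (Finset.mem_filter.mp hJ).2
      have hJL' : (J'.card : ℝ) ≤ √T * J.card := by
        have : (J'.card : ℝ) ≤ L * J.card := by exact_mod_cast hJL
        exact this.trans (by gcongr)
      have hJpos : (1 : ℝ) ≤ J.card := by
        have : 0 < J.card := by
          by_contra h0
          have : J.card = 0 := by omega
          rw [this, mul_zero] at hJL
          have := hne.card_pos
          omega
        exact_mod_cast this
      have h1 := measureReal_pi_le_card_filter_le (fun i => rowLaw ν (r i) (d i))
        (fun i => collisionSet J J' (r i)) (fun i => measurableSet_collisionSet J J' (r i))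
        (fun i => hν.rowLaw_collisionSet_le J J' (r i) (d i)) (l := X / 2) (by linarith)
        (κ * T * J.card / 64)
      refine h1.trans (Real.exp_le_exp.mpr ?_)
      have hcn : (Fintype.card ι : ℝ) ≤ n := by
        exact_mod_cast (by simpa using Fintype.card_le_of_injective r hr : Fintype.card ι ≤ n)
      have h2 : Real.exp (X / 2) * (J.card * J'.card * p ^ 2) =
          J.card * p * Real.exp (-(X / 2)) := by
        have h3 : Real.exp (-(X / 2)) = Real.exp (X / 2) * Real.exp (-X) := by
          rw [← Real.exp_add]; congr 1; ring
        rw [h3, hexpX]; ring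
      rw [h2]
      have h3 : Fintype.card ι * (J.card * p * Real.exp (-(X / 2))) ≤ J.card * T * (κ / 256) := by
        calc _ ≤ n * (J.card * p * (κ / 256)) := by gcongr
          _ = _ := by rw [hTdef]; ring
      have hJT : T ≤ J.card * T := by nlinarith
      have hJT' : √T * J'.card ≤ J.card * T := by
        calc √T * J'.card ≤ √T * (√T * J.card) := by gcongr
          _ = J.card * T := by rw [← mul_assoc, ← sq, hsT]; ring
      have h4 : J.card * T * (κ / 256) ≤ J.card * T * (κ / 256) * X :=
        le_mul_of_one_le_right (by positivity) hX1
      have h5 : κ / 512 * T ≤ κ / 512 * (J.card * T) * X := by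
        calc κ / 512 * T ≤ κ / 512 * (J.card * T) := by gcongr
          _ ≤ _ := le_mul_of_one_le_right (by positivity) hX1
      have h6 : κ / 512 * √T * J'.card * X ≤ κ / 512 * (J.card * T) * X := by
        rw [mul_assoc (κ / 512)]
        gcongr
      have h7 : X / 2 * (κ * T * J.card / 64) = κ / 128 * (J.card * T) * X := by ring
      rw [h7]
      have h8 : J.card * T * (κ / 256) * X = κ / 256 * (J.card * T) * X := by ring
      have h9 : κ / 128 * (J.card * T) * X = κ / 256 * (J.card * T) * X +
          (κ / 512 * (J.card * T) * X + κ / 512 * (J.card * T) * X) := by ring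
      linarith
    have hS2card : ((S2 J').card : ℝ) ≤ Real.exp (J'.card) := by
      have h1 : (S2 J').card ≤ 2 ^ J'.card :=
        (Finset.card_filter_le _ _).trans (Finset.card_powerset _).le
      calc ((S2 J').card : ℝ) ≤ 2 ^ J'.card := by exact_mod_cast h1
        _ ≤ Real.exp 1 ^ J'.card := by
            gcongr
            have := Real.add_one_le_exp (1 : ℝ)
            linarith
        _ = _ := by rw [← Real.exp_nat_mul, mul_one]
    have h1 : (matLaw ν r d).real (⋃ J ∈ S2 J', F2 J J') ≤
        Real.exp (J'.card) * Real.exp (-(κ / 512) * T - κ / 512 * √T * J'.card * X) := by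
      refine (measureReal_biUnion_finset_le _ _).trans ((Finset.sum_le_sum hF2le).trans ?_)
      rw [Finset.sum_const, nsmul_eq_mul]
      gcongr
    have h2 := choose_le_exp (n := n) hne.card_pos
    have h3 : Real.log (n / J'.card) = Real.log T + X := by
      have : (n : ℝ) / J'.card = T / (J'.card * p) := by rw [hTdef]; field_simp
      rw [this, Real.log_div hT0.ne' (by positivity), hX]; ring
    rw [h3] at h2
    calc _ ≤ Real.exp (J'.card * (1 + (Real.log T + X))) *
          (Real.exp (J'.card) * Real.exp (-(κ / 512) * T - κ / 512 * √T * J'.card * X)) :=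
          mul_le_mul h2 h1 measureReal_nonneg (Real.exp_pos _).le
      _ ≤ _ := by
          rw [← Real.exp_add, ← Real.exp_add]
          refine Real.exp_le_exp.mpr ?_
          have hlogT0 : 0 ≤ Real.log T := Real.log_nonneg (by linarith)
          have h4 : 2 + Real.log T + X ≤ κ / 512 * √T * X := by
            calc 2 + Real.log T + X ≤ (3 + Real.log T) * X := by nlinarith
              _ ≤ _ := by gcongr
          have h5 := mul_le_mul_of_nonneg_left h4 (by linarith : (0 : ℝ) ≤ J'.card)
          nlinarith
  have hsum1 : (matLaw ν r d).real (⋃ J ∈ S1, F1 J) ≤ (n + 1) * Real.exp (-(κ / 512) * T) :=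
    (measureReal_biUnion_finset_le _ _).trans
      (sum_finset_le_of_choose_mul_le S1 _ (Real.exp_pos _).le hP1)
  have hsum2 : (matLaw ν r d).real (⋃ J' ∈ S1, ⋃ J ∈ S2 J', F2 J J') ≤
      (n + 1) * Real.exp (-(κ / 512) * T) :=
    (measureReal_biUnion_finset_le _ _).trans
      (sum_finset_le_of_choose_mul_le S1 _ (Real.exp_pos _).le hP2)
  refine (measureReal_mono hsub (measure_ne_top _ _)).trans ((measureReal_union_le _ _).trans ?_)
  have h1 : 2 * ((n : ℝ) + 1) ≤ Real.exp (κ / 1024 * T) := by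
    have h2 : Real.exp (3 * Real.log n) ≤ Real.exp (κ / 1024 * T) :=
      Real.exp_le_exp.mpr (by linarith)
    have h3 : Real.exp (3 * Real.log n) = (n : ℝ) ^ 3 := by
      rw [mul_comm, Real.exp_mul, Real.exp_log hn0]
      norm_cast
    have h4 : (8 : ℝ) ≤ n := hT8.trans hTn
    have h5 : 2 * ((n : ℝ) + 1) ≤ n ^ 3 := by
      have : (64 : ℝ) ≤ n ^ 2 := by nlinarith
      nlinarith
    linarith
  calc _ ≤ 2 * ((n : ℝ) + 1) * Real.exp (-(κ / 512) * T) := by linarith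
    _ ≤ Real.exp (κ / 1024 * T) * Real.exp (-(κ / 512) * T) := by gcongr
    _ = _ := by rw [← Real.exp_add]; congr 1; ring

/-! ### Almost null vectors are spread -/

section chain

variable {n : ℕ} {ι : Type} [Fintype ι] {r : ι → Fin n} {M : ι → Fin n → ℝ} {L m : ℕ}

theorem app_on_of_mem_hitRows {J' : Finset (Fin n)} {j : Fin n} (hj : j ∈ J') {i : ι}
    (hi : i ∈ hitRows r M J' j) (x : Fin n → ℝ) : app M (on x J') i = M i j * x j := by
  simp only [hitRows, Finset.mem_filter, Finset.mem_univ, true_and] at hi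
  simp only [app, dotProduct]
  rw [Finset.sum_eq_single j]
  · simp [on, hj]
  · intro l _ hl
    by_cases hlJ : l ∈ J'
    · simp [hi.2.2 l hlJ hl]
    · simp [on, hlJ]
  · simp

theorem pairwiseDisjoint_hitRows {J' : Finset (Fin n)} :
    (J' : Set (Fin n)).PairwiseDisjoint (hitRows r M J') := by
  intro j hj l hl hjl
  refine Finset.disjoint_left.mpr fun i hij hil => ?_
  simp only [hitRows, Finset.mem_filter, Finset.mem_univ, true_and] at hij hil
  have h1 := hij.2.2 l hl (Ne.symm hjl)
  have h2 := hil.2.1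
  rw [h1] at h2
  norm_num at h2

/-- Let S carry the best k'-sparse approximation. Expansion forbids k + 1 columns of S with fewer
than `a` hit rows, so all but k have at least `a` of them. On a hit row the image of the restriction
of x to S is the single term M_ij x_j with |M_ij| ≥ 1/2, and hit rows of distinct columns are
disjoint, so the squares add up. Replacing this restriction by x costs K times the tail. -/
theorem Expands.tailNorm_sq_sub_le {a K : ℝ} (h : Expands r M L m a) (ha : 0 < a)
    (hop : OpBound M K) (x : Fin n → ℝ) {k k' : ℕ} (hk' : k' ≤ L * (k + 1))
    (hkm : k' ≤ m) :
    a / 4 * (tailNorm x k ^ 2 - tailNorm x k' ^ 2) ≤ (l2 (app M x) + K * tailNorm x k') ^ 2 := by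
  classical
  obtain ⟨S, hS, hSt⟩ := exists_tailNorm_eq x k'
  set bad := S.filter fun j => ((hitRows r M S j).card : ℝ) < a with hbad
  have hbadS : bad ⊆ S := Finset.filter_subset _ _
  have hbadcard : bad.card ≤ k := by
    by_contra hcon
    obtain ⟨J, hJ, hJc⟩ := Finset.exists_subset_card_eq (s := bad) (n := k + 1) (by omega)
    have h1 := h J S (hJ.trans hbadS) (Finset.card_pos.mp (by omega))
      (by rw [hJc]; omega) (by omega)
    have h2 : ∑ j ∈ J, ((hitRows r M S j).card : ℝ) < ∑ _j ∈ J, a :=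
      Finset.sum_lt_sum_of_nonempty (Finset.card_pos.mp (by omega))
        fun j hj => (Finset.mem_filter.mp (hJ hj)).2
    rw [Finset.sum_const, nsmul_eq_mul] at h2
    linarith
  have h1 : a / 4 * ∑ j ∈ S \ bad, x j ^ 2 ≤ l2 (app M (on x S)) ^ 2 := by
    rw [l2_sq, Finset.mul_sum]
    calc ∑ j ∈ S \ bad, a / 4 * x j ^ 2
        ≤ ∑ j ∈ S \ bad, ∑ i ∈ hitRows r M S j, app M (on x S) i ^ 2 := by
          refine Finset.sum_le_sum fun j hj => ?_
          obtain ⟨hjS, hjb⟩ := Finset.mem_sdiff.mp hj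
          have h2 : a ≤ (hitRows r M S j).card := by
            by_contra hcon
            exact hjb (Finset.mem_filter.mpr ⟨hjS, not_le.mp hcon⟩)
          calc a / 4 * x j ^ 2 ≤ ∑ i ∈ hitRows r M S j, 1 / 4 * x j ^ 2 := by
                rw [Finset.sum_const, nsmul_eq_mul]
                nlinarith [sq_nonneg (x j)]
            _ ≤ _ := by
                refine Finset.sum_le_sum fun i hi => ?_
                rw [app_on_of_mem_hitRows hjS hi, mul_pow, ← sq_abs (M i j)]
                have h3 : 1 / 2 ≤ |M i j| := (Finset.mem_filter.mp hi).2.2.1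
                gcongr
                nlinarith
      _ = ∑ i ∈ (S \ bad).biUnion (hitRows r M S), app M (on x S) i ^ 2 :=
          (Finset.sum_biUnion (pairwiseDisjoint_hitRows.subset
            (by exact_mod_cast Finset.sdiff_subset))).symm
      _ ≤ ∑ i, app M (on x S) i ^ 2 := Finset.sum_le_sum_of_subset_of_nonneg
          (Finset.subset_univ _) fun _ _ _ => sq_nonneg _
  have h2 : ∑ j ∈ S \ bad, x j ^ 2 = l2 (off x bad) ^ 2 - l2 (off x S) ^ 2 := by
    rw [l2_off_sq, l2_off_sq]
    have h3 : badᶜ = (S \ bad) ∪ Sᶜ := by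
      ext j
      simp only [Finset.mem_compl, Finset.mem_union, Finset.mem_sdiff]
      have := @hbadS j
      tauto
    rw [h3, Finset.sum_union]
    · ring
    · refine Finset.disjoint_left.mpr fun j hj hj' => ?_
      exact (Finset.mem_compl.mp hj') (Finset.mem_sdiff.mp hj).1
  have h3 : l2 (app M (on x S)) ≤ l2 (app M x) + K * tailNorm x k' := by
    have h4 : on x S = x - off x S := by rw [eq_sub_iff_add_eq, on_add_off]
    rw [h4, app_sub]
    refine (l2_sub_le _ _).trans ?_
    have := hop (off x S)
    rw [hSt] at this
    linarith
  rw [h2, hSt] at h1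
  have h4 : tailNorm x k ^ 2 ≤ l2 (off x bad) ^ 2 :=
    pow_le_pow_left₀ (tailNorm_nonneg _ _) (tailNorm_le x hbadcard) 2
  calc _ ≤ a / 4 * (l2 (off x bad) ^ 2 - tailNorm x k' ^ 2) := by gcongr
    _ ≤ _ := h1
    _ ≤ _ := pow_le_pow_left₀ (l2_nonneg _) h3 2

/-- The loss in one step of the chain of sparsity levels. -/
noncomputable def stepLoss (K κ : ℝ) : ℝ := √(1 + 128 * (1 + K) ^ 2 / κ)

theorem one_le_stepLoss {K κ : ℝ} (hκ : 0 < κ) : 1 ≤ stepLoss K κ := by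
  rw [stepLoss, Real.one_le_sqrt]
  have : 0 ≤ 128 * (1 + K) ^ 2 / κ := by positivity
  linarith

/-- The factor T in the number of hit rows cancels the square of √T in the operator norm, so the
loss depends on neither n nor p. -/
theorem Expands.tailNorm_le_stepLoss_mul {κ K T : ℝ} (hκ : 0 < κ) (hK : 0 ≤ K) (hT : 0 < T)
    (h : Expands r M L m (κ / 32 * T)) (hop : OpBound M (K * √T)) (x : Fin n → ℝ) {k k' : ℕ}
    (hk' : k' ≤ L * (k + 1)) (hkm : k' ≤ m) :
    tailNorm x k ≤ stepLoss K κ * max (tailNorm x k') (l2 (app M x) / √T) := by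
  have hsT : 0 < √T := Real.sqrt_pos.mpr hT
  set u := max (tailNorm x k') (l2 (app M x) / √T) with hu
  have hu1 : tailNorm x k' ≤ u := le_max_left _ _
  have hu2 : l2 (app M x) ≤ u * √T := by
    rw [← div_le_iff₀ hsT]; exact le_max_right _ _
  have ht := tailNorm_nonneg x k'
  have hu0 : 0 ≤ u := ht.trans hu1
  have h1 := h.tailNorm_sq_sub_le (by positivity) hop x hk' hkm
  have h2 : (l2 (app M x) + K * √T * tailNorm x k') ^ 2 ≤ ((1 + K) * u * √T) ^ 2 := by
    refine pow_le_pow_left₀ (add_nonneg (l2_nonneg _) (by positivity)) ?_ 2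
    calc _ ≤ u * √T + K * √T * u := by gcongr
      _ = _ := by ring
  rw [mul_pow, Real.sq_sqrt hT.le] at h2
  have h3 : κ / 128 * (tailNorm x k ^ 2 - tailNorm x k' ^ 2) ≤ ((1 + K) * u) ^ 2 := by
    refine le_of_mul_le_mul_right ?_ hT
    calc _ = κ / 32 * T / 4 * (tailNorm x k ^ 2 - tailNorm x k' ^ 2) := by ring
      _ ≤ _ := h1.trans h2
  have h4 : tailNorm x k ^ 2 ≤ (stepLoss K κ * u) ^ 2 := by
    rw [mul_pow, stepLoss, Real.sq_sqrt (by positivity)]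
    have h5 : tailNorm x k' ^ 2 ≤ u ^ 2 := pow_le_pow_left₀ ht hu1 2
    have h6 : tailNorm x k ^ 2 - tailNorm x k' ^ 2 ≤ 128 * (1 + K) ^ 2 / κ * u ^ 2 := by
      rw [div_mul_eq_mul_div, le_div_iff₀ hκ]
      nlinarith
    nlinarith
  exact le_of_pow_le_pow_left₀ two_ne_zero
    (mul_nonneg (zero_le_one.trans (one_le_stepLoss hκ)) hu0) h4

/-- Iterate along the sparsity levels 0, 1, L, L², …, capped at `m`, losing one constant factor at
each level. -/
theorem Expands.l2_le_pow_stepLoss_mul {κ K T : ℝ} (hκ : 0 < κ) (hK : 0 ≤ K) (hT : 0 < T)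
    (hL : 1 ≤ L) (h : Expands r M L m (κ / 32 * T)) (hop : OpBound M (K * √T)) (x : Fin n → ℝ)
    (k : ℕ) :
    l2 x ≤ stepLoss K κ ^ (k + 1) * max (tailNorm x (min (L ^ k) m)) (l2 (app M x) / √T) := by
  have hC := one_le_stepLoss (K := K) hκ
  have hw : 0 ≤ l2 (app M x) / √T := div_nonneg (l2_nonneg _) (Real.sqrt_nonneg _)
  induction k with
  | zero =>
    rw [← tailNorm_zero, zero_add, pow_one]
    refine h.tailNorm_le_stepLoss_mul hκ hK hT hop x ?_ (min_le_right _ _)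
    exact (min_le_left _ _).trans (by simpa using hL)
  | succ k ih =>
    refine ih.trans ?_
    rw [pow_succ _ (k + 1), mul_assoc]
    refine mul_le_mul_of_nonneg_left ?_ (by positivity)
    set u := max (tailNorm x (min (L ^ (k + 1)) m)) (l2 (app M x) / √T) with hu
    have hu0 : 0 ≤ u := hw.trans (le_max_right _ _)
    refine max_le ?_ ((le_max_right _ _).trans (le_mul_of_one_le_left hu0 hC))
    refine h.tailNorm_le_stepLoss_mul hκ hK hT hop x ?_ (min_le_right _ _)
    rcases le_total (L ^ k) m with h1 | h1
    · rw [min_eq_left h1]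
      refine (min_le_left _ _).trans ?_
      rw [pow_succ, mul_comm]
      exact Nat.mul_le_mul_left _ (Nat.le_succ _)
    · rw [min_eq_right h1]
      refine (min_le_right _ _).trans ?_
      calc m ≤ 1 * (m + 1) := by omega
        _ ≤ L * (m + 1) := Nat.mul_le_mul_right _ hL

end chain

/-- The total loss along the chain of sparsity levels. -/
noncomputable def spreadLevel (C p T : ℝ) : ℝ :=
  Real.exp (-(Real.log C * (3 + 4 * (Real.log (1 / p) / Real.log T))))

theorem spreadLevel_pos (C p T : ℝ) : 0 < spreadLevel C p T := Real.exp_pos _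

theorem quarter_log_le_log_floor_sqrt {T : ℝ} (hT : 16 ≤ T) :
    2 ≤ ⌊√T⌋₊ ∧ Real.log T / 4 ≤ Real.log ⌊√T⌋₊ := by
  have hT0 : 0 < T := by linarith
  set u := √(√T) with hu
  have hu2 : u ^ 2 = √T := Real.sq_sqrt (Real.sqrt_nonneg _)
  have hu4 : u ^ 4 = T := by
    rw [show u ^ 4 = (u ^ 2) ^ 2 by ring, hu2, Real.sq_sqrt hT0.le]
  have hu0 : 0 ≤ u := Real.sqrt_nonneg _
  have h2 : 2 ≤ u := by
    refine le_of_pow_le_pow_left₀ (n := 4) (by norm_num) hu0 ?_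
    rw [hu4]; norm_num; linarith
  have h3 : u ≤ ⌊√T⌋₊ := by
    have := Nat.lt_floor_add_one (√T)
    rw [← hu2] at this ⊢
    nlinarith
  refine ⟨by exact_mod_cast h2.trans h3, ?_⟩
  calc Real.log T / 4 = Real.log u := by rw [← hu4, Real.log_pow]; push_cast; ring
    _ ≤ _ := Real.log_le_log (by linarith) h3

/-- The chain gives tail mass at least ρ beyond 2q coordinates. The head consists of the best q
coordinates and of those outside them that are large relative to the tail E at level q; Chebyshev
allows at most q of the latter. What remains is flat relative to E, and one more chain step compares
E with its norm N. -/
theorem Expands.exists_split {n : ℕ} {ι : Type} [Fintype ι] {r : ι → Fin n} {M : ι → Fin n → ℝ}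
    {κ K p c₀ : ℝ} (hκ : 0 < κ) (hK : 0 ≤ K) (hp : 0 < p) (hp1 : p ≤ 1) (hc₀ : 0 < c₀)
    (hc₀1 : c₀ ≤ 1 / 8) (hT : 16 ≤ n * p)
    (h : Expands r M ⌊√(n * p)⌋₊ (2 * ⌊c₀ / p⌋₊) (κ / 32 * (n * p)))
    (hop : OpBound M (K * √(n * p))) {x : Fin n → ℝ} (hx : l2 x = 1)
    (hMx : l2 (app M x) < spreadLevel (stepLoss K κ) p (n * p) * √(n * p)) :
    ∃ J g y N, IsSplit (2 * ⌊c₀ / p⌋₊) J g y ∧ x = N • (g + y) ∧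
      spreadLevel (stepLoss K κ) p (n * p) ≤ N ∧
      l2 g ≤ 1 / spreadLevel (stepLoss K κ) p (n * p) ∧
      ∀ j, |y j| ≤ stepLoss K κ / √c₀ * √p := by
  classical
  set T := n * p with hTdef
  set C := stepLoss K κ with hCdef
  set ρ := spreadLevel C p T with hρ
  have hρ0 : 0 < ρ := spreadLevel_pos _ _ _
  have hT0 : 0 < T := by linarith
  have hsT : 0 < √T := Real.sqrt_pos.mpr hT0
  have hC : 1 ≤ C := one_le_stepLoss hκ
  have hC0 : 0 < C := by linarith
  obtain ⟨hL2, hLlog⟩ := quarter_log_le_log_floor_sqrt hT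
  set L := ⌊√T⌋₊ with hL
  set q := ⌊c₀ / p⌋₊ with hq
  have hqle : (q : ℝ) ≤ c₀ / p := Nat.floor_le (by positivity)
  set w := l2 (app M x) / √T with hw
  have hwρ : w < ρ := by rw [hw, div_lt_iff₀ hsT]; exact hMx
  have hlogT : 0 < Real.log T := Real.log_pos (by linarith)
  have htail : ρ ≤ tailNorm x (2 * q) := by
    -- Enough levels for L^k to exceed 1/p and thus 2q. Since log L ≥ (log T)/4, the k + 1 losses
    -- are covered by the exponent 3 + 4 log(1/p)/log T.
    set k := ⌈Real.log (1 / p) / Real.log L⌉₊ with hk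
    have hlogL : 0 < Real.log L := by linarith
    have hlogp : 0 ≤ Real.log (1 / p) := Real.log_nonneg (by rw [le_div_iff₀ hp]; linarith)
    have h1 := h.l2_le_pow_stepLoss_mul hκ hK hT0 (by omega) hop x k
    have hmk : 2 * q ≤ L ^ k := by
      have h2 : (2 * q : ℝ) ≤ (L : ℝ) ^ k := by
        have h3 : Real.log (1 / p) ≤ k * Real.log L := by
          rw [← div_le_iff₀ hlogL]; exact Nat.le_ceil _
        have h4 : 1 / p ≤ (L : ℝ) ^ k := by
          rw [← Real.log_le_log_iff (by positivity) (by positivity), Real.log_pow]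
          exact h3
        refine le_trans ?_ h4
        have : c₀ / p ≤ 1 / 8 / p := by gcongr
        have h5 : 1 / 8 / p = 1 / 8 * (1 / p) := by ring
        have h6 : 0 < 1 / p := by positivity
        linarith
      exact_mod_cast h2
    rw [min_eq_right hmk, hx] at h1
    have h2 : C ^ (k + 1) ≤ 1 / ρ := by
      have hkle : (k : ℝ) ≤ 4 * (Real.log (1 / p) / Real.log T) + 1 := by
        have h3 := (Nat.ceil_lt_add_one (a := Real.log (1 / p) / Real.log L) (by positivity)).le
        refine h3.trans ?_
        gcongr
        rw [div_le_iff₀ hlogL]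
        calc Real.log (1 / p) = 4 * (Real.log (1 / p) / Real.log T) * (Real.log T / 4) := by
              field_simp
          _ ≤ _ := by gcongr
      have hlogC : 0 ≤ Real.log C := Real.log_nonneg hC
      rw [hρ, spreadLevel, one_div, ← Real.exp_neg, neg_neg]
      calc C ^ (k + 1) = Real.exp (Real.log C * (k + 1)) := by
            rw [Real.exp_mul, Real.exp_log hC0]; norm_cast
        _ ≤ _ := by
            refine Real.exp_le_exp.mpr (mul_le_mul_of_nonneg_left ?_ hlogC)
            linarith
    have h3 : 1 ≤ 1 / ρ * max (tailNorm x (2 * q)) w := by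
      refine h1.trans (mul_le_mul_of_nonneg_right h2 ?_)
      exact (tailNorm_nonneg _ _).trans (le_max_left _ _)
    rw [one_div_mul_eq_div, le_div_iff₀ hρ0, one_mul] at h3
    rcases le_max_iff.mp h3 with h4 | h4
    · exact h4
    · exact absurd hwρ (not_lt.mpr h4)
  obtain ⟨S, hS, hSE⟩ := exists_tailNorm_eq x q
  set E := tailNorm x q with hE
  have hE0 : 0 < E := hρ0.trans_le (htail.trans (tailNorm_anti x (by omega)))
  set G := Sᶜ.filter fun j => E * √(p / c₀) < |x j| with hG
  have hGcard : G.card ≤ q := by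
    have h1 : ∑ j ∈ G, E ^ 2 * (p / c₀) ≤ E ^ 2 := by
      have h2 : E ^ 2 = ∑ j ∈ Sᶜ, x j ^ 2 := by rw [← hSE, l2_off_sq]
      refine le_trans ?_ h2.ge
      calc ∑ j ∈ G, E ^ 2 * (p / c₀) ≤ ∑ j ∈ G, x j ^ 2 := Finset.sum_le_sum fun j hj => by
            have h2 := pow_le_pow_left₀ (by positivity) (Finset.mem_filter.mp hj).2.le 2
            rwa [mul_pow, Real.sq_sqrt (by positivity), sq_abs] at h2
        _ ≤ _ := Finset.sum_le_sum_of_subset_of_nonneg (Finset.filter_subset _ _)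
            fun _ _ _ => sq_nonneg _
    rw [Finset.sum_const, nsmul_eq_mul] at h1
    refine Nat.le_floor ?_
    rw [le_div_iff₀ hp]
    have h2 : E ^ 2 * (G.card * (p / c₀)) ≤ E ^ 2 * 1 := by linarith
    have h3 := le_of_mul_le_mul_left h2 (by positivity)
    rw [mul_div_assoc', div_le_one hc₀] at h3
    exact h3
  set H := S ∪ G with hH
  have hHcard : H.card ≤ 2 * q := (Finset.card_union_le _ _).trans (by omega)
  set N := l2 (off x H) with hN
  have hNt : tailNorm x (2 * q) ≤ N := tailNorm_le x hHcard
  have hNρ : ρ ≤ N := htail.trans hNt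
  have hN0 : 0 < N := hρ0.trans_le hNρ
  -- If q = 0 the levels q and 2q coincide. Otherwise the chain step from q to 2q applies, and its
  -- other alternative is excluded because Mx is too small.
  have hEN : E ≤ C * N := by
    rcases Nat.eq_zero_or_pos q with h0 | hqpos
    · have h1 : E ≤ N := by
        have : tailNorm x q = tailNorm x (2 * q) := by rw [h0]
        rw [hE, this]; exact hNt
      nlinarith
    · have h1 := h.tailNorm_le_stepLoss_mul hκ hK hT0 hop x (k := q) (k' := 2 * q)
        (by nlinarith) le_rfl
      rw [max_eq_left (hwρ.le.trans htail)] at h1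
      exact h1.trans (by gcongr)
  refine ⟨H, N⁻¹ • on x H, N⁻¹ • off x H, N, ⟨hHcard, ?_, ?_, ?_⟩, ?_, hNρ, ?_, ?_⟩
  · intro j hj; simp [on, hj]
  · intro j hj; simp [off, hj]
  · rw [l2_smul, abs_of_pos (by positivity)]; exact inv_mul_cancel₀ hN0.ne'
  · rw [← smul_add, on_add_off, smul_smul, mul_inv_cancel₀ hN0.ne', one_smul]
  · rw [l2_smul, abs_of_pos (by positivity)]
    calc N⁻¹ * l2 (on x H) ≤ ρ⁻¹ * 1 := by
          refine mul_le_mul ?_ ((l2_on_le x H).trans hx.le) (l2_nonneg _) (by positivity)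
          gcongr
      _ = _ := by simp
  · intro j
    by_cases hj : j ∈ H
    · simp only [off, hj, Pi.smul_apply, if_true, smul_zero, abs_zero]; positivity
    · simp only [off, hj, Pi.smul_apply, if_false, smul_eq_mul, abs_mul]
      rw [abs_of_pos (by positivity : 0 < N⁻¹)]
      have hjS : j ∉ S := fun h => hj (Finset.mem_union_left _ h)
      have h1 : |x j| ≤ E * √(p / c₀) := by
        by_contra hcon
        exact hj (Finset.mem_union_right _ (Finset.mem_filter.mpr
          ⟨Finset.mem_compl.mpr hjS, not_le.mp hcon⟩))
      calc N⁻¹ * |x j| ≤ N⁻¹ * (C * N * √(p / c₀)) := by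
            gcongr
            exact h1.trans (by gcongr)
        _ = C / √c₀ * √p := by rw [Real.sqrt_div hp.le]; field_simp

/-- Since 1/p ≤ n and log T ≥ 1, the loss is at most polynomial in n; discretizing a head of this
size costs only O(log n) per coordinate. -/
theorem one_div_spreadLevel_le {C p : ℝ} {n : ℕ} (hC : 1 ≤ C) (hp : 0 < p) (hp1 : p ≤ 1)
    (hT : 3 ≤ n * p) :
    1 / spreadLevel C p (n * p) ≤ Real.exp (7 * Real.log C * Real.log n) := by
  have hn : (0 : ℝ) < n := by
    by_contra h0
    have : (n : ℝ) * p ≤ 0 := mul_nonpos_of_nonpos_of_nonneg (not_lt.mp h0) hp.le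
    linarith
  have hTn : (n : ℝ) * p ≤ n := by nlinarith
  have hlogT : 1 ≤ Real.log (n * p) := by
    rw [Real.le_log_iff_exp_le (by linarith)]
    linarith [Real.exp_one_lt_d9]
  have hlogn : 1 ≤ Real.log n := hlogT.trans (Real.log_le_log (by linarith) hTn)
  have hlogp : 0 ≤ Real.log (1 / p) := Real.log_nonneg (by rw [le_div_iff₀ hp]; linarith)
  have h1 : Real.log (1 / p) ≤ Real.log n :=
    Real.log_le_log (by positivity) (by rw [div_le_iff₀ hp]; linarith)
  have h2 : Real.log (1 / p) / Real.log (n * p) ≤ Real.log n :=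
    (div_le_self hlogp hlogT).trans h1
  have hlogC : 0 ≤ Real.log C := Real.log_nonneg hC
  rw [spreadLevel, one_div, ← Real.exp_neg, neg_neg]
  refine Real.exp_le_exp.mpr ?_
  calc Real.log C * (3 + 4 * (Real.log (1 / p) / Real.log (n * p)))
      ≤ Real.log C * (3 * Real.log n + 4 * Real.log n) := by gcongr; linarith
    _ = _ := by ring

/-- `x` is a multiple, at least `ρ`, of the sum of a sparse vector and a spread unit vector. -/
def HasSpreadSplit {n : ℕ} (m : ℕ) (ρ s ε : ℝ) (x : Fin n → ℝ) : Prop :=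
  ∃ J g y N, IsSplit m J g y ∧ x = N • (g + y) ∧ ρ ≤ N ∧ l2 g ≤ 1 / ρ ∧ IsSpread s ε y

theorem two_mul_exp_neg_le {c T : ℝ} (hcT : 2 ≤ c * T) :
    2 * Real.exp (-c * T) ≤ Real.exp (-(c / 2) * T) := by
  have h1 : 2 ≤ Real.exp (c / 2 * T) := by
    have := Real.add_one_le_exp (c / 2 * T)
    linarith
  calc 2 * Real.exp (-c * T) ≤ Real.exp (c / 2 * T) * Real.exp (-c * T) := by gcongr
    _ = _ := by rw [← Real.exp_add]; congr 1; ring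

/-- The head has O(1/p) coordinates, at most n/(4T) of them; this makes its entropy m log n small
compared with n once log n is small compared with T. -/
theorem two_mul_floor_le {p c₀ : ℝ} {n : ℕ} (hp : 0 < p) (hc₀ : 0 < c₀) (hc₀1 : c₀ ≤ 1 / 8)
    (hT : 1 ≤ n * p) :
    ((2 * ⌊c₀ / p⌋₊ : ℕ) : ℝ) * (4 * (n * p)) ≤ n ∧ 2 * ⌊c₀ / p⌋₊ ≤ n := by
  have h1 : (⌊c₀ / p⌋₊ : ℝ) ≤ c₀ / p := Nat.floor_le (by positivity)
  have h2 : (⌊c₀ / p⌋₊ : ℝ) * p ≤ 1 / 8 := by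
    rw [le_div_iff₀ hp] at h1; linarith
  have h3 : ((2 * ⌊c₀ / p⌋₊ : ℕ) : ℝ) * (4 * (n * p)) ≤ n := by
    push_cast
    have := mul_le_mul_of_nonneg_right h2 (by positivity : (0 : ℝ) ≤ 8 * n)
    linarith
  refine ⟨h3, ?_⟩
  have h4 : ((2 * ⌊c₀ / p⌋₊ : ℕ) : ℝ) ≤ n := by
    refine le_trans ?_ h3
    exact le_mul_of_one_le_right (by positivity) (by linarith)
  exact_mod_cast h4

/-- Expansion produces a split with flat body. If the body were not spread it would be nearly
sparse, and the normalized vector x/N would still have a small image because N ≥ ρ; the net estimate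
excludes this. -/
theorem exists_matLaw_not_spreadSplit_le {κ B K : ℝ} (hκ : 0 < κ) (hκ1 : κ ≤ 1) (hB : 1 ≤ B)
    (hK : 1 ≤ K) :
    ∃ s ε b c c₀ C₀ : ℝ, 0 < s ∧ 0 < ε ∧ 0 < b ∧ 0 < c ∧ 0 < c₀ ∧ c₀ ≤ 1 / 8 ∧
      ∀ (p : ℝ), 0 < p → p ≤ 1 → ∀ ν : Measure ℝ, SparseLaw ν p κ B →
      ∀ (n : ℕ), C₀ ≤ n * p → C₀ * Real.log n ≤ n * p →
      ∀ (ι : Type) [Fintype ι] (r : ι → Fin n) (d : ι → ℝ), Function.Injective r →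
        n ≤ Fintype.card ι + 1 →
        (matLaw ν r d).real {M | OpBound M (K * √(n * p)) ∧ ¬ ∀ x, l2 x = 1 →
          l2 (app M x) ≤ b * spreadLevel (stepLoss K κ) p (n * p) * √(n * p) →
          HasSpreadSplit (2 * ⌊c₀ / p⌋₊) (spreadLevel (stepLoss K κ) p (n * p)) s ε x} ≤ Real.exp (-c * (n * p)) := by
  obtain ⟨c₀, C1, hc₀, hc₀1, hexp⟩ := exists_matLaw_not_expands_le (B := B) hκ hκ1
  have hC := one_le_stepLoss (K := K) hκ
  set C := stepLoss K κ with hCdef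
  obtain ⟨ε, s, b, c, hε, hs, hb, hc, hs1, hnet⟩ :=
    exists_matLaw_nearlySparse_le hκ hB (A := C / √c₀) (by positivity) hK
  set β := 2 + 7 * Real.log C + Real.log (4 / ε + 3) with hβ
  have hlogC : 0 ≤ Real.log C := Real.log_nonneg hC
  have hlogε : 0 ≤ Real.log (4 / ε + 3) := by
    refine Real.log_nonneg ?_
    have : 0 < 4 / ε := by positivity
    linarith
  have hβ0 : 0 < β := by linarith
  set c' := min (κ / 1024) c with hc'
  have hc'0 : 0 < c' := by positivity
  refine ⟨s, ε, min b 1 / 2, c' / 2, c₀, max (max C1 66) (max (β / c) (2 / c')), hs, hε,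
    by positivity, by positivity, hc₀, hc₀1, ?_⟩
  intro p hp hp1 ν hν n hT hTlog ι _ r d hr hcard
  have := hν.prob
  set T := n * p with hTdef
  have hT1 : C1 ≤ T := ((le_max_left _ _).trans (le_max_left _ _)).trans hT
  have hT66 : 66 ≤ T := ((le_max_right _ _).trans (le_max_left _ _)).trans hT
  have hTc' : 2 / c' ≤ T := ((le_max_right _ _).trans (le_max_right _ _)).trans hT
  have hT0 : 0 < T := by linarith
  have hn0 : (0 : ℝ) < n := by
    by_contra h0
    have : (n : ℝ) * p ≤ 0 := mul_nonpos_of_nonpos_of_nonneg (not_lt.mp h0) hp.le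
    linarith
  have hTn : T ≤ n := by rw [hTdef]; nlinarith
  have hlogn : 1 ≤ Real.log n := by
    rw [Real.le_log_iff_exp_le hn0]
    linarith [Real.exp_one_lt_d9]
  have hlog1 : C1 * Real.log n ≤ T :=
    (mul_le_mul_of_nonneg_right ((le_max_left _ _).trans (le_max_left _ _)) (by linarith)).trans hTlog
  have hlogβ : β * Real.log n ≤ c * T := by
    have h1 : β / c * Real.log n ≤ T :=
      (mul_le_mul_of_nonneg_right ((le_max_left _ _).trans (le_max_right _ _)) (by linarith)).trans hTlog
    rw [div_mul_eq_mul_div, div_le_iff₀ hc] at h1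
    linarith
  have hn66 : 66 ≤ n := by exact_mod_cast hT66.trans hTn
  set ρ := spreadLevel C p T with hρ
  have hρ0 : 0 < ρ := spreadLevel_pos _ _ _
  have hρn : 1 / ρ ≤ Real.exp (7 * Real.log C * Real.log n) :=
    one_div_spreadLevel_le hC hp hp1 (by linarith)
  obtain ⟨hmT, hmn⟩ := two_mul_floor_le hp hc₀ hc₀1 (by linarith : 1 ≤ n * p)
  set m := 2 * ⌊c₀ / p⌋₊ with hm
  set H := ⌈2 * (1 / ρ * √n / ε)⌉₊ with hH
  have hbudget : ((n * (2 * H + 1) : ℝ)) ^ m ≤ Real.exp (c * n) := by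
    have h1 : (H : ℝ) ≤ 2 * (1 / ρ * √n / ε) + 1 := (Nat.ceil_lt_add_one (by positivity)).le
    have hsn : √(n : ℝ) ≤ n := by
      rw [Real.sqrt_le_left hn0.le]; nlinarith
    set Z := Real.exp (7 * Real.log C * Real.log n) with hZ
    have hZ1 : 1 ≤ Z := Real.one_le_exp (by positivity)
    have h2 : (n * (2 * H + 1) : ℝ) ≤ Real.exp (β * Real.log n) := by
      calc (n * (2 * H + 1) : ℝ) ≤ n * (4 * (Z * n / ε) + 3) := by
            gcongr n * ?_
            have : 1 / ρ * √n / ε ≤ Z * n / ε := by gcongr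
            linarith
        _ ≤ n * (4 * (Z * n / ε) + 3 * (Z * n)) := by
            gcongr
            have h1n : (1 : ℝ) ≤ n := by linarith
            have : 1 * 1 ≤ Z * n := mul_le_mul hZ1 h1n zero_le_one (by positivity)
            linarith
        _ = n * n * Z * (4 / ε + 3) := by field_simp
        _ = Real.exp (Real.log n + Real.log n + 7 * Real.log C * Real.log n +
              Real.log (4 / ε + 3)) := by
            rw [Real.exp_add, Real.exp_add, Real.exp_add, Real.exp_log hn0,
              Real.exp_log (by positivity)]
        _ ≤ _ := by
            refine Real.exp_le_exp.mpr ?_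
            rw [hβ]
            nlinarith
    calc (n * (2 * H + 1) : ℝ) ^ m ≤ Real.exp (β * Real.log n) ^ m :=
          pow_le_pow_left₀ (by positivity) h2 m
      _ = Real.exp (m * (β * Real.log n)) := by rw [Real.exp_nat_mul]
      _ ≤ _ := by
          refine Real.exp_le_exp.mpr ?_
          calc (m : ℝ) * (β * Real.log n) ≤ m * (c * T) := by gcongr
            _ = c * (m * T) := by ring
            _ ≤ c * n := by
                gcongr
                have : (0 : ℝ) ≤ m * T := by positivity
                linarith
  have h1 := hexp p hp hp1 ν hν n hT1 hlog1 ι r d hr hcard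
  have h2 := hnet p hp ν hν n hn66 ι r d hr hcard m H hmn hbudget
  refine (measureReal_mono ?_ (measure_ne_top _ _)).trans
    ((measureReal_union_le _ _).trans ((add_le_add h1 h2).trans ?_))
  · rintro M ⟨hop, hneg⟩
    by_cases hM : Expands r M ⌊√T⌋₊ m (κ / 32 * T)
    · right
      push Not at hneg
      obtain ⟨x, hx, hMx, hno⟩ := hneg
      have hsT : 0 < √T := Real.sqrt_pos.mpr hT0
      have hb1 : min b 1 / 2 ≤ b := by
        have := min_le_left b 1
        have : 0 < min b 1 := by positivity
        linarith [min_le_left b 1]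
      have hb2 : min b 1 / 2 < 1 := by linarith [min_le_right b 1]
      have hMx' : l2 (app M x) < ρ * √T := by
        refine hMx.trans_lt ?_
        gcongr
        exact mul_lt_of_lt_one_left hρ0 hb2
      obtain ⟨J, g, y, N, hsplit, hxe, hN, hg, hyA⟩ := hM.exists_split hκ (by linarith) hp hp1 hc₀ hc₀1
        (by linarith) hop hx hMx'
      have hN0 : 0 < N := hρ0.trans_le hN
      refine ⟨hop, J, g, y, hsplit, ?_, hyA, ?_, ?_⟩
      · refine le_trans ?_ (Nat.le_ceil _)
        gcongr
      · by_contra hcon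
        push Not at hcon
        exact hno ⟨J, g, y, N, hsplit, hxe, hN, hg, fun S hS => (hcon S hS).le⟩
      · have h3 : g + y = N⁻¹ • x := by
          rw [hxe, smul_smul, inv_mul_cancel₀ hN0.ne', one_smul]
        rw [h3, app_smul, l2_smul, abs_of_pos (by positivity)]
        calc N⁻¹ * l2 (app M x) ≤ ρ⁻¹ * (b * ρ * √T) := by
              refine mul_le_mul (by gcongr) (hMx.trans (by gcongr)) (l2_nonneg _) (by positivity)
          _ = b * √T := by field_simp
    · exact Or.inl hM
  · have h3 : Real.exp (-(κ / 1024) * T) ≤ Real.exp (-c' * T) := by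
      refine Real.exp_le_exp.mpr ?_
      have h5 : c' * T ≤ κ / 1024 * T := mul_le_mul_of_nonneg_right (min_le_left _ _) hT0.le
      linarith
    have h4 : Real.exp (-c * n) ≤ Real.exp (-c' * T) := by
      refine Real.exp_le_exp.mpr ?_
      have h5 : c' ≤ c := min_le_right _ _
      have : c' * T ≤ c * n := mul_le_mul h5 hTn hT0.le hc.le
      linarith
    refine le_trans ?_ (two_mul_exp_neg_le (c := c') (T := T) ?_)
    · linarith
    · rw [div_le_iff₀ hc'0] at hTc'; linarith

/-- Almost null vectors have a positive proportion of large coordinates. -/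
theorem exists_matLaw_few_large_le {κ B K : ℝ} (hκ : 0 < κ) (hκ1 : κ ≤ 1) (hB : 1 ≤ B)
    (hK : 1 ≤ K) :
    ∃ a b c C₀ : ℝ, 0 < a ∧ 0 < b ∧ 0 < c ∧
      ∀ (p : ℝ), 0 < p → p ≤ 1 → ∀ ν : Measure ℝ, SparseLaw ν p κ B →
      ∀ (n : ℕ), C₀ ≤ n * p → C₀ * Real.log n ≤ n * p →
      ∀ (ι : Type) [Fintype ι] (r : ι → Fin n) (d : ι → ℝ), Function.Injective r →
        n ≤ Fintype.card ι + 1 →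
        (matLaw ν r d).real {M | OpBound M (K * √(n * p)) ∧ ¬ ∀ x, l2 x = 1 →
          l2 (app M x) ≤ b * spreadLevel (stepLoss K κ) p (n * p) * √(n * p) →
          a * n ≤ ((Finset.univ.filter fun j =>
            a * spreadLevel (stepLoss K κ) p (n * p) / √n ≤ |x j|).card : ℝ)} ≤
          Real.exp (-c * (n * p)) := by
  obtain ⟨s, ε, b, c, c₀, C₀, hs, hε, hb, hc, -, -, hmain⟩ :=
    exists_matLaw_not_spreadSplit_le hκ hκ1 hB hK
  -- The first entry is the proportion of large coordinates found below, the second their threshold.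
  set a := min (ε ^ 2 * s / 2) (ε / 2) with ha
  have ha0 : 0 < a := by positivity
  refine ⟨a, b, c, max C₀ 1, ha0, hb, hc, ?_⟩
  intro p hp hp1 ν hν n hT hTlog ι _ r d hr hcard
  have := hν.prob
  have hT1 : 1 ≤ n * p := (le_max_right _ _).trans hT
  have hn0 : (0 : ℝ) < n := by
    by_contra h0
    have : (n : ℝ) * p ≤ 0 := mul_nonpos_of_nonpos_of_nonneg (not_lt.mp h0) hp.le
    linarith
  have hn : 0 < n := by exact_mod_cast hn0
  have hlogn : 0 ≤ Real.log n := Real.log_natCast_nonneg n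
  refine (measureReal_mono ?_).trans (hmain p hp hp1 ν hν n ((le_max_left _ _).trans hT)
    ((mul_le_mul_of_nonneg_right (le_max_left _ _) hlogn).trans hTlog) ι r d hr hcard)
  rintro M ⟨hop, hneg⟩
  refine ⟨hop, fun hcon => hneg fun x hx hMx => ?_⟩
  obtain ⟨J, g, y, N, hsplit, hxe, hN, hg, hsp⟩ := hcon x hx hMx
  set ρ := spreadLevel (stepLoss K κ) p (n * p) with hρ
  have hρ0 : 0 < ρ := spreadLevel_pos _ _ _
  have hN0 : 0 < N := hρ0.trans_le hN
  have hsn : 0 < √(n : ℝ) := Real.sqrt_pos.mpr hn0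
  set S := Finset.univ.filter fun j => 1 / √(s * n) < |y j| with hS
  have h1 := hsp S (card_filter_lt_abs_le hs hn hsplit.l2_eq)
  set D := Finset.univ.filter fun j => a * ρ / √n ≤ |x j| with hD
  have h2 : ε ^ 2 ≤ ∑ j ∈ Sᶜ, y j ^ 2 := by
    rw [← l2_off_sq]; exact pow_le_pow_left₀ hε.le h1 2
  -- Outside S the squared norm of y is at least ε². A coordinate there contributes at most 1/(sn),
  -- and at most ε²/(2n) when x_j is small, so at least ε²sn/2 coordinates of x are large.
  -- Coordinates in the head contribute nothing to y.
  have h3 : ∀ j ∈ Sᶜ, y j ^ 2 ≤ (if j ∈ D then 1 / (s * n) else 0) + ε ^ 2 / (2 * n) := by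
    intro j hj
    have h4 : |y j| ≤ 1 / √(s * n) := by
      by_contra hc
      exact (Finset.mem_compl.mp hj) (by simpa [hS] using hc)
    by_cases hjD : j ∈ D
    · have h5 := pow_le_pow_left₀ (abs_nonneg _) h4 2
      rw [sq_abs, div_pow, one_pow, Real.sq_sqrt (by positivity)] at h5
      simp only [hjD, if_true]
      have : 0 ≤ ε ^ 2 / (2 * n) := by positivity
      linarith
    · simp only [hjD, if_false, zero_add]
      have h5 : |x j| < a * ρ / √n := by
        by_contra hc
        exact hjD (by simpa [hD] using hc)
      have h6 : |y j| ≤ ε / 2 / √n := by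
        by_cases hjJ : j ∈ J
        · rw [hsplit.body j hjJ, abs_zero]; positivity
        · have h7 : x j = N * y j := by
            rw [hxe]; simp [hsplit.head j hjJ]
          rw [h7, abs_mul, abs_of_pos hN0] at h5
          have h8 : ρ * |y j| ≤ ρ * (ε / 2 / √n) := by
            calc ρ * |y j| ≤ N * |y j| := by gcongr
              _ ≤ a * ρ / √n := h5.le
              _ ≤ ε / 2 * ρ / √n := by gcongr; exact min_le_right _ _
              _ = _ := by ring
          exact le_of_mul_le_mul_left h8 hρ0
      have h9 := pow_le_pow_left₀ (abs_nonneg _) h6 2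
      rw [sq_abs, div_pow, Real.sq_sqrt hn0.le] at h9
      refine h9.trans ?_
      rw [div_le_div_iff₀ hn0 (by positivity)]
      nlinarith [sq_nonneg ε]
  have h4 := h2.trans (Finset.sum_le_sum h3)
  rw [Finset.sum_add_distrib] at h4
  have h5 : ∑ j ∈ Sᶜ, (if j ∈ D then 1 / (s * n) else 0 : ℝ) ≤ D.card * (1 / (s * n)) := by
    rw [← Finset.sum_filter, Finset.sum_const, nsmul_eq_mul]
    gcongr
    intro j hj
    exact (Finset.mem_filter.mp hj).2
  have h6 : ∑ j ∈ Sᶜ, (ε ^ 2 / (2 * n) : ℝ) ≤ ε ^ 2 / 2 := by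
    rw [Finset.sum_const, nsmul_eq_mul]
    have h7 : ((Sᶜ).card : ℝ) ≤ n := by
      exact_mod_cast (Finset.card_le_univ _).trans (by simp)
    calc _ ≤ (n : ℝ) * (ε ^ 2 / (2 * n)) := by gcongr
      _ = _ := by field_simp
  have h7 : ε ^ 2 / 2 ≤ D.card * (1 / (s * n)) := by linarith
  rw [mul_one_div, le_div_iff₀ (by positivity)] at h7
  calc a * n ≤ ε ^ 2 * s / 2 * n := by gcongr; exact min_le_left _ _
    _ ≤ _ := by linarith

set_option maxHeartbeats 1000000 in
/-- Null vectors of the matrix have small ball probabilities of the optimal order. -/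
theorem exists_matLaw_not_smallBall_le {κ B K : ℝ} (hκ : 0 < κ) (hκ1 : κ ≤ 1) (hB : 1 ≤ B)
    (hK : 1 ≤ K) :
    ∃ C c C₀ : ℝ, 0 < C ∧ 0 < c ∧
      ∀ (p : ℝ), 0 < p → p ≤ 1 → ∀ ν : Measure ℝ, SparseLaw ν p κ B →
      ∀ (n : ℕ), C₀ ≤ n * p → C₀ * Real.log n ≤ n * p →
      ∀ (ι : Type) [Fintype ι] (r : ι → Fin n) (d : ι → ℝ), Function.Injective r →
        n ≤ Fintype.card ι + 1 →
        (matLaw ν r d).real {M | OpBound M (K * √(n * p)) ∧ ¬ ∀ x, l2 x = 1 → app M x = 0 →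
          ∀ (k : Fin n) (a τ : ℝ), 0 ≤ τ → (rowLaw ν k a).real {X | |X ⬝ᵥ x| ≤ τ} ≤
            C * (τ / (spreadLevel (stepLoss K κ) p (n * p) * √p)) + Real.exp (-c * (n * p))} ≤
          Real.exp (-c * (n * p)) := by
  obtain ⟨s, ε, b, c, c₀, C1, hs, hε, hb, hc, hc₀, hc₀1, hA⟩ :=
    exists_matLaw_not_spreadSplit_le hκ hκ1 hB hK
  obtain ⟨α, w, C2, hα, hw, hw1, hwα, hLCD⟩ := exists_matLaw_structured_le hκ hκ1 hB hK hs hε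
  have hLoss := one_le_stepLoss (K := K) hκ
  set C := stepLoss K κ with hCdef
  have hlogC : 0 ≤ Real.log C := Real.log_nonneg hLoss
  set β := 1 + 7 * Real.log C + Real.log (4 / α + 1) with hβ
  have hlogα : 0 ≤ Real.log (4 / α + 1) := by
    refine Real.log_nonneg ?_
    have : 0 < 4 / α := by positivity
    linarith
  set CL := 32 * √(Real.pi ^ 3 / (2 * κ * (ε / 2) ^ 2)) with hCL
  have hCL0 : 0 < CL := by have := Real.pi_pos; positivity
  set F := 2 * B * CL + 32 with hF
  have hF0 : 0 < F := by positivity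
  set c' := min (min c 1) (w / 2) with hc'
  have hc'0 : 0 < c' := by positivity
  have hc'1 : c' ≤ c := (min_le_left _ _).trans (min_le_left _ _)
  have hc'2 : c' ≤ 1 := (min_le_left _ _).trans (min_le_right _ _)
  have hc'3 : c' ≤ w / 2 := min_le_right _ _
  refine ⟨CL, c' / 2, max (max (max C1 C2) (max 3 β)) (max (max (1 / w) (2 / c')) (2 * F / c')),
    hCL0, by positivity, ?_⟩
  intro p hp hp1 ν hν n hT hTlog ι _ r d hr hcard
  have := hν.prob
  set T := n * p with hTdef
  have hT1 : C1 ≤ T := ((le_max_left _ _).trans ((le_max_left _ _).trans (le_max_left _ _))).trans hT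
  have hT2 : C2 ≤ T := ((le_max_right _ _).trans ((le_max_left _ _).trans (le_max_left _ _))).trans hT
  have hT3 : 3 ≤ T := ((le_max_left _ _).trans ((le_max_right _ _).trans (le_max_left _ _))).trans hT
  have hTw : 1 / w ≤ T := ((le_max_left _ _).trans ((le_max_left _ _).trans (le_max_right _ _))).trans hT
  have hTc' : 2 / c' ≤ T :=
    ((le_max_right _ _).trans ((le_max_left _ _).trans (le_max_right _ _))).trans hT
  have hTF : 2 * F / c' ≤ T := ((le_max_right _ _).trans (le_max_right _ _)).trans hT
  have hT0 : 0 < T := by linarith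
  have hn0 : (0 : ℝ) < n := by
    by_contra h0
    have : (n : ℝ) * p ≤ 0 := mul_nonpos_of_nonpos_of_nonneg (not_lt.mp h0) hp.le
    linarith
  have hTn : T ≤ n := by rw [hTdef]; nlinarith
  have hlogn : 1 ≤ Real.log n := by
    rw [Real.le_log_iff_exp_le hn0]
    linarith [Real.exp_one_lt_d9]
  have hlog : ∀ a, a ≤ max (max (max C1 C2) (max 3 β)) (max (max (1 / w) (2 / c')) (2 * F / c')) →
      a * Real.log n ≤ T := fun a ha =>
    (mul_le_mul_of_nonneg_right ha (by linarith)).trans hTlog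
  have hlog1 : C1 * Real.log n ≤ T :=
    hlog _ ((le_max_left _ _).trans ((le_max_left _ _).trans (le_max_left _ _)))
  have hlogβ : β * Real.log n ≤ T :=
    hlog _ ((le_max_right _ _).trans ((le_max_right _ _).trans (le_max_left _ _)))
  have hlogw : Real.log n ≤ w * T := by
    have := hlog (1 / w) ((le_max_left _ _).trans ((le_max_left _ _).trans (le_max_right _ _)))
    rw [one_div_mul_eq_div, div_le_iff₀ hw] at this
    linarith
  set ρ := spreadLevel C p T with hρ
  have hρ0 : 0 < ρ := spreadLevel_pos _ _ _
  have hρn : 1 / ρ ≤ Real.exp (7 * Real.log C * Real.log n) :=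
    one_div_spreadLevel_le hLoss hp hp1 hT3
  obtain ⟨hmT, hmn⟩ := two_mul_floor_le hp hc₀ hc₀1 (by linarith : 1 ≤ n * p)
  set m := 2 * ⌊c₀ / p⌋₊ with hm
  set X := Real.exp (w * T) with hX
  have hX0 : 0 < X := Real.exp_pos _
  have hwT : 1 ≤ w * T := by rw [div_le_iff₀ hw] at hTw; linarith
  have hX2 : 2 ≤ X := by have := Real.add_one_le_exp (w * T); linarith
  have hbudget : (n * (4 * (X * (1 / ρ) / α) + 1)) ^ m ≤ Real.exp n := by
    set Z := Real.exp (7 * Real.log C * Real.log n) with hZ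
    have hZ1 : 1 ≤ Z := Real.one_le_exp (by positivity)
    have h2 : (n * (4 * (X * (1 / ρ) / α) + 1) : ℝ) ≤ Real.exp (w * T + β * Real.log n) := by
      calc (n * (4 * (X * (1 / ρ) / α) + 1) : ℝ) ≤ n * (4 * (X * Z / α) + X * Z) := by
            have hXZ : 1 * 1 ≤ X * Z := mul_le_mul (by linarith) hZ1 zero_le_one hX0.le
            have h5 : X * (1 / ρ) / α ≤ X * Z / α := by gcongr
            gcongr n * ?_
            linarith
        _ = X * (n * Z * (4 / α + 1)) := by field_simp
        _ = Real.exp (w * T + (Real.log n + 7 * Real.log C * Real.log n +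
              Real.log (4 / α + 1))) := by
            rw [Real.exp_add, Real.exp_add, Real.exp_add, Real.exp_log hn0,
              Real.exp_log (by positivity)]
        _ ≤ _ := by
            refine Real.exp_le_exp.mpr ?_
            have h5 : Real.log (4 / α + 1) ≤ Real.log (4 / α + 1) * Real.log n :=
              le_mul_of_one_le_right hlogα hlogn
            have h6 : β * Real.log n = Real.log n + 7 * Real.log C * Real.log n +
              Real.log (4 / α + 1) * Real.log n := by rw [hβ]; ring
            linarith
    calc _ ≤ Real.exp (w * T + β * Real.log n) ^ m := pow_le_pow_left₀ (by positivity) h2 m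
      _ = Real.exp (m * (w * T + β * Real.log n)) := by rw [Real.exp_nat_mul]
      _ ≤ _ := by
          refine Real.exp_le_exp.mpr ?_
          calc (m : ℝ) * (w * T + β * Real.log n) ≤ m * (T + T) := by
                gcongr
                exact mul_le_of_le_one_left hT0.le hw1
            _ = m * (2 * T) := by ring
            _ ≤ m * (4 * T) := by gcongr; norm_num
            _ ≤ n := hmT
  have h1 := hA p hp hp1 ν hν n hT1 hlog1 ι r d hr hcard
  have h2 := hLCD p hp hp1 ν hν n hT2 ι r d hr hcard m (1 / ρ) (by positivity) hmn hbudget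
  have hsp : 0 < √p := Real.sqrt_pos.mpr hp
  refine (measureReal_mono ?_ (measure_ne_top _ _)).trans
    ((measureReal_union_le _ _).trans ((add_le_add h1 h2).trans ?_))
  · rintro M ⟨hop, hneg⟩
    by_contra hM
    rw [Set.mem_union, not_or] at hM
    obtain ⟨hM1, hM2⟩ := hM
    refine hneg fun x hx hMx k a τ hτ => ?_
    have hgood : HasSpreadSplit m ρ s ε x := by
      by_contra hcon
      refine hM1 ⟨hop, fun hall => hcon (hall x hx ?_)⟩
      rw [hMx, l2_zero]; positivity
    obtain ⟨J, g, y, N, hsplit, hxe, hN, hg, hspread⟩ := hgood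
    have hN0 : 0 < N := hρ0.trans_le hN
    have h3 : g + y = N⁻¹ • x := by
      rw [hxe, smul_smul, inv_mul_cancel₀ hN0.ne', one_smul]
    have hker : app M (g + y) = 0 := by rw [h3, app_smul, hMx, smul_zero]
    have hdist : ∀ θ : ℝ, 0 ≤ θ → θ ≤ X / 2 →
        min (ε / 2 * θ) (α * √n / 4) ≤ latticeDist (θ • y) := by
      have hd : ∀ θ : ℝ, 0 ≤ θ → θ + 1 ≤ X →
          min (ε / 2 * θ) (α * √n / 4) ≤ latticeDist (θ • y) := by
        by_contra hcon
        exact hM2 ⟨hop, J, g, y, hsplit, hg, hspread, hker, hcon⟩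
      exact fun θ h0 hθ => hd θ h0 (by linarith)
    -- Dividing by N ≥ ρ rescales τ to τ/ρ. The second term reaches the smallest scale at which the
    -- small ball estimate is available, and costs only an exponentially small amount.
    set t := τ / ρ + B / (X / 2) with ht
    have hτρ : 0 ≤ τ / ρ := by positivity
    have hball := hν.measureReal_rowSum_le hp hp1 hκ hB k a (y := y) (z := g + y) (fun j => by
      by_cases hj : j ∈ J
      · exact Or.inl (hsplit.body j hj)
      · exact Or.inr (by simp [hsplit.head j hj])) (e := ε / 2) (g := α * √n / 4) (Θ := X / 2)
      (t := t) (by positivity) (by positivity) (by positivity) hdist (by rw [ht]; linarith)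
    rw [← hCL] at hball
    have hle : (rowLaw ν k a).real {X | |X ⬝ᵥ x| ≤ τ} ≤
        (rowSum ν k a (g + y)).real {x | |x| ≤ t} := by
      rw [rowSum, map_measureReal_apply (measurable_dotProduct_const _)
        (measurableSet_le (by fun_prop) (by fun_prop))]
      refine measureReal_mono fun Y hY => ?_
      have hY : |Y ⬝ᵥ x| ≤ τ := hY
      show |Y ⬝ᵥ (g + y)| ≤ t
      rw [h3, dotProduct_smul, smul_eq_mul, abs_mul, abs_of_pos (by positivity)]
      have h4 : N⁻¹ * |Y ⬝ᵥ x| ≤ ρ⁻¹ * τ := by gcongr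
      have h5 : 0 ≤ B / (X / 2) := by positivity
      have h6 : ρ⁻¹ * τ = τ / ρ := by ring
      rw [ht]; linarith
    refine hle.trans (hball.trans ?_)
    have hexp1 : Real.exp (-8 * κ * p * (α * √n / 4) ^ 2) ≤ Real.exp (-(w / 2) * T) := by
      refine Real.exp_le_exp.mpr ?_
      rw [div_pow, mul_pow, Real.sq_sqrt hn0.le]
      have h4 : w * T ≤ κ * α ^ 2 / 4 * T := by gcongr
      have h5 : -8 * κ * p * (α ^ 2 * n / 4 ^ 2) = -(2 * (κ * α ^ 2 / 4 * T)) := by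
        rw [hTdef]; ring
      rw [h5]
      nlinarith
    have hexp2 : B / (X / 2) / √p ≤ 2 * B * Real.exp (-(w / 2) * T) := by
      have h4 : 1 / √p ≤ Real.exp (w / 2 * T) := by
        have h5 : 1 / √p ≤ √n := by
          rw [div_le_iff₀ hsp, ← Real.sqrt_mul hn0.le, Real.one_le_sqrt]
          linarith
        refine h5.trans ?_
        rw [Real.sqrt_le_left (Real.exp_pos _).le, ← Real.exp_nat_mul, ← Real.log_le_iff_le_exp hn0]
        push_cast
        linarith
      have h6 : Real.exp (-(w / 2) * T) = X⁻¹ * Real.exp (w / 2 * T) := by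
        rw [hX, ← Real.exp_neg, ← Real.exp_add]; congr 1; ring
      calc B / (X / 2) / √p = 2 * B * (X⁻¹ * (1 / √p)) := by field_simp
        _ ≤ 2 * B * (X⁻¹ * Real.exp (w / 2 * T)) := by gcongr
        _ = _ := by rw [h6]
    have hFexp : F * Real.exp (-(w / 2) * T) ≤ Real.exp (-(c' / 2) * T) := by
      have h4 : F ≤ Real.exp (c' / 2 * T) := by
        rw [div_le_iff₀ hc'0] at hTF
        have := Real.add_one_le_exp (c' / 2 * T)
        linarith
      calc F * Real.exp (-(w / 2) * T) ≤ Real.exp (c' / 2 * T) * Real.exp (-c' * T) := by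
            gcongr
        _ = _ := by rw [← Real.exp_add]; congr 1; ring
    have h7 : t / √p = τ / (ρ * √p) + B / (X / 2) / √p := by
      rw [ht, add_div, div_div]
    rw [h7]
    have h8 := mul_le_mul_of_nonneg_left hexp2 hCL0.le
    have h9 : F * Real.exp (-(w / 2) * T) =
        CL * (2 * B * Real.exp (-(w / 2) * T)) + 32 * Real.exp (-(w / 2) * T) := by rw [hF]; ring
    linarith
  · have h3 : Real.exp (-c * T) ≤ Real.exp (-c' * T) := by
      refine Real.exp_le_exp.mpr ?_
      nlinarith
    have h4 : Real.exp (-n) ≤ Real.exp (-c' * T) := by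
      refine Real.exp_le_exp.mpr ?_
      nlinarith
    refine le_trans ?_ (two_mul_exp_neg_le (c := c') (T := T) ?_)
    · linarith
    · rw [div_le_iff₀ hc'0] at hTc'; linarith

/-! ### Distances between a row and the span of the others -/

/-- Every unit vector orthogonal to all rows but the `j`-th almost annihilates the `j`-th row. -/
def CloseRow {n : ℕ} (t : ℝ) (j : Fin n) (N : Fin n → Fin n → ℝ) : Prop :=
  ∀ v, l2 v = 1 → (∀ i, i ≠ j → N i ⬝ᵥ v = 0) → |N j ⬝ᵥ v| ≤ t

theorem isCompact_l2_sphere (n : ℕ) : IsCompact {v : Fin n → ℝ | l2 v = 1} := by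
  refine Metric.isCompact_of_isClosed_isBounded (isClosed_eq continuous_l2 continuous_const) ?_
  refine (Metric.isBounded_closedBall (x := (0 : Fin n → ℝ)) (r := 1)).subset fun v hv => ?_
  rw [mem_closedBall_zero_iff, pi_norm_le_iff_of_nonneg zero_le_one]
  exact fun i => (abs_le_l2 v i).trans (le_of_eq hv)

/-- The complement is a countable union of projections, along the compact sphere, of closed sets;
such projections are closed. -/
theorem measurableSet_closeRow {n : ℕ} (t : ℝ) (j : Fin n) :
    MeasurableSet {N : Fin n → Fin n → ℝ | CloseRow t j N} := by
  have hcompact := isCompact_l2_sphere n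
  have : CompactSpace {v : Fin n → ℝ | l2 v = 1} := isCompact_iff_compactSpace.mp hcompact
  let F : ℕ → Set ((Fin n → Fin n → ℝ) × {v : Fin n → ℝ | l2 v = 1}) := fun k =>
    {q | (∀ i, i ≠ j → q.1 i ⬝ᵥ q.2.1 = 0) ∧ t + 1 / (k + 1) ≤ |q.1 j ⬝ᵥ q.2.1|}
  have hdot : ∀ i, Continuous fun q : (Fin n → Fin n → ℝ) × {v : Fin n → ℝ | l2 v = 1} =>
      q.1 i ⬝ᵥ q.2.1 := fun i =>
    Continuous.dotProduct ((continuous_apply i).comp continuous_fst)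
      (continuous_subtype_val.comp continuous_snd)
  have hF : ∀ k, IsClosed (F k) := fun k => by
    have h1 : F k = (⋂ i, ⋂ _ : i ≠ j, {q | q.1 i ⬝ᵥ q.2.1 = 0}) ∩
        {q | t + 1 / (k + 1) ≤ |q.1 j ⬝ᵥ q.2.1|} := by
      ext q; simp [F]
    rw [h1]
    refine IsClosed.inter ?_ (isClosed_le continuous_const (hdot j).abs)
    exact isClosed_iInter fun i => isClosed_iInter fun _ => isClosed_eq (hdot i) continuous_const
  have heq : {N : Fin n → Fin n → ℝ | CloseRow t j N} = (⋃ k, Prod.fst '' F k)ᶜ := by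
    ext N
    rw [← not_iff_not]
    simp only [Set.mem_compl_iff, not_not, Set.mem_iUnion, Set.mem_image, Prod.exists,
      exists_and_right, exists_eq_right]
    constructor
    · intro h
      have h : ¬ CloseRow t j N := h
      unfold CloseRow at h
      push Not at h
      obtain ⟨v, hv, hN, ht⟩ := h
      obtain ⟨k, hk⟩ := exists_nat_one_div_lt (sub_pos.mpr ht)
      exact ⟨k, ⟨v, hv⟩, hN, by show t + 1 / ((k : ℝ) + 1) ≤ |N j ⬝ᵥ v|; linarith⟩
    · rintro ⟨k, v, hN, ht⟩ (h : CloseRow t j N)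
      have h1 := h v.1 v.2 hN
      have h2 : t + 1 / ((k : ℝ) + 1) ≤ |N j ⬝ᵥ v.1| := ht
      have : (0 : ℝ) < 1 / (k + 1) := by positivity
      linarith
  rw [heq]
  exact (MeasurableSet.iUnion fun k => (isClosedMap_fst_of_compactSpace _ (hF k)).measurableSet).compl

theorem measurableSet_opBound {ι : Type*} [Fintype ι] {n : ℕ} (a : ℝ) :
    MeasurableSet {N : ι → Fin n → ℝ | OpBound N a} := by
  simp only [OpBound, Set.ofPred_forall]
  refine (isClosed_iInter fun x => isClosed_le ?_ continuous_const).measurableSet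
  refine continuous_l2.comp ?_
  unfold app dotProduct
  fun_prop

theorem exists_l2_eq_one_app_eq_zero {m : ℕ} (N : Fin m → Fin (m + 1) → ℝ) :
    ∃ v, l2 v = 1 ∧ app N v = 0 := by
  have h := LinearMap.ker_ne_bot_of_finrank_lt (f := Matrix.mulVecLin (Matrix.of N)) (by simp)
  obtain ⟨w, hw, hw0⟩ := (Submodule.ne_bot_iff _).mp h
  have hw : app N w = 0 := by
    ext i; exact congrFun (LinearMap.mem_ker.mp hw) i
  have hpos : 0 < l2 w := by
    rw [l2_eq_norm]; exact norm_pos_iff.mpr (by simpa using hw0)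
  refine ⟨(l2 w)⁻¹ • w, ?_, by rw [app_smul, hw, smul_zero]⟩
  rw [l2_smul, abs_of_pos (by positivity), inv_mul_cancel₀ hpos.ne']

theorem OpBound.comp_injective {ι ι' : Type*} [Fintype ι] [Fintype ι'] {n : ℕ} {N : ι → Fin n → ℝ}
    {a : ℝ} (h : OpBound N a) {f : ι' → ι} (hf : Function.Injective f) :
    OpBound (fun i => N (f i)) a := by
  intro x
  refine le_trans ?_ (h x)
  refine Real.sqrt_le_sqrt ?_
  calc ∑ i, app (fun i => N (f i)) x i ^ 2 = ∑ i ∈ Finset.univ.map ⟨f, hf⟩, app N x i ^ 2 := by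
        rw [Finset.sum_map]; rfl
    _ ≤ _ := Finset.sum_le_sum_of_subset_of_nonneg (Finset.subset_univ _) fun _ _ _ => sq_nonneg _

/-- Condition on the rows other than the j-th. They have a unit null vector, which then does not
depend on row `j`, and closeness applied to this vector is a small ball event, of probability at
most `β` unless the other rows are bad. Fubini concludes. -/
theorem matLaw_closeRow_le {m : ℕ} (ν : Measure ℝ) [IsProbabilityMeasure ν] (d : Fin (m + 1) → ℝ)
    (j : Fin (m + 1)) (a t : ℝ) {β q : ℝ} (hβ : 0 ≤ β)
    (hbad : (matLaw ν j.succAbove fun i => d (j.succAbove i)).real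
      {N | OpBound N a ∧ ¬ ∀ x, l2 x = 1 → app N x = 0 →
        (rowLaw ν j (d j)).real {X | |X ⬝ᵥ x| ≤ t} ≤ β} ≤ q) :
    (matLaw ν id d).real {N | OpBound N a ∧ CloseRow t j N} ≤ β + q := by
  set law := matLaw ν j.succAbove fun i => d (j.succAbove i) with hlaw
  set bad := {N : Fin m → Fin (m + 1) → ℝ | OpBound N a ∧ ¬ ∀ x, l2 x = 1 → app N x = 0 →
        (rowLaw ν j (d j)).real {X | |X ⬝ᵥ x| ≤ t} ≤ β} with hbaddef
  have hmp := measurePreserving_piFinSuccAbove (α := fun _ : Fin (m + 1) => Fin (m + 1) → ℝ)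
    (fun i => rowLaw ν i (d i)) j
  set e := MeasurableEquiv.piFinSuccAbove (fun _ : Fin (m + 1) => Fin (m + 1) → ℝ) j with he
  set S := {N : Fin (m + 1) → Fin (m + 1) → ℝ | OpBound N a ∧ CloseRow t j N} with hS
  have hSm : MeasurableSet S := (measurableSet_opBound a).inter (measurableSet_closeRow t j)
  -- Measurability of the bad set has not been established, so it is replaced by its measurable hull
  -- of the same measure.
  set P := e.symm ⁻¹' S ∩ Prod.snd ⁻¹' (toMeasurable law bad)ᶜ with hP
  have hPm : MeasurableSet P := (e.symm.measurable hSm).inter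
    (measurable_snd (measurableSet_toMeasurable _ _).compl)
  have hlaw' : matLaw ν id d = Measure.pi fun i => rowLaw ν i (d i) := rfl
  have hmain : ((rowLaw ν j (d j)).prod law) P ≤ ENNReal.ofReal β := by
    rw [Measure.prod_apply_symm hPm]
    refine (lintegral_mono (g := fun _ => ENNReal.ofReal β) fun N => ?_).trans (by simp)
    -- The norm bound for the remaining rows is inherited from any completion X₀; without a
    -- completion the slice is empty.
    by_cases hne : ∃ X, (X, N) ∈ P
    · obtain ⟨X₀, ⟨hX₀, hX₀'⟩, hN⟩ := hne
      have hN : N ∉ bad := fun h => hN (subset_toMeasurable _ _ h)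
      have hop : OpBound N a := by
        have h1 := OpBound.comp_injective hX₀ (f := j.succAbove) Fin.succAbove_right_injective
        convert h1 using 2 with i
        simp [he]
      obtain ⟨v, hv, hNv⟩ := exists_l2_eq_one_app_eq_zero N
      have hsb : (rowLaw ν j (d j)).real {X | |X ⬝ᵥ v| ≤ t} ≤ β := by
        by_contra hcon
        exact hN ⟨hop, fun hall => hcon (hall v hv hNv)⟩
      refine (measure_mono (t := {X | |X ⬝ᵥ v| ≤ t}) ?_).trans ?_
      · rintro X ⟨⟨-, hX⟩, -⟩
        have h1 := hX v hv fun i hi => by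
          obtain ⟨l, rfl⟩ := Fin.exists_succAbove_eq hi
          have h2 : N l ⬝ᵥ v = 0 := congrFun hNv l
          simpa [he] using h2
        simpa [he] using h1
      · rw [← ENNReal.ofReal_toReal (measure_ne_top (rowLaw ν j (d j)) _)]
        exact ENNReal.ofReal_le_ofReal hsb
    · have : (fun X => (X, N)) ⁻¹' P = ∅ := by
        ext X; simpa using fun h => hne ⟨X, h⟩
      rw [this]; simp
  have hsub : S ⊆ e ⁻¹' (P ∪ Prod.snd ⁻¹' (toMeasurable law bad)) := by
    intro N hN
    by_cases h : (e N).2 ∈ toMeasurable law bad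
    · exact Or.inr h
    · exact Or.inl ⟨by simpa using hN, h⟩
  have hmeas : (matLaw ν id d) S ≤ ENNReal.ofReal β + law bad := by
    refine (measure_mono hsub).trans ?_
    rw [hlaw', hmp.measure_preimage_equiv]
    refine (measure_union_le _ _).trans (add_le_add hmain ?_)
    have : Prod.snd ⁻¹' (toMeasurable law bad) =
      (Set.univ : Set (Fin (m + 1) → ℝ)) ×ˢ (toMeasurable law bad) := by ext; simp
    rw [this]
    refine (Measure.prod_prod _ _).le.trans ?_
    rw [measure_univ, one_mul]
    exact (measure_toMeasurable bad).le
  have h3 := ENNReal.toReal_mono (by finiteness) hmeas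
  rw [ENNReal.toReal_add (by finiteness) (by finiteness), ENNReal.toReal_ofReal hβ] at h3
  exact h3.trans (add_le_add le_rfl hbad)

/-! ### From almost null vectors to close columns. -/

/-- Markov's inequality for the number of events that occur. -/
theorem measureReal_le_card_le {X : Type*} [MeasurableSpace X] (μ : Measure X) [IsFiniteMeasure μ]
    {ι : Type*} [Fintype ι] (E : ι → Set X) (hE : ∀ j, MeasurableSet (E j)) (s : X → Finset ι)
    (hs : ∀ x, ∀ j ∈ s x, x ∈ E j) (a : ℝ) :
    a * μ.real {x | a ≤ (s x).card} ≤ ∑ j, μ.real (E j) := by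
  have h1 := mul_meas_ge_le_integral_of_nonneg (μ := μ)
    (f := fun x => ∑ j, (E j).indicator (fun _ => (1 : ℝ)) x)
    (Filter.Eventually.of_forall fun x => Finset.sum_nonneg fun j _ =>
      Set.indicator_nonneg (fun _ _ => zero_le_one) x)
    (integrable_finsetSum _ fun j _ => (integrable_const _).indicator (hE j)) a
  rw [integral_finsetSum _ fun j _ => (integrable_const _).indicator (hE j)] at h1
  simp only [integral_indicator_const _ (hE _), smul_eq_mul,
    mul_one] at h1
  by_cases ha : 0 ≤ a
  · refine le_trans ?_ h1
    refine mul_le_mul_of_nonneg_left (measureReal_mono fun x hx => ?_) ha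
    refine le_trans (show a ≤ (s x).card from hx) ?_
    calc ((s x).card : ℝ) = ∑ j ∈ s x, (E j).indicator (fun _ => (1 : ℝ)) x := by
          rw [Finset.sum_congr rfl fun j hj => Set.indicator_of_mem (hs x j hj) _]
          simp
      _ ≤ _ := Finset.sum_le_sum_of_subset_of_nonneg (Finset.subset_univ _) fun j _ _ =>
          Set.indicator_nonneg (fun _ _ => zero_le_one) x
  · exact (mul_nonpos_of_nonpos_of_nonneg (not_le.mp ha).le measureReal_nonneg).trans
      (Finset.sum_nonneg fun _ _ => measureReal_nonneg)

/-- Pairing the image of x with a unit vector orthogonal to all columns but the j-th leaves x_j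
times the product with that column; Cauchy–Schwarz bounds the pairing by τ. -/
theorem closeRow_transpose_of_l2_app_le {n : ℕ} (M : Fin n → Fin n → ℝ) (x : Fin n → ℝ)
    {τ θ : ℝ} (hθ : 0 < θ) (hMx : l2 (app M x) ≤ τ) {j : Fin n} (hj : θ ≤ |x j|) :
    CloseRow (τ / θ) j fun i k => M k i := by
  intro v hv hN
  have h1 : app M x ⬝ᵥ v = x j * ((fun k => M k j) ⬝ᵥ v) := by
    have h2 : app M x ⬝ᵥ v = ∑ i, x i * ((fun k => M k i) ⬝ᵥ v) := by
      simp only [app, dotProduct, Finset.sum_mul, Finset.mul_sum]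
      rw [Finset.sum_comm]
      exact Finset.sum_congr rfl fun i _ => Finset.sum_congr rfl fun k _ => by ring
    rw [h2, Finset.sum_eq_single j]
    · intro i _ hi; rw [hN i hi, mul_zero]
    · simp
  have h3 : |app M x ⬝ᵥ v| ≤ τ := by
    have h4 := Finset.sum_mul_sq_le_sq_mul_sq Finset.univ (app M x) v
    rw [← l2_sq, ← l2_sq, hv, one_pow, mul_one] at h4
    exact (abs_le_of_sq_le_sq h4 (l2_nonneg _)).trans hMx
  rw [h1, abs_mul] at h3
  rw [le_div_iff₀ hθ]
  calc _ ≤ |(fun k => M k j) ⬝ᵥ v| * |x j| := by gcongr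
    _ ≤ τ := by linarith

/-- An almost null vector makes at least an columns close, which Markov makes unlikely. The
largeness of coordinates concerns A and the closeness of columns its transpose, hence the hypotheses
that both have the same law. -/
theorem exists_almostNull_le {κ B K : ℝ} (hκ : 0 < κ) (hκ1 : κ ≤ 1) (hB : 1 ≤ B) (hK : 1 ≤ K) :
    ∃ c c' C C₀ : ℝ, 0 < c ∧ 0 < c' ∧ 0 < C ∧ 0 < C₀ ∧
      ∀ (p : ℝ), 0 < p → p ≤ 1 → ∀ ν : Measure ℝ, SparseLaw ν p κ B →
      ∀ (n : ℕ), C₀ ≤ n * p → C₀ * Real.log n ≤ n * p →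
      ∀ (Ω : Type*) [MeasurableSpace Ω] (μ : Measure Ω) [IsProbabilityMeasure μ]
        (A : Ω → Fin n → Fin n → ℝ) (d : Fin n → ℝ), Measurable A →
        μ.map A = matLaw ν id d → μ.map (fun ω i j => A ω j i) = matLaw ν id d →
      ∀ ε : ℝ, 0 < ε →
        μ.real {ω | OpBound (A ω) (K * √(n * p)) ∧ OpBound (fun i j => A ω j i) (K * √(n * p)) ∧
          ∃ x, l2 x = 1 ∧ l2 (app (A ω) x) ≤
            C * ε * Real.exp (-c * (Real.log (1 / p) / Real.log (n * p))) * √(p / n)} ≤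
          ε + Real.exp (-c' * (n * p)) := by
  obtain ⟨a, b, c₁, C₁, ha, hb, hc₁, hlarge⟩ := exists_matLaw_few_large_le hκ hκ1 hB hK
  obtain ⟨D, c₂, C₂, hD, hc₂, hball⟩ := exists_matLaw_not_smallBall_le hκ hκ1 hB hK
  have hLoss := one_le_stepLoss (K := K) hκ
  set Cs := stepLoss K κ with hCs
  have hlogC : 0 ≤ Real.log Cs := Real.log_nonneg hLoss
  set W := Real.exp (6 * Real.log Cs) with hW
  have hW0 : 0 < W := Real.exp_pos _
  -- Two factors ρ are lost, one in the size ρ/√n of the large coordinates and one in the small ball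
  -- estimate; `W` collects the part of ρ⁻² not depending on p and T, and the summand 1 keeps `c`
  -- positive.
  set c := 8 * Real.log Cs + 1 with hc
  set c₃ := min c₁ c₂ with hc₃
  have hc₃0 : 0 < c₃ := by positivity
  -- The first entry makes the small ball term aε for each column, which becomes ε after division by
  -- the proportion a; the second keeps τ below the threshold for almost null vectors.
  set C := min (a ^ 2 / (D * W)) (b / W) with hC
  have hC0 : 0 < C := by positivity
  refine ⟨c, c₃ / 2, C, max (max C₁ C₂) (max 3 (2 * (2 / a + 1) / c₃)), by positivity,
    by positivity, hC0, by positivity, ?_⟩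
  intro p hp hp1 ν hν n hT hTlog Ω _ μ _ A d hA hlaw hlawT ε hε
  have := hν.prob
  set T := n * p with hTdef
  have hT1 : C₁ ≤ T := ((le_max_left _ _).trans (le_max_left _ _)).trans hT
  have hT2 : C₂ ≤ T := ((le_max_right _ _).trans (le_max_left _ _)).trans hT
  have hT3 : 3 ≤ T := ((le_max_left _ _).trans (le_max_right _ _)).trans hT
  have hT4 : 2 * (2 / a + 1) / c₃ ≤ T := ((le_max_right _ _).trans (le_max_right _ _)).trans hT
  have hT0 : 0 < T := by linarith
  have hn0 : (0 : ℝ) < n := by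
    by_contra h0
    have : (n : ℝ) * p ≤ 0 := mul_nonpos_of_nonpos_of_nonneg (not_lt.mp h0) hp.le
    linarith
  have hlogn : 0 ≤ Real.log n := Real.log_natCast_nonneg n
  have hlog1 : C₁ * Real.log n ≤ T := (mul_le_mul_of_nonneg_right
    ((le_max_left _ _).trans (le_max_left _ _)) hlogn).trans hTlog
  have hlog2 : C₂ * Real.log n ≤ T := (mul_le_mul_of_nonneg_right
    ((le_max_right _ _).trans (le_max_left _ _)) hlogn).trans hTlog
  rcases le_or_gt 1 ε with hε1 | hε1
  · exact measureReal_le_one.trans (by linarith [Real.exp_pos (-(c₃ / 2) * T)])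
  set Λ := Real.log (1 / p) / Real.log T with hΛ
  have hΛ0 : 0 ≤ Λ := div_nonneg (Real.log_nonneg (by rw [le_div_iff₀ hp]; linarith))
    (Real.log_nonneg (by linarith))
  set ρ := spreadLevel Cs p T with hρ
  have hρ0 : 0 < ρ := spreadLevel_pos _ _ _
  have hρ1 : ρ ≤ 1 := by
    rw [hρ, spreadLevel, Real.exp_le_one_iff, neg_nonpos]
    positivity
  set E := Real.exp (-c * Λ) with hE
  have hE0 : 0 < E := Real.exp_pos _
  have hEρ : E ≤ W * ρ ^ 2 := by
    rw [hρ, spreadLevel, ← Real.exp_nat_mul, hW, ← Real.exp_add, hE, Real.exp_le_exp, hc, ← hΛ]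
    push_cast
    linarith
  set τ := C * ε * E * √(p / n) with hτ
  have hsn : 0 < √(n : ℝ) := Real.sqrt_pos.mpr hn0
  have hsp : 0 < √p := Real.sqrt_pos.mpr hp
  have hsqrt : √(p / n) = √p / √n := Real.sqrt_div hp.le _
  have hτ0 : 0 ≤ τ := by positivity
  have hCW : C * W ≤ b := by
    calc C * W ≤ b / W * W := by gcongr; exact min_le_right _ _
      _ = b := by field_simp
  have hn1 : (1 : ℝ) ≤ n := by
    have : 0 < n := by exact_mod_cast hn0
    exact_mod_cast this
  have hτb : τ ≤ b * ρ * √T := by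
    have h1 : √(p / n) ≤ √T := by
      refine Real.sqrt_le_sqrt ?_
      rw [div_le_iff₀ hn0, hTdef]
      have h2 : 1 * 1 ≤ (n : ℝ) * n := mul_le_mul hn1 hn1 zero_le_one hn0.le
      calc p = 1 * 1 * p := by ring
        _ ≤ n * n * p := by gcongr
        _ = _ := by ring
    have h3 : C * ε * E ≤ b * ρ := by
      calc C * ε * E ≤ C * 1 * (W * ρ ^ 2) := by gcongr
        _ = C * W * (ρ * ρ) := by ring
        _ ≤ b * (ρ * 1) := by gcongr
        _ = b * ρ := by ring
    exact mul_le_mul h3 h1 (Real.sqrt_nonneg _) (by positivity)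
  set θ := a * ρ / √n with hθ
  have hθ0 : 0 < θ := by positivity
  set t := τ / θ with ht
  have ht0 : 0 ≤ t := by positivity
  have hmain : D * (t / (ρ * √p)) ≤ a * ε := by
    have h1 : D * (t / (ρ * √p)) = D * C * ε * (E / ρ ^ 2) / a := by
      rw [ht, hτ, hθ, hsqrt]; field_simp
    have h2 : E / ρ ^ 2 ≤ W := by rw [div_le_iff₀ (by positivity)]; exact hEρ
    have h3 : C * (D * W) ≤ a ^ 2 := by
      calc C * (D * W) ≤ a ^ 2 / (D * W) * (D * W) := by gcongr; exact min_le_left _ _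
        _ = _ := by field_simp
    rw [h1, div_le_iff₀ ha]
    calc D * C * ε * (E / ρ ^ 2) ≤ D * C * ε * W := by gcongr
      _ = C * (D * W) * ε := by ring
      _ ≤ a ^ 2 * ε := by gcongr
      _ = _ := by ring
  have hrow : ∀ j, (matLaw ν id d).real {N | OpBound N (K * √T) ∧ CloseRow t j N} ≤
      a * ε + 2 * Real.exp (-c₂ * T) := by
    intro j
    obtain ⟨m, rfl⟩ : ∃ m, n = m + 1 := ⟨n - 1, by have : 0 < n := by exact_mod_cast hn0
                                                   omega⟩
    have h1 := matLaw_closeRow_le ν d j (K * √T) t (β := D * (t / (ρ * √p)) + Real.exp (-c₂ * T))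
      (q := Real.exp (-c₂ * T)) (by positivity) ?_
    · linarith
    · refine (measureReal_mono ?_).trans (hball p hp hp1 ν hν (m + 1) hT2 hlog2 (Fin m)
        j.succAbove (fun i => d (j.succAbove i)) Fin.succAbove_right_injective (by simp))
      rintro N ⟨h2, h3⟩
      exact ⟨h2, fun h4 => h3 fun x hx hNx => h4 x hx hNx j (d j) t ht0⟩
  set Ej : Fin n → Set (Fin n → Fin n → ℝ) := fun j =>
    {N | OpBound N (K * √T) ∧ CloseRow t j N} with hEj
  classical
  set cnt : (Fin n → Fin n → ℝ) → Finset (Fin n) := fun N =>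
    Finset.univ.filter fun j => N ∈ Ej j with hcnt
  have hmarkov : (matLaw ν id d).real {N | a * n ≤ (cnt N).card} ≤
      ε + 2 / a * Real.exp (-c₂ * T) := by
    have h1 := measureReal_le_card_le (matLaw ν id d) Ej
      (fun j => (measurableSet_opBound _).inter (measurableSet_closeRow t j)) cnt
      (fun N j hj => (Finset.mem_filter.mp hj).2) (a * n)
    have h2 : ∑ j, (matLaw ν id d).real (Ej j) ≤ n * (a * ε + 2 * Real.exp (-c₂ * T)) := by
      refine (Finset.sum_le_sum fun j _ => hrow j).trans (le_of_eq ?_)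
      rw [Finset.sum_const, Finset.card_univ, Fintype.card_fin, nsmul_eq_mul]
    have h3 := h1.trans h2
    rw [← le_div_iff₀' (by positivity)] at h3
    refine h3.trans (le_of_eq ?_)
    field_simp
  have hlargeId := hlarge p hp hp1 ν hν n hT1 hlog1 (Fin n) id d Function.injective_id (by simp)
  have hAT : Measurable fun ω i j => A ω j i := by
    refine measurable_pi_lambda _ fun i => measurable_pi_lambda _ fun j => ?_
    exact (measurable_pi_apply i).comp ((measurable_pi_apply j).comp hA)
  have hpull : ∀ {f : Ω → Fin n → Fin n → ℝ} (hf : Measurable f)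
      (hmap : μ.map f = matLaw ν id d) (s : Set (Fin n → Fin n → ℝ)),
      μ.real (f ⁻¹' s) ≤ (matLaw ν id d).real s := by
    intro f hf hmap s
    refine ENNReal.toReal_mono (measure_ne_top _ _) ?_
    rw [← hmap]
    exact Measure.le_map_apply hf.aemeasurable s
  refine (measureReal_mono ?_ (measure_ne_top _ _)).trans ((measureReal_union_le _ _).trans
    ((add_le_add ((hpull hA hlaw _).trans hlargeId) ((hpull hAT hlawT _).trans hmarkov)).trans ?_))
  · rintro ω ⟨hop, hopT, x, hx, hAx⟩
    by_contra hcon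
    rw [Set.mem_union, not_or] at hcon
    obtain ⟨h1, h2⟩ := hcon
    refine h1 ⟨hop, fun hall => h2 ?_⟩
    refine (hall x hx (hAx.trans hτb)).trans ?_
    refine Nat.cast_le.mpr (Finset.card_le_card fun j hj => ?_)
    refine Finset.mem_filter.mpr ⟨Finset.mem_univ _, hopT, ?_⟩
    exact closeRow_transpose_of_l2_app_le (A ω) x hθ0 hAx (Finset.mem_filter.mp hj).2
  · have h1 : Real.exp (-c₁ * T) ≤ Real.exp (-c₃ * T) := by
      refine Real.exp_le_exp.mpr ?_
      have : c₃ * T ≤ c₁ * T := mul_le_mul_of_nonneg_right (min_le_left _ _) hT0.le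
      linarith
    have h2 : Real.exp (-c₂ * T) ≤ Real.exp (-c₃ * T) := by
      refine Real.exp_le_exp.mpr ?_
      have : c₃ * T ≤ c₂ * T := mul_le_mul_of_nonneg_right (min_le_right _ _) hT0.le
      linarith
    have h3 : 2 / a + 1 ≤ Real.exp (c₃ / 2 * T) := by
      rw [div_le_iff₀ hc₃0] at hT4
      linarith [Real.add_one_le_exp (c₃ / 2 * T)]
    have h4 : 2 / a * Real.exp (-c₂ * T) ≤ 2 / a * Real.exp (-c₃ * T) := by gcongr
    have h5 : (2 / a + 1) * Real.exp (-c₃ * T) ≤ Real.exp (-(c₃ / 2) * T) := by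
      calc _ ≤ Real.exp (c₃ / 2 * T) * Real.exp (-c₃ * T) := by gcongr
        _ = _ := by rw [← Real.exp_add]; congr 1; ring
    linarith

/-! ### The law of the random matrix -/

section law

variable {Ω : Type*} [MeasurableSpace Ω] {μ : Measure Ω}

/-- Grouping an independent family indexed by pairs along the first index. -/
theorem iIndepFun_curry {ι κ : Type*} [Fintype ι] [Fintype κ] {X : ι → κ → Ω → ℝ}
    (hX : ∀ i j, Measurable (X i j)) (h : iIndepFun (fun q : ι × κ => X q.1 q.2) μ) :
    iIndepFun (fun i ω j => X i j ω) μ := by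
  have := h.isProbabilityMeasure
  have hp : ∀ i j, IsProbabilityMeasure (μ.map (X i j)) :=
    fun i j => Measure.isProbabilityMeasure_map (hX i j).aemeasurable
  have hrow : ∀ i, μ.map (fun ω j => X i j ω) = Measure.infinitePi fun j => μ.map (X i j) := by
    intro i
    have h1 : iIndepFun (fun j => X i j) μ :=
      h.precomp (g := fun j => (i, j)) (fun j j' hj => by simpa using hj)
    exact (iIndepFun_iff_map_fun_eq_infinitePi_map (hX i)).1 h1
  rw [iIndepFun_iff_map_fun_eq_infinitePi_map (fun i => measurable_pi_lambda _ (hX i))]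
  simp only [hrow]
  rw [← Measure.infinitePi_map_curry (fun i j => μ.map (X i j)),
    ← (iIndepFun_iff_map_fun_eq_infinitePi_map (fun q : ι × κ => hX q.1 q.2)).1 h,
    Measure.map_map (MeasurableEquiv.measurable _)
      (measurable_pi_lambda _ fun q : ι × κ => hX q.1 q.2)]
  rfl

/-- An independent family stays independent when constants are added to it. -/
theorem iIndepFun_dite_const {ι : Type*} [Fintype ι] {P : ι → Prop} [DecidablePred P]
    {f : {q // P q} → Ω → ℝ} (hf : ∀ q, Measurable (f q)) (h : iIndepFun f μ) (c : ι → ℝ) :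
    iIndepFun (fun q ω => if hq : P q then f ⟨q, hq⟩ ω else c q) μ := by
  have := h.isProbabilityMeasure
  have hg : ∀ q, Measurable fun ω => if hq : P q then f ⟨q, hq⟩ ω else c q := by
    intro q
    by_cases hq : P q
    · simpa [hq] using hf ⟨q, hq⟩
    · simp [hq]
  rw [iIndepFun_iff_map_fun_eq_pi_map fun q => (hg q).aemeasurable]
  have : ∀ q, IsProbabilityMeasure (μ.map fun ω => if hq : P q then f ⟨q, hq⟩ ω else c q) :=
    fun q => Measure.isProbabilityMeasure_map (hg q).aemeasurable
  refine (Measure.pi_eq fun s hs => ?_).symm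
  rw [Measure.map_apply (measurable_pi_lambda _ hg) (MeasurableSet.univ_pi hs),
    ← Fintype.prod_subtype_mul_prod_subtype P]
  have h1 : ∀ q : {q // P q}, (μ.map fun ω => if hq : P q then f ⟨q, hq⟩ ω else c q) (s q) =
      μ (f q ⁻¹' s q) := by
    intro q
    rw [Measure.map_apply (hg q) (hs q)]
    congr 1
    ext ω
    simp [q.2]
  classical
  have h2 : ∀ q : {q // ¬ P q}, (μ.map fun ω => if hq : P q then f ⟨q, hq⟩ ω else c q) (s q) =
      if c q ∈ s q then 1 else 0 := by
    intro q
    rw [Measure.map_apply (hg q) (hs q)]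
    by_cases hc : c q ∈ s q
    · simp [q.2, hc]
    · simp [q.2, hc]
  simp only [h1, h2]
  rw [← h.meas_iInter fun q => ⟨s q, hs q, rfl⟩]
  by_cases hc : ∀ q : {q // ¬ P q}, c q ∈ s q
  · simp only [hc, if_true, Finset.prod_const_one, mul_one]
    congr 1
    ext ω
    simp only [Set.mem_preimage, Set.mem_univ_pi, Set.mem_iInter, Subtype.forall]
    constructor
    · intro h3 q hq
      simpa [hq] using h3 q
    · intro h3 q
      by_cases hq : P q
      · simpa [hq] using h3 q hq
      · simpa [hq] using hc ⟨q, hq⟩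
  · push Not at hc
    obtain ⟨q, hq⟩ := hc
    rw [Finset.prod_eq_zero (Finset.mem_univ q) (by simp [hq]), mul_zero]
    convert measure_empty (μ := μ)
    ext ω
    simp only [Set.mem_preimage, Set.mem_univ_pi, Set.mem_empty_iff_false, iff_false, not_forall]
    exact ⟨q, by simpa [q.2] using hq⟩

theorem map_eq_matLaw {n : ℕ} {ν : Measure ℝ} {d : Fin n → ℝ} {X : Fin n → Fin n → Ω → ℝ}
    (hX : ∀ i j, Measurable (X i j)) (h : iIndepFun (fun q : Fin n × Fin n => X q.1 q.2) μ)
    (hlaw : ∀ i j, μ.map (X i j) = entryLaw ν i (d i) j) :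
    μ.map (fun ω i j => X i j ω) = matLaw ν id d := by
  have := h.isProbabilityMeasure
  rw [(iIndepFun_curry hX h).map_fun_eq_pi_map
    fun i => (measurable_pi_lambda _ (hX i)).aemeasurable, matLaw]
  congr 1
  ext1 i
  have h1 : iIndepFun (fun j => X i j) μ :=
    h.precomp (g := fun j => (i, j)) (fun j j' hj => by simpa using hj)
  rw [h1.map_fun_eq_pi_map fun j => (hX i j).aemeasurable, rowLaw]
  congr 1
  ext1 j
  exact hlaw i j

/-- Reindex the joint family by pairs of a position and a Boolean, group it by position, and
multiply within each group. -/
theorem iIndepFun_mul_of_sum_elim {E : Type*} [Fintype E] {δ ξ : E → Ω → ℝ}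
    (hδ : ∀ e, Measurable (δ e)) (hξ : ∀ e, Measurable (ξ e)) (h : iIndepFun (Sum.elim δ ξ) μ) :
    iIndepFun (fun e ω => δ e ω * ξ e ω) μ := by
  let X : E → Bool → Ω → ℝ := fun e b => if b then δ e else ξ e
  have hX : ∀ e b, Measurable (X e b) := by
    rintro e (_ | _)
    · exact hξ e
    · exact hδ e
  have h1 : iIndepFun (fun q : E × Bool => X q.1 q.2) μ := by
    have h2 := h.precomp (g := fun q : E × Bool => if q.2 then Sum.inl q.1 else Sum.inr q.1) (by
      rintro ⟨e, _ | _⟩ ⟨e', _ | _⟩ he <;> simp_all)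
    convert h2 using 1
    ext ⟨e, _ | _⟩ ω <;> simp [X]
  exact (iIndepFun_curry hX h1).comp (fun _ x => x true * x false) fun _ =>
    (measurable_pi_apply _).mul (measurable_pi_apply _)

/-- The law of the product of a Bernoulli variable of parameter `p` and an independent variable of
law `lam`. -/
noncomputable def sparsify (p : ℝ) (lam : Measure ℝ) : Measure ℝ :=
  ENNReal.ofReal p • lam + ENNReal.ofReal (1 - p) • Measure.dirac 0

theorem map_mul_bernoulli_prod (q : unitInterval) (lam : Measure ℝ) [IsProbabilityMeasure lam] :
    ((bernoulliMeasure (1 : ℝ) 0 q).prod lam).map (fun z => z.1 * z.2) = sparsify q lam := by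
  have h0 : Measurable fun z : ℝ × ℝ => z.1 * z.2 := by fun_prop
  ext s hs
  have hs' := h0 hs
  rw [Measure.map_apply h0 hs, bernoulliMeasure_def, Measure.prod_apply hs', sparsify]
  simp only [lintegral_add_measure, lintegral_smul_measure, Measure.add_apply, Measure.smul_apply]
  have h1 : Measurable fun x : ℝ => lam (Prod.mk x ⁻¹' ((fun z : ℝ × ℝ => z.1 * z.2) ⁻¹' s)) :=
    measurable_measure_prodMk_left hs'
  rw [lintegral_dirac' _ h1, lintegral_dirac' _ h1]
  have h2 : ENNReal.ofReal q = (unitInterval.toNNReal q : ENNReal) := by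
    rw [ENNReal.ofReal]; congr 1; exact Real.toNNReal_of_nonneg q.2.1
  have h3 : ENNReal.ofReal (1 - q) = (unitInterval.toNNReal (unitInterval.symm q) : ENNReal) := by
    rw [ENNReal.ofReal]; congr 1; exact Real.toNNReal_of_nonneg (unitInterval.symm q).2.1
  rw [h2, h3]
  congr 1
  · congr 2
    ext; simp
  · congr 1
    by_cases h : (0 : ℝ) ∈ s
    · have : Prod.mk (0 : ℝ) ⁻¹' ((fun z : ℝ × ℝ => z.1 * z.2) ⁻¹' s) = Set.univ := by
        ext; simp [h]
      rw [this, measure_univ, Measure.dirac_apply_of_mem h]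
    · have : Prod.mk (0 : ℝ) ⁻¹' ((fun z : ℝ × ℝ => z.1 * z.2) ⁻¹' s) = ∅ := by
        ext; simp [h]
      rw [this, measure_empty, Measure.dirac_apply' _ hs]
      simp [h]

theorem map_mul_eq_sparsify (q : unitInterval) [IsProbabilityMeasure μ] {δ ξ : Ω → ℝ}
    (hδ : Measurable δ) (hξ : Measurable ξ) (h : IndepFun δ ξ μ)
    (hlaw : HasLaw δ (bernoulliMeasure (1 : ℝ) 0 q) μ) :
    μ.map (fun ω => δ ω * ξ ω) = sparsify q (μ.map ξ) := by
  have : IsProbabilityMeasure (μ.map ξ) := Measure.isProbabilityMeasure_map hξ.aemeasurable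
  have h1 : μ.map (fun ω => δ ω * ξ ω) = (μ.map fun ω => (δ ω, ξ ω)).map fun q => q.1 * q.2 := by
    rw [Measure.map_map (by fun_prop) (by fun_prop)]; rfl
  rw [h1, (indepFun_iff_map_prod_eq_prod_map_map hδ.aemeasurable hξ.aemeasurable).1 h, hlaw.map_eq,
    map_mul_bernoulli_prod]

end law

/-! ### The entry law of a sparse matrix -/

theorem sparsify_real_of_zero_notMem {lam : Measure ℝ} {p : ℝ} (hp : 0 ≤ p) {s : Set ℝ} (hs : MeasurableSet s)
    (h0 : (0 : ℝ) ∉ s) : (sparsify p lam).real s = p * lam.real s := by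
  rw [measureReal_def, sparsify, Measure.add_apply, Measure.smul_apply, Measure.smul_apply,
    Measure.dirac_apply' _ hs]
  simp [h0, measureReal_def, ENNReal.toReal_ofReal hp]

section entry

variable {lam : Measure ℝ} [IsProbabilityMeasure lam]

theorem isProbabilityMeasure_sparsify {p : ℝ} (hp : 0 ≤ p) (hp1 : p ≤ 1) :
    IsProbabilityMeasure (sparsify p lam) := by
  refine ⟨?_⟩
  simp only [sparsify, Measure.add_apply, Measure.smul_apply, measure_univ, smul_eq_mul, mul_one]
  rw [← ENNReal.ofReal_add hp (by linarith)]
  simp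

theorem charFun_sparsify {p : ℝ} (hp : 0 ≤ p) (hp1 : p ≤ 1) (s : ℝ) :
    charFun (sparsify p lam) s = p * charFun lam s + (1 - p) := by
  have hintg : ∀ (m : Measure ℝ) [IsFiniteMeasure m],
      Integrable (fun x : ℝ => Complex.exp (s * x * Complex.I)) m := fun m _ => by
    refine Integrable.mono' (integrable_const (1 : ℝ)) (by fun_prop)
      (Filter.Eventually.of_forall fun x => ?_)
    rw [← Complex.ofReal_mul, Complex.norm_exp_ofReal_mul_I]
  rw [charFun_apply_real, sparsify, integral_add_measure
    ((hintg lam).smul_measure ENNReal.ofReal_ne_top)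
    ((hintg (Measure.dirac 0)).smul_measure ENNReal.ofReal_ne_top), integral_smul_measure,
    integral_smul_measure, integral_dirac, ENNReal.toReal_ofReal hp,
    ENNReal.toReal_ofReal (by linarith), ← charFun_apply_real]
  simp

/-- Symmetrization: |φ|² is the characteristic function of the difference of two independent copies.
Evenness of the cosine permits the absolute value, so that the measure can later be supported on
positive numbers. -/
theorem one_sub_norm_charFun_sq (s : ℝ) :
    1 - ‖charFun lam s‖ ^ 2 = ∫ z : ℝ × ℝ, (1 - Real.cos (s * |z.1 - z.2|)) ∂lam.prod lam := by
  have hexp : Integrable (fun x : ℝ => Complex.exp (s * x * Complex.I)) lam := by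
    refine Integrable.mono' (integrable_const (1 : ℝ)) (by fun_prop)
      (Filter.Eventually.of_forall fun x => ?_)
    rw [← Complex.ofReal_mul, Complex.norm_exp_ofReal_mul_I]
  have hcos : Integrable (fun x : ℝ => Real.cos (s * x)) lam :=
    Integrable.mono' (integrable_const (1 : ℝ)) (by fun_prop)
      (Filter.Eventually.of_forall fun x => Real.abs_cos_le_one _)
  have hsin : Integrable (fun x : ℝ => Real.sin (s * x)) lam :=
    Integrable.mono' (integrable_const (1 : ℝ)) (by fun_prop)
      (Filter.Eventually.of_forall fun x => Real.abs_sin_le_one _)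
  have hre : (charFun lam s).re = ∫ x, Real.cos (s * x) ∂lam := by
    rw [charFun_apply_real, ← RCLike.re_eq_complex_re, ← integral_re hexp]
    refine integral_congr_ae (Filter.Eventually.of_forall fun x => ?_)
    simp only [RCLike.re_eq_complex_re]
    rw [← Complex.ofReal_mul, Complex.exp_ofReal_mul_I_re]
  have him : (charFun lam s).im = ∫ x, Real.sin (s * x) ∂lam := by
    rw [charFun_apply_real, ← RCLike.im_eq_complex_im, ← integral_im hexp]
    refine integral_congr_ae (Filter.Eventually.of_forall fun x => ?_)
    simp only [RCLike.im_eq_complex_im]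
    rw [← Complex.ofReal_mul, Complex.exp_ofReal_mul_I_im]
  have h1 : ∀ z : ℝ × ℝ, 1 - Real.cos (s * |z.1 - z.2|) =
      1 - (Real.cos (s * z.1) * Real.cos (s * z.2) + Real.sin (s * z.1) * Real.sin (s * z.2)) := by
    intro z
    rw [← Real.cos_sub, ← mul_sub]
    rcases abs_cases (z.1 - z.2) with ⟨h, -⟩ | ⟨h, -⟩
    · rw [h]
    · rw [h, mul_neg, Real.cos_neg]
  have h2 : Integrable (fun z : ℝ × ℝ => Real.cos (s * z.1) * Real.cos (s * z.2) +
      Real.sin (s * z.1) * Real.sin (s * z.2)) (lam.prod lam) :=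
    (hcos.mul_prod hcos).add (hsin.mul_prod hsin)
  simp only [h1]
  rw [integral_sub (integrable_const _) h2,
    integral_add (hcos.mul_prod hcos) (hsin.mul_prod hsin),
    integral_prod_mul (fun x => Real.cos (s * x)) fun x => Real.cos (s * x),
    integral_prod_mul (fun x => Real.sin (s * x)) fun x => Real.sin (s * x),
    ← Complex.normSq_eq_norm_sq, Complex.normSq_apply, hre, him]
  simp

/-- The triangle inequality gives 1 - p(1 - |φ|), and 1 - |φ| ≥ (1 - |φ|²)/2. -/
theorem norm_charFun_sparsify_le {p : ℝ} (hp : 0 ≤ p) (hp1 : p ≤ 1) (s : ℝ) :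
    ‖charFun (sparsify p lam) s‖ ≤ Real.exp (-p * ((1 - ‖charFun lam s‖ ^ 2) / 2)) := by
  rw [charFun_sparsify hp hp1]
  set x := ‖charFun lam s‖ with hx
  have h1 : ‖(p : ℂ) * charFun lam s + (1 - p)‖ ≤ p * x + (1 - p) := by
    refine (norm_add_le _ _).trans ?_
    rw [norm_mul, Complex.norm_real, Real.norm_of_nonneg hp, ← Complex.ofReal_one,
      ← Complex.ofReal_sub, Complex.norm_real, Real.norm_of_nonneg (by linarith)]
  refine h1.trans ?_
  have h2 := Real.add_one_le_exp (-p * ((1 - x ^ 2) / 2))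
  have h3 : p * ((1 - x ^ 2) / 2) ≤ p * (1 - x) := by
    gcongr
    nlinarith [sq_nonneg (1 - x)]
  linarith

/-- A Paley–Zygmund argument by integrating a pointwise inequality: on the event, complete the
square with x² - 2M; off it, x² ≤ 1/4. -/
theorem le_measureReal_half_le_abs {M : ℝ} (hM : 1 ≤ M) (h4 : Integrable (fun x => x ^ 4) lam)
    (h2 : Integrable (fun x => x ^ 2) lam) (hvar : ∫ x, x ^ 2 ∂lam = 1)
    (hmom : ∫ x, x ^ 4 ∂lam ≤ M) : 1 / (2 * M) ≤ lam.real {x | 1 / 2 ≤ |x|} := by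
  have hs : MeasurableSet {x : ℝ | 1 / 2 ≤ |x|} := measurableSet_le (by fun_prop) (by fun_prop)
  have hM0 : 0 < M := by linarith
  have hpt : ∀ x : ℝ, x ^ 2 ≤ 1 / 4 + 1 / (4 * M) * x ^ 4 +
      {x : ℝ | 1 / 2 ≤ |x|}.indicator (fun _ => M) x := by
    intro x
    by_cases hx : x ∈ {x : ℝ | 1 / 2 ≤ |x|}
    · rw [Set.indicator_of_mem hx]
      have h5 : 0 ≤ (x ^ 2 - 2 * M) ^ 2 / (4 * M) := by positivity
      have h6 : (x ^ 2 - 2 * M) ^ 2 / (4 * M) = 1 / (4 * M) * x ^ 4 - x ^ 2 + M := by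
        field_simp; ring
      linarith
    · rw [Set.indicator_of_notMem hx]
      have hx : |x| < 1 / 2 := not_le.mp hx
      have h5 : 0 ≤ 1 / (4 * M) * x ^ 4 := by positivity
      have h6 := pow_le_pow_left₀ (abs_nonneg x) hx.le 2
      rw [sq_abs] at h6
      linarith
  have hi : Integrable ({x : ℝ | 1 / 2 ≤ |x|}.indicator fun _ => M) lam :=
    (integrable_const _).indicator hs
  have hr : Integrable (fun x : ℝ => 1 / 4 + 1 / (4 * M) * x ^ 4) lam :=
    (integrable_const _).add (h4.const_mul _)
  have h5 := integral_mono h2 (hr.add hi) hpt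
  have h6 : ∫ x, (1 / 4 + 1 / (4 * M) * x ^ 4 + {x : ℝ | 1 / 2 ≤ |x|}.indicator (fun _ => M) x) ∂lam
      = 1 / 4 + 1 / (4 * M) * ∫ x, x ^ 4 ∂lam + lam.real {x | 1 / 2 ≤ |x|} * M := by
    rw [integral_add hr hi,
      integral_add (integrable_const _) (h4.const_mul _), integral_const_mul,
      integral_indicator_const _ hs]
    simp
  have h7 : 1 / (4 * M) * ∫ x, x ^ 4 ∂lam ≤ 1 / 4 := by
    calc _ ≤ 1 / (4 * M) * M := by gcongr
      _ = 1 / 4 := by field_simp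
  rw [div_le_iff₀ (by positivity)]
  have h8 : 1 ≤ 1 / 4 + 1 / (4 * M) * ∫ x, x ^ 4 ∂lam + lam.real {x | 1 / 2 ≤ |x|} * M := by
    exact hvar.symm.le.trans (h5.trans h6.le)
  linarith

/-- The same method for u = x - x', of variance 2. The range |u| < 1 contributes at most 1, and for
|u| > 8√M the quadratic is dominated by u⁴/(32M), whose mean is at most 1/2; the remaining mass lies
in the window. -/
theorem le_measureReal_abs_sub_mem {M : ℝ} (hM : 1 ≤ M) (h4 : Integrable (fun x => x ^ 4) lam)
    (h2 : Integrable (fun x => x ^ 2) lam) (h1 : Integrable (fun x => x) lam)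
    (hmean : ∫ x, x ∂lam = 0) (hvar : ∫ x, x ^ 2 ∂lam = 1) (hmom : ∫ x, x ^ 4 ∂lam ≤ M) :
    1 / (32 * M) ≤ (lam.prod lam).real {z | |z.1 - z.2| ∈ Set.Icc 1 (8 * √M)} := by
  set G := {z : ℝ × ℝ | |z.1 - z.2| ∈ Set.Icc 1 (8 * √M)} with hG
  have hs : MeasurableSet G := (show Measurable fun z : ℝ × ℝ => |z.1 - z.2| by fun_prop)
    measurableSet_Icc
  have hM0 : 0 < M := by linarith
  have hpt : ∀ z : ℝ × ℝ, z.1 ^ 2 + z.2 ^ 2 - 2 * (z.1 * z.2) ≤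
      1 + 1 / (4 * M) * (z.1 ^ 4 + z.2 ^ 4) + G.indicator (fun _ => 16 * M) z := by
    intro z
    set u := z.1 - z.2 with hu
    have h5 : z.1 ^ 2 + z.2 ^ 2 - 2 * (z.1 * z.2) = u ^ 2 := by rw [hu]; ring
    have h6 : u ^ 4 ≤ 8 * (z.1 ^ 4 + z.2 ^ 4) := by
      have h7 : u ^ 2 ≤ 2 * (z.1 ^ 2 + z.2 ^ 2) := by rw [hu]; nlinarith [sq_nonneg (z.1 + z.2)]
      have h8 := pow_le_pow_left₀ (sq_nonneg u) h7 2
      nlinarith [sq_nonneg (z.1 ^ 2 - z.2 ^ 2)]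
    have h9 : 1 / (32 * M) * u ^ 4 ≤ 1 / (4 * M) * (z.1 ^ 4 + z.2 ^ 4) := by
      calc _ ≤ 1 / (32 * M) * (8 * (z.1 ^ 4 + z.2 ^ 4)) := by gcongr
        _ = _ := by field_simp; ring
    have h10 : 0 ≤ 1 / (32 * M) * u ^ 4 := by positivity
    rw [h5]
    by_cases hz : z ∈ G
    · rw [Set.indicator_of_mem hz]
      have h11 : 0 ≤ (u ^ 2 - 16 * M) ^ 2 / (32 * M) := by positivity
      have h12 : (u ^ 2 - 16 * M) ^ 2 / (32 * M) = 1 / (32 * M) * u ^ 4 - u ^ 2 + 8 * M := by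
        field_simp; ring
      linarith
    · rw [Set.indicator_of_notMem hz]
      rcases lt_or_ge |u| 1 with h11 | h11
      · have h12 := pow_le_pow_left₀ (abs_nonneg u) h11.le 2
        rw [sq_abs] at h12
        linarith
      · have h12 : 8 * √M < |u| := by
          by_contra hcon
          exact hz ⟨h11, not_lt.mp hcon⟩
        have h13 := pow_le_pow_left₀ (by positivity) h12.le 2
        rw [sq_abs, mul_pow, Real.sq_sqrt hM0.le] at h13
        have h14 : u ^ 2 ≤ 1 / (32 * M) * u ^ 4 := by
          rw [one_div_mul_eq_div, le_div_iff₀ (by positivity)]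
          nlinarith [sq_nonneg u]
        linarith
  have hi : Integrable (G.indicator fun _ => 16 * M) (lam.prod lam) :=
    (integrable_const _).indicator hs
  have hl' : Integrable (fun z : ℝ × ℝ => z.1 ^ 2 + z.2 ^ 2) (lam.prod lam) :=
    (h2.comp_fst lam).add (h2.comp_snd lam)
  have hl : Integrable (fun z : ℝ × ℝ => z.1 ^ 2 + z.2 ^ 2 - 2 * (z.1 * z.2)) (lam.prod lam) :=
    hl'.sub ((h1.mul_prod h1).const_mul 2)
  have hq : Integrable (fun z : ℝ × ℝ => z.1 ^ 4 + z.2 ^ 4) (lam.prod lam) :=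
    (h4.comp_fst lam).add (h4.comp_snd lam)
  have hr : Integrable (fun z : ℝ × ℝ => 1 + 1 / (4 * M) * (z.1 ^ 4 + z.2 ^ 4)) (lam.prod lam) :=
    (integrable_const _).add (hq.const_mul _)
  have h5 := integral_mono hl (hr.add hi) hpt
  have h6 : ∫ z : ℝ × ℝ, (z.1 ^ 2 + z.2 ^ 2 - 2 * (z.1 * z.2)) ∂lam.prod lam = 2 := by
    rw [integral_sub hl' ((h1.mul_prod h1).const_mul 2),
      integral_add (h2.comp_fst lam) (h2.comp_snd lam), integral_const_mul,
      integral_prod_mul (fun x : ℝ => x) fun x : ℝ => x, integral_fun_fst (fun x : ℝ => x ^ 2),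
      integral_fun_snd (fun x : ℝ => x ^ 2), hvar, hmean]
    simp; norm_num
  have h7 : ∫ z : ℝ × ℝ, (1 + 1 / (4 * M) * (z.1 ^ 4 + z.2 ^ 4) + G.indicator (fun _ => 16 * M) z)
      ∂lam.prod lam = 1 + 1 / (4 * M) * (2 * ∫ x, x ^ 4 ∂lam) + (lam.prod lam).real G * (16 * M) := by
    rw [integral_add hr hi,
      integral_add (integrable_const _) (hq.const_mul _), integral_const_mul,
      integral_indicator_const _ hs, integral_add (h4.comp_fst lam) (h4.comp_snd lam),
      integral_fun_fst (fun x : ℝ => x ^ 4), integral_fun_snd (fun x : ℝ => x ^ 4)]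
    simp only [integral_const, probReal_univ, smul_eq_mul, one_mul]
    ring
  have h8 : 1 / (4 * M) * (2 * ∫ x, x ^ 4 ∂lam) ≤ 1 / 2 := by
    calc _ ≤ 1 / (4 * M) * (2 * M) := by gcongr
      _ = 1 / 2 := by field_simp; norm_num
  rw [div_le_iff₀ (by positivity)]
  have h9 : 2 ≤ 1 + 1 / (4 * M) * (2 * ∫ x, x ^ 4 ∂lam) + (lam.prod lam).real G * (16 * M) := by
    exact h6.symm.le.trans (h5.trans h7.le)
  linarith

theorem sparseLaw_sparsify {M p : ℝ} (hp : 0 ≤ p) (hp1 : p ≤ 1) (hM : 1 ≤ M)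
    (h4 : Integrable (fun x => x ^ 4) lam) (h2 : Integrable (fun x => x ^ 2) lam)
    (h1 : Integrable (fun x => x) lam)
    (hmean : ∫ x, x ∂lam = 0) (hvar : ∫ x, x ^ 2 ∂lam = 1) (hmom : ∫ x, x ^ 4 ∂lam ≤ M) :
    SparseLaw (sparsify p lam) p (1 / (64 * M)) (8 * √M) where
  prob := isProbabilityMeasure_sparsify hp hp1
  nonzero_le := by
    rw [sparsify_real_of_zero_notMem hp (measurableSet_singleton _).compl (by simp)]
    exact mul_le_of_le_one_right hp measureReal_le_one
  le_large := by
    rw [sparsify_real_of_zero_notMem hp (measurableSet_le (by fun_prop) (by fun_prop))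
      (by norm_num), mul_comm]
    gcongr
    refine le_trans ?_ (le_measureReal_half_le_abs hM h4 h2 hvar hmom)
    gcongr
    norm_num
  norm_charFun_le := by
    set σ := (lam.prod lam).map fun z : ℝ × ℝ => |z.1 - z.2| with hσ
    have hmeas : Measurable fun z : ℝ × ℝ => |z.1 - z.2| := by fun_prop
    have : IsProbabilityMeasure σ := Measure.isProbabilityMeasure_map hmeas.aemeasurable
    have hσG : σ.real (Set.Icc 1 (8 * √M)) =
        (lam.prod lam).real {z | |z.1 - z.2| ∈ Set.Icc 1 (8 * √M)} := by
      rw [hσ, map_measureReal_apply hmeas measurableSet_Icc]; rfl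
    -- The factor 1/2 comes from (1 - |φ|²)/2. Restricting to the window only discards a nonnegative
    -- integral, and leaves mass at least (1/2)·1/(32M).
    refine ⟨(2⁻¹ : ENNReal) • σ.restrict (Set.Icc 1 (8 * √M)), ?_, ?_, ?_, ?_⟩
    · rw [measureReal_ennreal_smul_apply, measureReal_restrict_apply_univ, hσG]
      have h5 := le_measureReal_abs_sub_mem hM h4 h2 h1 hmean hvar hmom
      have h6 : 1 / (64 * M) = 2⁻¹ * (1 / (32 * M)) := by field_simp; norm_num
      rw [h6]
      simp only [ENNReal.toReal_inv, ENNReal.toReal_ofNat]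
      gcongr
    · rw [Measure.smul_apply, smul_eq_mul]
      refine mul_le_one' ?_ ?_
      · simp
      · rw [Measure.restrict_apply_univ]; exact prob_le_one
    · exact Measure.ae_smul_measure (ae_restrict_mem measurableSet_Icc) _
    · intro s
      refine (norm_charFun_sparsify_le hp hp1 s).trans (Real.exp_le_exp.mpr ?_)
      rw [neg_mul, neg_mul, neg_le_neg_iff]
      refine mul_le_mul_of_nonneg_left ?_ hp
      rw [integral_smul_measure, one_sub_norm_charFun_sq]
      have hintg : Integrable (fun x : ℝ => 1 - Real.cos (s * x)) σ := by
        refine (integrable_const _).sub (Integrable.mono' (integrable_const (1 : ℝ)) (by fun_prop)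
          (Filter.Eventually.of_forall fun x => Real.abs_cos_le_one _))
      have h5 : ∫ z : ℝ × ℝ, (1 - Real.cos (s * |z.1 - z.2|)) ∂lam.prod lam =
          ∫ x, (1 - Real.cos (s * x)) ∂σ := by
        rw [hσ, integral_map hmeas.aemeasurable (by fun_prop)]
      have h6 := setIntegral_le_integral (s := Set.Icc 1 (8 * √M)) hintg
        (Filter.Eventually.of_forall fun x => sub_nonneg.mpr (Real.cos_le_one _))
      rw [h5]
      simp only [ENNReal.toReal_inv, ENNReal.toReal_ofNat, smul_eq_mul]
      linarith

end entry

/-! ### The smallest singular value -/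

theorem opBound_of_norm_le {n : ℕ} (A : Matrix (Fin n) (Fin n) ℝ) {a : ℝ} (h : ‖A‖ ≤ a) :
    OpBound (fun i j => A i j) a := by
  intro x
  have h1 := A.l2_opNorm_mulVec (WithLp.toLp 2 x)
  rw [l2_eq_norm, l2_eq_norm]
  exact h1.trans (by gcongr)

theorem opBound_transpose_of_norm_le {n : ℕ} (A : Matrix (Fin n) (Fin n) ℝ) {a : ℝ} (h : ‖A‖ ≤ a) :
    OpBound (fun i j => A j i) a := by
  refine opBound_of_norm_le A.transpose ?_
  rwa [← Matrix.conjTranspose_eq_transpose_of_trivial, Matrix.l2_opNorm_conjTranspose]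

/-- The infimum over the compact sphere is attained; n > 0 makes the sphere nonempty. -/
theorem exists_l2_app_le_of_sMin_le {n : ℕ} (hn : 0 < n) (A : Matrix (Fin n) (Fin n) ℝ) {τ : ℝ}
    (h : sMin A ≤ τ) : ∃ x, l2 x = 1 ∧ l2 (app (fun i j => A i j) x) ≤ τ := by
  have : Nonempty (Fin n) := ⟨⟨0, hn⟩⟩
  have hne : (Metric.sphere (0 : EuclideanSpace ℝ (Fin n)) 1).Nonempty :=
    NormedSpace.sphere_nonempty.mpr zero_le_one
  have hcont : Continuous fun x : EuclideanSpace ℝ (Fin n) => ‖Matrix.toEuclideanLin A x‖ :=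
    (LinearMap.continuous_of_finiteDimensional _).norm
  obtain ⟨x, hx, hxA⟩ := ((isCompact_sphere _ _).image hcont).sInf_mem (hne.image _)
  refine ⟨x.ofLp, ?_, ?_⟩
  · rw [l2_eq_norm]; simpa using hx
  · rw [l2_eq_norm]
    refine le_trans (le_of_eq ?_) h
    rw [sMin, ← hxA]
    rfl

/-- Off-diagonal products, and the constants `d i` on the diagonal. -/
noncomputable def shiftedEntry {Ω : Type*} {n : ℕ} (δ ξ : OffDiag n → Ω → ℝ) (d : Fin n → ℝ)
    (i j : Fin n) (ω : Ω) : ℝ :=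
  if h : i ≠ j then δ ⟨(i, j), h⟩ ω * ξ ⟨(i, j), h⟩ ω else d i

theorem shiftedEntry_eq {Ω : Type*} {n : ℕ} (δ ξ : OffDiag n → Ω → ℝ) (d : Fin n → ℝ)
    (i j : Fin n) (ω : Ω) : shiftedEntry δ ξ d i j ω =
      (zeroDiagMatrix (fun e => δ e ω) (fun e => ξ e ω) + Matrix.diagonal d) i j := by
  by_cases h : i = j
  · subst h; simp [shiftedEntry, zeroDiagMatrix]
  · simp [shiftedEntry, zeroDiagMatrix, h]

section shiftedEntry

variable {Ω : Type*} [MeasurableSpace Ω] {μ : Measure Ω} {n : ℕ} {δ ξ : OffDiag n → Ω → ℝ}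
  {d : Fin n → ℝ}

theorem measurable_shiftedEntry (hδ : ∀ e, Measurable (δ e)) (hξ : ∀ e, Measurable (ξ e))
    (i j : Fin n) : Measurable (shiftedEntry δ ξ d i j) := by
  unfold shiftedEntry
  by_cases h : i = j
  · simp [h]
  · simp only [ne_eq, h, not_false_eq_true, dite_true]
    exact (hδ _).mul (hξ _)

theorem iIndepFun_shiftedEntry (hδ : ∀ e, Measurable (δ e)) (hξ : ∀ e, Measurable (ξ e))
    (h : iIndepFun (Sum.elim δ ξ) μ) :
    iIndepFun (fun q : Fin n × Fin n => shiftedEntry δ ξ d q.1 q.2) μ :=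
  iIndepFun_dite_const (P := fun q : Fin n × Fin n => q.1 ≠ q.2) (fun e => (hδ e).mul (hξ e))
    (iIndepFun_mul_of_sum_elim hδ hξ h) fun q => d q.1

theorem map_shiftedEntry [IsProbabilityMeasure μ] {ν : Measure ℝ}
    (hν : ∀ e, μ.map (fun ω => δ e ω * ξ e ω) = ν) (i j : Fin n) :
    μ.map (shiftedEntry δ ξ d i j) = entryLaw ν i (d i) j := by
  unfold entryLaw
  by_cases h : i = j
  · subst h
    have : shiftedEntry δ ξ d i i = fun _ => d i := by ext; simp [shiftedEntry]
    rw [this, Measure.map_const]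
    simp
  · have : shiftedEntry δ ξ d i j = fun ω => δ ⟨(i, j), h⟩ ω * ξ ⟨(i, j), h⟩ ω := by
      ext; simp [shiftedEntry, h]
    rw [this, hν, if_neg (Ne.symm h)]

theorem map_shiftedEntry_transpose [IsProbabilityMeasure μ] {ν : Measure ℝ}
    (hν : ∀ e, μ.map (fun ω => δ e ω * ξ e ω) = ν) (i j : Fin n) :
    μ.map (shiftedEntry δ ξ d j i) = entryLaw ν i (d i) j := by
  rw [map_shiftedEntry hν]
  unfold entryLaw
  by_cases h : i = j
  · subst h; rfl
  · rw [if_neg h, if_neg (Ne.symm h)]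

end shiftedEntry

theorem sparseLaw_sparsify_map {Ω : Type*} [MeasurableSpace Ω] {μ : Measure Ω} [IsProbabilityMeasure μ]
    {ξ : Ω → ℝ} (hξ : Measurable ξ) (h4 : MemLp ξ 4 μ) (hmean : ∫ ω, ξ ω ∂μ = 0)
    (hvar : variance ξ μ = 1) {M p : ℝ} (hM : 1 ≤ M) (hmom : ∫ ω, ξ ω ^ 4 ∂μ ≤ M) (hp : 0 ≤ p)
    (hp1 : p ≤ 1) : SparseLaw (sparsify p (μ.map ξ)) p (1 / (64 * M)) (8 * √M) := by
  have : IsProbabilityMeasure (μ.map ξ) := Measure.isProbabilityMeasure_map hξ.aemeasurable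
  have hL : MemLp (fun x : ℝ => x) 4 (μ.map ξ) :=
    (memLp_map_measure_iff (by fun_prop) hξ.aemeasurable).mpr h4
  have hL2 : MemLp (fun x : ℝ => x) 2 (μ.map ξ) := hL.mono_exponent (by norm_num)
  have hint4 : Integrable (fun x : ℝ => x ^ 4) (μ.map ξ) := by
    have h1 := MemLp.integrable_norm_pow (p := 4) hL (by norm_num)
    simpa [Even.pow_abs (show Even 4 by decide)] using h1
  have hmap : ∀ k : ℕ, ∫ x, x ^ k ∂μ.map ξ = ∫ ω, ξ ω ^ k ∂μ := fun k =>
    integral_map hξ.aemeasurable (by fun_prop)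
  refine sparseLaw_sparsify hp hp1 hM hint4 hL2.integrable_sq (hL.integrable (by norm_num)) ?_ ?_ ?_
  · have := hmap 1
    simp only [pow_one] at this
    rw [this, hmean]
  · rw [hmap, ← hvar, variance_of_integral_eq_zero hξ.aemeasurable hmean]
  · rw [hmap]; exact hmom

/-- The norm on matrices is the Euclidean operator norm. The constants depend only on `K`, `R` and
a bound `M` for the fourth moment of the `ξ e`. -/
theorem theorem1p1 (K : ℝ) (hK : 1 ≤ K) (R : ℝ) (hR : 0 < R) (M : ℝ) :
    ∃ c c' C Cbar : ℝ, 0 < c ∧ 0 < c' ∧ 0 < C ∧ 0 < Cbar ∧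
      ∀ (n : ℕ), 2 ≤ n →
      ∀ (p : ℝ) (hp : p ∈ Set.Ioc (0 : ℝ) 1), Cbar * Real.log n / n ≤ p →
      ∀ (Ω : Type*) [MeasurableSpace Ω] (μ : Measure Ω) [IsProbabilityMeasure μ]
        (δ ξ : OffDiag n → Ω → ℝ),
        (∀ e, Measurable (δ e)) → (∀ e, Measurable (ξ e)) →
        -- all the `δ e` and all the `ξ e` together are mutually independent
        iIndepFun (Sum.elim δ ξ) μ →
        (∀ e, HasLaw (δ e) (bernoulliMeasure (1 : ℝ) 0 ⟨p, hp.1.le, hp.2⟩) μ) →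
        (∀ e e', IdentDistrib (ξ e) (ξ e') μ μ) →
        (∀ e, MemLp (ξ e) 4 μ) →
        (∀ e, ∫ ω, ξ e ω ∂μ = 0) →
        (∀ e, variance (ξ e) μ = 1) →
        (∀ e, ∫ ω, ξ e ω ^ 4 ∂μ ≤ M) →
      ∀ (d : Fin n → ℝ), ‖Matrix.diagonal d‖ ≤ R * √(n * p) →
      ∀ (ε : ℝ), 0 < ε →
        μ.real
          ({ω | sMin (zeroDiagMatrix (fun e => δ e ω) (fun e => ξ e ω) + Matrix.diagonal d) ≤
              C * ε * Real.exp (-c * (Real.log (1 / p) / Real.log (n * p))) * √(p / n)} ∩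
            {ω | ‖zeroDiagMatrix (fun e => δ e ω) (fun e => ξ e ω)‖ ≤ K * √(n * p)}) ≤
          ε + Real.exp (-c' * (n * p)) := by
  -- No lower bound on `M` is assumed, whereas the estimates for the entry law use a fourth moment
  -- bound of at least one.
  set M' := max M 1 with hM'
  have hM1 : 1 ≤ M' := le_max_right _ _
  have hM0 : 0 < M' := by linarith
  have hκ1 : 1 / (64 * M') ≤ 1 := by rw [div_le_one (by positivity)]; linarith
  have hB : 1 ≤ 8 * √M' := by
    have := Real.one_le_sqrt.mpr hM1
    linarith
  -- The diagonal becomes part of the matrix, so its norm bound is added to `K`.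
  obtain ⟨c, c', C, C₀, hc, hc', hC, hC₀, hmain⟩ :=
    exists_almostNull_le (κ := 1 / (64 * M')) (K := K + R) (by positivity) hκ1 hB (by linarith)
  have hlog2 : 0 < Real.log 2 := Real.log_pos (by norm_num)
  -- As n ≥ 2 and log 2 < 1, this single condition yields both C₀ ≤ np and C₀ log n ≤ np.
  refine ⟨c, c', C, C₀ / Real.log 2, hc, hc', hC, by positivity, ?_⟩
  intro n hn p hp hnp Ω _ μ _ δ ξ hδ hξ hind hber hident hL4 hmean hvar hmom d hd ε hε
  have hn2 : (2 : ℝ) ≤ n := by exact_mod_cast hn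
  have hn0 : (0 : ℝ) < n := by linarith
  have hlogn : Real.log 2 ≤ Real.log n := Real.log_le_log (by norm_num) hn2
  have hT : C₀ / Real.log 2 * Real.log n ≤ n * p := by
    rw [div_le_iff₀ hn0] at hnp; linarith
  have hT1 : C₀ ≤ n * p := by
    refine le_trans ?_ hT
    rw [div_mul_eq_mul_div, le_div_iff₀ hlog2]
    gcongr
  have hT2 : C₀ * Real.log n ≤ n * p := by
    refine le_trans ?_ hT
    refine mul_le_mul_of_nonneg_right ?_ (by linarith)
    rw [le_div_iff₀ hlog2]
    exact mul_le_of_le_one_right hC₀.le (by linarith [Real.log_two_lt_d9])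
  let e₀ : OffDiag n := ⟨(⟨0, by omega⟩, ⟨1, by omega⟩), by simp⟩
  have hν : ∀ e, μ.map (fun ω => δ e ω * ξ e ω) = sparsify p (μ.map (ξ e₀)) := by
    intro e
    have h1 : IndepFun (δ e) (ξ e) μ := hind.indepFun (i := Sum.inl e) (j := Sum.inr e) (by simp)
    rw [map_mul_eq_sparsify _ (hδ e) (hξ e) h1 (hber e), (hident e e₀).map_eq]
  have hsparse : SparseLaw (sparsify p (μ.map (ξ e₀))) p (1 / (64 * M')) (8 * √M') :=
    sparseLaw_sparsify_map (hξ e₀) (hL4 e₀) (hmean e₀) (hvar e₀) hM1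
      ((hmom e₀).trans (le_max_left _ _)) hp.1.le hp.2
  have hmeas := measurable_shiftedEntry (d := d) hδ hξ
  have hindX := iIndepFun_shiftedEntry (d := d) hδ hξ hind
  have h1 := hmain p hp.1 hp.2 _ hsparse n hT1 hT2 Ω μ (fun ω i j => shiftedEntry δ ξ d i j ω) d
    (measurable_pi_lambda _ fun i => measurable_pi_lambda _ fun j => hmeas i j)
    (map_eq_matLaw hmeas hindX (map_shiftedEntry hν))
    (map_eq_matLaw (X := fun i j => shiftedEntry δ ξ d j i) (fun i j => hmeas j i)
      (hindX.precomp (g := Prod.swap) Prod.swap_injective) (map_shiftedEntry_transpose hν)) ε hε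
  refine (measureReal_mono ?_ (measure_ne_top _ _)).trans h1
  rintro ω ⟨hs, hA⟩
  set A := zeroDiagMatrix (fun e => δ e ω) (fun e => ξ e ω) with hAdef
  have hA : ‖A‖ ≤ K * √(n * p) := hA
  have hnorm : ‖A + Matrix.diagonal d‖ ≤ (K + R) * √(n * p) := by
    refine (norm_add_le _ _).trans ?_
    linarith
  refine ⟨?_, ?_, ?_⟩
  · simp only [shiftedEntry_eq]
    exact opBound_of_norm_le _ hnorm
  · simp only [shiftedEntry_eq]
    exact opBound_transpose_of_norm_le _ hnorm
  · simp only [shiftedEntry_eq]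
    exact exists_l2_app_le_of_sMin_le (by omega) _ hs
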